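/- **Setting.** Let $d\in\{2,3\}$ and let $\Omega\subset\mathbb R^d$ be a non-empty bounded convex open set (for instance a convex polygon/polyhedron); $(\cdot,\cdot)$ and $\|\cdot\|$ denote the inner product and norm of $L^2(\Omega)$ or $L^2(\Omega)^d$. Let $\varepsilon,\gamma,\lambda,\mu_0,\mathscr T,\varkappa_0,\nu_w,\nu_f>0$ (interface thickness, mobility, capillary coefficient, permeability, relaxation time, susceptibility, viscosities of the two phases), and let $\nu,\varkappa:\mathbb R\to\mathbb R$ be Lipschitz with $\min\{\nu_w,\nu_f\}\le\nu\le\max\{\nu_w,\nu_f\}$ and $0\le\varkappa\le\varkappa_0$. Let $F(s)=(s+1)^2$ for $s\le-1$, $F(s)=\frac14(s^2-1)^2$ for $|s|\le1$, $F(s)=(s-1)^2$ for $s\ge1$, and $f=F'$. Let $0<\eta\le\varepsilon$ and $t_F>0$. Let $\phi_0$, $m_0$, $u_0$ (with $u_0=0$ on $\partial\Omega$) and the applied field $h_a(t,x)$ be smooth. A discretization with parameter $h>0$ consists of finite dimensional spaces $G_h=Y_h\subset H^1(\Omega)$ containing the constants (phase field and chemical potential), $M_h\subset L^2(\Omega)^d$,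 $U_h\subset H^1_0(\Omega)^d$, $P_h\subset L^2(\Omega)$; trilinear forms $B_h:U_h\times U_h\times U_h\to\mathbb R$ and $B_h^m:U_h\times M_h\times M_h\to\mathbb R$, both skew symmetric in their last two arguments; and linear interpolation operators $I_{G_h}:C(\overline\Omega)\to G_h$, $I_{M_h}:C(\overline\Omega)^d\to M_h$, $I_{U_h}:C(\overline\Omega)^d\to U_h$. For $K\ge1$ put $\tau=t_F/K$, $t^k=k\tau$, $H^k=I_{M_h}[h_a(t^k)]$, $\delta a^k=a^k-a^{k-1}$, $T(U)=\frac12(\nabla U+\nabla U^{\top})$. **Scheme.** Put $\Phi^0=I_{G_h}[\phi_0]$, $M^0=I_{M_h}[m_0]$, $U^0=I_{U_h}[u_0]$. For $k=1,\dots,K$ find $(\Phi^k,\Psi^k,M^k,U^k,P^k)\in G_h\times Y_h\times M_h\times U_h\times P_h$ such that for all $(\Lambda,\Upsilon,Z,V,Q)\in G_h\times Y_h\times M_h\times U_h\times P_h$, with $\nu_k:=\nu(\Phi^{k-1})$ and $\varkappa_k:=\varkappa(\Phi^{k-1})$, $$\tfrac1\tau(\delta\Phi^k,\Lambda)-(U^k\Phi^{k-1},\nabla\Lambda)-\gamma(\nabla\Psi^k,\nabla\Lambda)=0,$$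 $$(\Psi^k,\Upsilon)+\varepsilon(\nabla\Phi^k,\nabla\Upsilon)+\tfrac1\varepsilon(f(\Phi^{k-1}),\Upsilon)+\tfrac1\eta(\delta\Phi^k,\Upsilon)=0,$$ $$\tfrac1\tau(\delta M^k,Z)-B_h^m(U^k,Z,M^k)+\tfrac1{\mathscr T}(M^k,Z)=\tfrac1{\mathscr T}(\varkappa_k H^k,Z),$$ $$\tfrac1\tau(\delta U^k,V)+B_h(U^{k-1},U^k,V)+(\nu_k T(U^k),T(V))-(P^k,\operatorname{div}V)=\mu_0B_h^m(V,H^k,M^k)+\tfrac\lambda\varepsilon(\Phi^{k-1}\nabla\Psi^k,V),$$ $$(Q,\operatorname{div}U^k)=0.$$ **Proposition.** (i) For every discretization, every $K\ge1$ and every $k=1,\dots,K$, the $k$-th step has a solution for arbitrary $(\Phi^{k-1},M^{k-1},U^{k-1})\in G_h\times M_h\times U_h$; in particular the scheme has a solution. There is no restriction on $\varkappa_0$. (ii) Every solution of the scheme satisfies $$\begin{aligned} &\|U^K\|^2+\tfrac{\mu_0}2\|M^K\|^2+\lambda\|\nabla\Phi^K\|^2+\tfrac{2\lambda}{\varepsilon^2}(F(\Phi^K),1)\\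 &+\sum_{k=1}^K\Big(\|\delta U^k\|^2+\mu_0\|\delta M^k\|^2+\lambda\|\delta\nabla\Phi^k\|^2+\tfrac{2\lambda\gamma\tau}{\varepsilon}\|\nabla\Psi^k\|^2\Big)\\ &+\sum_{k=1}^K\Big(2\tau\|\sqrt{\nu_k}\,T(U^k)\|^2+\tfrac{\mu_0\tau}{\mathscr T}\|M^k\|^2+\tfrac{2\mu_0\tau}{\mathscr T}\|\sqrt{\varkappa_k}\,H^k\|^2\Big)\\ &\le\|U^0\|^2+2\mu_0\|M^0\|^2+\lambda\|\nabla\Phi^0\|^2+\tfrac{2\lambda}{\varepsilon^2}(F(\Phi^0),1)+\mu_0\|H^1\|^2+2\mu_0\|H^K\|^2\\ &\quad+\sum_{k=1}^K\tfrac{3\mu_0\tau}{\mathscr T}(1+\varkappa_0^2)\|H^k\|^2+3\mu_0\mathscr T\sum_{k=1}^{K-1}\tau\Big\|\tfrac{\delta H^{k+1}}{\tau}\Big\|^2 . \end{aligned}$$ (iii) Every solution of the scheme conserves mass: $(\Phi^k,1)=(\Phi^0,1)$ for $1\le k\le K$. (iv) For all $c_I$, $h_{\max}$ and integers $\ell_G,\ell_M,\ell_U\ge0$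 there is a constant $c<\infty$, depending only on these, on $\Omega$, $t_F$, $\eta$, the parameters and laws of the model and the data $\phi_0,m_0,u_0,h_a$ (but not on $K$, nor on the discretization), such that $\big(\sum_{k=1}^K\tau\|\Psi^k\|_{H^1(\Omega)}^2\big)^{1/2}\le c$ for every $K\ge1$ and every solution of the scheme with a discretization with $h\le h_{\max}$ whose interpolants satisfy, for all smooth $\varphi$, $\|I_{G_h}\varphi-\varphi\|+h\|\nabla(I_{G_h}\varphi-\varphi)\|\le c_Ih^{\ell_G+1}|\varphi|_{H^{\ell_G+1}(\Omega)}$, $\|I_{M_h}\varphi-\varphi\|\le c_Ih^{\ell_M+1}|\varphi|_{H^{\ell_M+1}(\Omega)}$ and, if $\varphi=0$ on $\partial\Omega$, $\|I_{U_h}\varphi-\varphi\|\le c_Ih^{\ell_U+1}|\varphi|_{H^{\ell_U+1}(\Omega)}$. -/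

import Mathlib

open MeasureTheory
open scoped ContDiff

noncomputable section

namespace FerroScheme

variable {d : ℕ}

/-! ## Function spaces -/

/-- Euclidean space `ℝ^d`. -/
abbrev Sp (d : ℕ) := EuclideanSpace ℝ (Fin d)

/-- Scalar `L²(Ω)`. -/
abbrev L2 (Ω : Set (Sp d)) := Lp ℝ 2 ((volume : Measure (Sp d)).restrict Ω)

/-- Vector valued `L²(Ω)^d` (Euclidean norm on the fibres). -/
abbrev L2v (Ω : Set (Sp d)) := Lp (Sp d) 2 ((volume : Measure (Sp d)).restrict Ω)

/-- Classical partial derivative `∂_i φ`. -/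
def pderiv (i : Fin d) (φ : Sp d → ℝ) (x : Sp d) : ℝ :=
  fderiv ℝ φ x (EuclideanSpace.single i 1)

/-- Test functions `φ ∈ C_c^∞(Ω)`. -/
structure IsTest (Ω : Set (Sp d)) (φ : Sp d → ℝ) : Prop where
  smooth : ContDiff ℝ ∞ φ
  compact : HasCompactSupport φ
  supp : tsupport φ ⊆ Ω

/-- `g` is the weak gradient of `u` in `Ω`. -/
def IsWeakGrad (Ω : Set (Sp d)) (u : L2 Ω) (g : L2v Ω) : Prop :=
  ∀ φ : Sp d → ℝ, IsTest Ω φ → ∀ i : Fin d,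
    ∫ x in Ω, u x * pderiv i φ x = - ∫ x in Ω, g x i * φ x

theorem IsTest.memLp {Ω : Set (Sp d)} {φ : Sp d → ℝ} (h : IsTest Ω φ) :
    MemLp φ 2 ((volume : Measure (Sp d)).restrict Ω) :=
  (h.smooth.continuous.memLp_of_hasCompactSupport h.compact).restrict Ω

theorem IsTest.memLp_pderiv {Ω : Set (Sp d)} {φ : Sp d → ℝ} (h : IsTest Ω φ) (i : Fin d) :
    MemLp (pderiv i φ) 2 ((volume : Measure (Sp d)).restrict Ω) := by
  have hc : Continuous (pderiv i φ) :=
    (h.smooth.continuous_fderiv (by simp)).clm_apply continuous_const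
  have hs : HasCompactSupport (pderiv i φ) :=
    (h.compact.fderiv (𝕜 := ℝ)).comp_left (g := fun L : Sp d →L[ℝ] ℝ =>
      L (EuclideanSpace.single i 1)) (by simp)
  exact (hc.memLp_of_hasCompactSupport hs).restrict Ω

theorem memLp_coord {Ω : Set (Sp d)} (g : L2v Ω) (i : Fin d) :
    MemLp (fun x => g x i) 2 ((volume : Measure (Sp d)).restrict Ω) :=
  (EuclideanSpace.proj (𝕜 := ℝ) i : Sp d →L[ℝ] ℝ).comp_memLp' (Lp.memLp g)

/-- The graph of the weak gradient: all pairs `(u, ∇u)` with `u ∈ L²(Ω)` and weak gradient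
`∇u ∈ L²(Ω)^d`. -/
def H1graph (Ω : Set (Sp d)) : Submodule ℝ (L2 Ω × L2v Ω) where
  carrier := {p | IsWeakGrad Ω p.1 p.2}
  zero_mem' := by
    intro φ _ i
    have h1 : ∫ x in Ω, ((0 : L2 Ω) : Sp d → ℝ) x * pderiv i φ x = 0 := by
      refine integral_eq_zero_of_ae ?_
      filter_upwards [Lp.coeFn_zero ℝ 2 ((volume : Measure (Sp d)).restrict Ω)] with x hx
      rw [hx]
      simp
    have h2 : ∫ x in Ω, ((0 : L2v Ω) : Sp d → Sp d) x i * φ x = 0 := by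
      refine integral_eq_zero_of_ae ?_
      filter_upwards [Lp.coeFn_zero (Sp d) 2 ((volume : Measure (Sp d)).restrict Ω)] with x hx
      rw [hx]
      simp
    change ∫ x in Ω, ((0 : L2 Ω) : Sp d → ℝ) x * pderiv i φ x
      = - ∫ x in Ω, ((0 : L2v Ω) : Sp d → Sp d) x i * φ x
    rw [h1, h2, neg_zero]
  add_mem' := by
    rintro ⟨u, g⟩ ⟨v, k⟩ hu hv φ hφ i
    have e1 : ∫ x in Ω, ((u + v : L2 Ω) : Sp d → ℝ) x * pderiv i φ x
        = (∫ x in Ω, u x * pderiv i φ x) + ∫ x in Ω, v x * pderiv i φ x := by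
      refine Eq.trans ?_ (integral_add ((Lp.memLp u).integrable_mul (hφ.memLp_pderiv i))
        ((Lp.memLp v).integrable_mul (hφ.memLp_pderiv i)))
      refine integral_congr_ae ?_
      filter_upwards [Lp.coeFn_add u v] with x hx
      simp only [hx, Pi.add_apply, add_mul]
    have e2 : ∫ x in Ω, ((g + k : L2v Ω) : Sp d → Sp d) x i * φ x
        = (∫ x in Ω, g x i * φ x) + ∫ x in Ω, k x i * φ x := by
      refine Eq.trans ?_ (integral_add ((memLp_coord g i).integrable_mul hφ.memLp)
        ((memLp_coord k i).integrable_mul hφ.memLp))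
      refine integral_congr_ae ?_
      filter_upwards [Lp.coeFn_add g k] with x hx
      simp only [hx, Pi.add_apply, PiLp.add_apply, add_mul]
    have a := hu φ hφ i
    have b := hv φ hφ i
    simp only at a b
    change ∫ x in Ω, ((u + v : L2 Ω) : Sp d → ℝ) x * pderiv i φ x
      = - ∫ x in Ω, ((g + k : L2v Ω) : Sp d → Sp d) x i * φ x
    rw [e1, e2, a, b]
    ring
  smul_mem' := by
    rintro c ⟨u, g⟩ hu φ hφ i
    have e1 : ∫ x in Ω, ((c • u : L2 Ω) : Sp d → ℝ) x * pderiv i φ x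
        = c * ∫ x in Ω, u x * pderiv i φ x := by
      rw [← integral_const_mul]
      refine integral_congr_ae ?_
      filter_upwards [Lp.coeFn_smul c u] with x hx
      simp only [hx, Pi.smul_apply, smul_eq_mul, mul_assoc]
    have e2 : ∫ x in Ω, ((c • g : L2v Ω) : Sp d → Sp d) x i * φ x
        = c * ∫ x in Ω, g x i * φ x := by
      rw [← integral_const_mul]
      refine integral_congr_ae ?_
      filter_upwards [Lp.coeFn_smul c g] with x hx
      simp only [hx, Pi.smul_apply, PiLp.smul_apply, smul_eq_mul, mul_assoc]
    have a := hu φ hφ i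
    simp only at a
    change ∫ x in Ω, ((c • u : L2 Ω) : Sp d → ℝ) x * pderiv i φ x
      = - ∫ x in Ω, ((c • g : L2v Ω) : Sp d → Sp d) x i * φ x
    rw [e1, e2, a]
    ring

/-- The Sobolev space `H¹(Ω)`, realised as the space of all pairs `(u, ∇u)` with `u ∈ L²(Ω)`
and weak gradient `∇u ∈ L²(Ω)^d` (the second entry is determined by the first one). -/
def H1 (Ω : Set (Sp d)) : Type := ↥(H1graph Ω)

instance (Ω : Set (Sp d)) : AddCommGroup (H1 Ω) := inferInstanceAs (AddCommGroup ↥(H1graph Ω))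

instance (Ω : Set (Sp d)) : Module ℝ (H1 Ω) := inferInstanceAs (Module ℝ ↥(H1graph Ω))

/-- The `L²` function underlying an element of `H¹(Ω)`. -/
def fn {Ω : Set (Sp d)} : H1 Ω →ₗ[ℝ] L2 Ω :=
  (LinearMap.fst ℝ (L2 Ω) (L2v Ω)).comp (H1graph Ω).subtype

/-- The weak gradient of an element of `H¹(Ω)`. -/
def grad {Ω : Set (Sp d)} : H1 Ω →ₗ[ℝ] L2v Ω :=
  (LinearMap.snd ℝ (L2 Ω) (L2v Ω)).comp (H1graph Ω).subtype

/-- `H¹(Ω)^d`. -/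
def H1v (Ω : Set (Sp d)) : Type := Fin d → H1 Ω

instance (Ω : Set (Sp d)) : AddCommGroup (H1v Ω) := inferInstanceAs (AddCommGroup (Fin d → H1 Ω))

instance (Ω : Set (Sp d)) : Module ℝ (H1v Ω) := inferInstanceAs (Module ℝ (Fin d → H1 Ω))

/-- The `i`-th component of a vector field in `H¹(Ω)^d`. -/
def comp {Ω : Set (Sp d)} (i : Fin d) : H1v Ω →ₗ[ℝ] H1 Ω :=
  LinearMap.proj (R := ℝ) (φ := fun _ : Fin d => H1 Ω) i

/-- `H¹₀(Ω)`: the closure of `C_c^∞(Ω)` with respect to the `H¹` norm, as a set of pairs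
`(u, ∇u)`. -/
def H10 (Ω : Set (Sp d)) : Set (L2 Ω × L2v Ω) :=
  closure {p | ∃ φ : Sp d → ℝ, IsTest Ω φ ∧
    p.1 =ᵐ[(volume : Measure (Sp d)).restrict Ω] φ ∧
    ∀ i : Fin d, (fun x => p.2 x i) =ᵐ[(volume : Measure (Sp d)).restrict Ω] pderiv i φ}

/-- Divergence of a vector field with components in `H¹(Ω)`. -/
def divg {Ω : Set (Sp d)} (U : H1v Ω) (x : Sp d) : ℝ := ∑ i, grad (comp i U) x i

/-- Entry `(i, j)` of the symmetric gradient `T(U) = (∇U + ∇Uᵀ) / 2`. -/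
def symGrad {Ω : Set (Sp d)} (U : H1v Ω) (i j : Fin d) (x : Sp d) : ℝ :=
  (grad (comp i U) x j + grad (comp j U) x i) / 2

/-- `L²(Ω)^d` inner product of two vector fields with components in `H¹(Ω)`. -/
def ipV {Ω : Set (Sp d)} (U V : H1v Ω) : ℝ := ∑ i, inner ℝ (fn (comp i U)) (fn (comp i V))

/-- `L²(Ω)` norm of a function. -/
def l2norm {F : Type*} [NormedAddCommGroup F] (Ω : Set (Sp d)) (f : Sp d → F) : ℝ :=
  (eLpNorm f 2 ((volume : Measure (Sp d)).restrict Ω)).toReal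

/-! ## The model -/

/-- Truncated double well potential. -/
def dwF (s : ℝ) : ℝ :=
  if s ≤ -1 then (s + 1) ^ 2 else if s ≤ 1 then (s ^ 2 - 1) ^ 2 / 4 else (s - 1) ^ 2

/-- `f = F'`. -/
def dwf : ℝ → ℝ := deriv dwF

/-- Constitutive parameters: interface thickness `ε`, mobility `γ`, capillary coefficient `lam`,
permeability `μ₀`, relaxation time `trel`, susceptibility `κ₀`, viscosities `νw`, `νf` of the two
phases, and the Lipschitz laws `ν(φ)`, `κ(φ)`. -/
structure Params where
  ε : ℝ
  γ : ℝ
  lam : ℝ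
  μ₀ : ℝ
  trel : ℝ
  κ₀ : ℝ
  νw : ℝ
  νf : ℝ
  ν : ℝ → ℝ
  κ : ℝ → ℝ
  ε_pos : 0 < ε
  γ_pos : 0 < γ
  lam_pos : 0 < lam
  μ₀_pos : 0 < μ₀
  trel_pos : 0 < trel
  κ₀_pos : 0 < κ₀
  νw_pos : 0 < νw
  νf_pos : 0 < νf
  ν_lip : ∃ L, LipschitzWith L ν
  κ_lip : ∃ L, LipschitzWith L κ
  ν_bounds : ∀ s, min νw νf ≤ ν s ∧ ν s ≤ max νw νf
  κ_bounds : ∀ s, 0 ≤ κ s ∧ κ s ≤ κ₀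

/-- Smooth data: initial phase field, magnetization and velocity (the latter with zero boundary
values), and the applied magnetic field `h_a(t, x)`. -/
structure SmoothData (Ω : Set (Sp d)) where
  φ0 : C(Sp d, ℝ)
  m0 : C(Sp d, Sp d)
  u0 : C(Sp d, Sp d)
  ha : ℝ → C(Sp d, Sp d)
  φ0_smooth : ContDiff ℝ ∞ φ0
  m0_smooth : ContDiff ℝ ∞ m0
  u0_smooth : ContDiff ℝ ∞ u0
  u0_bdry : ∀ x ∈ frontier Ω, u0 x = 0
  ha_smooth : ContDiff ℝ ∞ (fun p : ℝ × Sp d => ha p.1 p.2)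

/-! ## The discretization -/

/-- A space discretization: finite dimensional spaces `G` (phase field) and `Y` (chemical
potential) in `H¹(Ω)`, which coincide and contain the constants, `M ⊂ L²(Ω)^d` (magnetization),
`U ⊂ H¹₀(Ω)^d` (velocity) and `P ⊂ L²(Ω)` (pressure); trilinear forms `Bh` and `Bm` that are skew
symmetric in their last two arguments; linear interpolation operators. -/
structure Discretization (Ω : Set (Sp d)) where
  h : ℝ
  h_pos : 0 < h
  G : Submodule ℝ (H1 Ω)
  Y : Submodule ℝ (H1 Ω)
  M : Submodule ℝ (L2v Ω)
  U : Submodule ℝ (H1v Ω)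
  P : Submodule ℝ (L2 Ω)
  finG : FiniteDimensional ℝ G
  finM : FiniteDimensional ℝ M
  finU : FiniteDimensional ℝ U
  finP : FiniteDimensional ℝ P
  Y_eq : Y = G
  one_mem : ∃ g ∈ G, fn g =ᵐ[(volume : Measure (Sp d)).restrict Ω] fun _ => (1 : ℝ)
  U_zero : ∀ u ∈ U, ∀ i, (fn (comp i u), grad (comp i u)) ∈ H10 Ω
  Bh : U →ₗ[ℝ] U →ₗ[ℝ] U →ₗ[ℝ] ℝ
  Bm : U →ₗ[ℝ] M →ₗ[ℝ] M →ₗ[ℝ] ℝ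
  Bh_skew : ∀ u v w, Bh u v w = - Bh u w v
  Bm_skew : ∀ u v w, Bm u v w = - Bm u w v
  IG : C(closure Ω, ℝ) →ₗ[ℝ] G
  IM : C(closure Ω, Sp d) →ₗ[ℝ] M
  IU : C(closure Ω, Sp d) →ₗ[ℝ] U

/-- Optimal approximation of smooth functions by the interpolants, with constant `c` and orders
`lG + 1`, `lM + 1`, `lU + 1`; the seminorm on the right is that of `H^{l+1}(Ω)`. As the velocity
space consists of functions vanishing on the boundary, only such functions are considered
there. -/
structure Discretization.Approximates {Ω : Set (Sp d)} (D : Discretization Ω)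
    (c : ℝ) (lG lM lU : ℕ) : Prop where
  approxG : ∀ φ : C(Sp d, ℝ), ContDiff ℝ ∞ φ →
    l2norm Ω (fun x => fn (D.IG (φ.restrict (closure Ω)) : H1 Ω) x - φ x)
      + D.h * l2norm Ω (fun x => grad (D.IG (φ.restrict (closure Ω)) : H1 Ω) x - gradient φ x)
      ≤ c * D.h ^ (lG + 1) * l2norm Ω (iteratedFDeriv ℝ (lG + 1) φ)
  approxM : ∀ φ : C(Sp d, Sp d), ContDiff ℝ ∞ φ →
    l2norm Ω (fun x => (D.IM (φ.restrict (closure Ω)) : L2v Ω) x - φ x)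
      ≤ c * D.h ^ (lM + 1) * l2norm Ω (iteratedFDeriv ℝ (lM + 1) φ)
  approxU : ∀ φ : C(Sp d, Sp d), ContDiff ℝ ∞ φ → (∀ x ∈ frontier Ω, φ x = 0) →
    l2norm Ω (fun x => WithLp.toLp 2
        (fun i => fn (comp i (D.IU (φ.restrict (closure Ω)) : H1v Ω)) x) - φ x)
      ≤ c * D.h ^ (lU + 1) * l2norm Ω (iteratedFDeriv ℝ (lU + 1) φ)

/-- The unknowns at one time level: phase field, chemical potential, magnetization, velocity,
pressure. -/
structure State {Ω : Set (Sp d)} (D : Discretization Ω) where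
  Φ : D.G
  Ψ : D.Y
  M : D.M
  U : D.U
  P : D.P

/-- One step of the scheme: `s` solves the discrete equations with previous time level `s'`,
time step `τ`, stabilization parameter `η` and magnetic field `H`. -/
structure IsStep {Ω : Set (Sp d)} (D : Discretization Ω) (p : Params) (η τ : ℝ) (H : D.M)
    (s' s : State D) : Prop where
  phase : ∀ Λ : D.G,
    inner ℝ (fn ((s.Φ - s'.Φ : D.G) : H1 Ω)) (fn (Λ : H1 Ω)) / τ
      - (∫ x in Ω, fn (s'.Φ : H1 Ω) x *
          ∑ i, fn (comp i (s.U : H1v Ω)) x * grad (Λ : H1 Ω) x i)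
      - p.γ * inner ℝ (grad (s.Ψ : H1 Ω)) (grad (Λ : H1 Ω)) = 0
  chemical : ∀ χ : D.Y,
    inner ℝ (fn (s.Ψ : H1 Ω)) (fn (χ : H1 Ω))
      + p.ε * inner ℝ (grad (s.Φ : H1 Ω)) (grad (χ : H1 Ω))
      + (1 / p.ε) * (∫ x in Ω, dwf (fn (s'.Φ : H1 Ω) x) * fn (χ : H1 Ω) x)
      + (1 / η) * inner ℝ (fn ((s.Φ - s'.Φ : D.G) : H1 Ω)) (fn (χ : H1 Ω)) = 0
  magnetization : ∀ Z : D.M,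
    inner ℝ ((s.M - s'.M : D.M) : L2v Ω) (Z : L2v Ω) / τ
      - D.Bm s.U Z s.M
      + (1 / p.trel) * inner ℝ (s.M : L2v Ω) (Z : L2v Ω)
      = (1 / p.trel) * ∫ x in Ω, p.κ (fn (s'.Φ : H1 Ω) x) *
          inner ℝ ((H : L2v Ω) x) ((Z : L2v Ω) x)
  momentum : ∀ V : D.U,
    ipV ((s.U - s'.U : D.U) : H1v Ω) (V : H1v Ω) / τ
      + D.Bh s'.U s.U V
      + (∫ x in Ω, p.ν (fn (s'.Φ : H1 Ω) x) *
          ∑ i, ∑ j, symGrad (s.U : H1v Ω) i j x * symGrad (V : H1v Ω) i j x)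
      - (∫ x in Ω, (s.P : L2 Ω) x * divg (V : H1v Ω) x)
      = p.μ₀ * D.Bm V H s.M
        + (p.lam / p.ε) * ∫ x in Ω, fn (s'.Φ : H1 Ω) x *
            ∑ i, grad (s.Ψ : H1 Ω) x i * fn (comp i (V : H1v Ω)) x
  incompressible : ∀ Q : D.P,
    ∫ x in Ω, (Q : L2 Ω) x * divg (s.U : H1v Ω) x = 0

/-- The discrete magnetic field `H^k = I_M[h_a(t^k)]`, `t^k = k τ`. -/
def Hk {Ω : Set (Sp d)} (D : Discretization Ω) (dat : SmoothData Ω) (τ : ℝ) (k : ℕ) : D.M :=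
  D.IM ((dat.ha (k * τ)).restrict (closure Ω))

/-- `s 0, …, s K` is a solution of the scheme with `K` steps of length `τ = tF / K`, started from
the interpolated initial data. (The chemical potential and pressure of `s 0` play no role.) -/
structure IsSolution {Ω : Set (Sp d)} (D : Discretization Ω) (p : Params) (η tF : ℝ)
    (dat : SmoothData Ω) (K : ℕ) (s : ℕ → State D) : Prop where
  initΦ : (s 0).Φ = D.IG (dat.φ0.restrict (closure Ω))
  initM : (s 0).M = D.IM (dat.m0.restrict (closure Ω))
  initU : (s 0).U = D.IU (dat.u0.restrict (closure Ω))
  step : ∀ k ∈ Finset.Icc 1 K, IsStep D p η (tF / K) (Hk D dat (tF / K) k) (s (k - 1)) (s k)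

/-- The terms of the discrete energy other than the magnetic one:
`‖U‖² + λ ‖∇Φ‖² + (2 λ / ε²) (F(Φ), 1)`. -/
def energy {Ω : Set (Sp d)} {D : Discretization Ω} (p : Params) (s : State D) : ℝ :=
  ipV (s.U : H1v Ω) (s.U : H1v Ω) + p.lam * ‖grad (s.Φ : H1 Ω)‖ ^ 2
    + (2 * p.lam / p.ε ^ 2) * ∫ x in Ω, dwF (fn (s.Φ : H1 Ω) x)

/-- The sum of the numerical and the physical dissipation in one time step. -/
def dissipation {Ω : Set (Sp d)} {D : Discretization Ω} (p : Params) (τ : ℝ) (H : D.M)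
    (s' s : State D) : ℝ :=
  ipV ((s.U - s'.U : D.U) : H1v Ω) ((s.U - s'.U : D.U) : H1v Ω)
    + p.μ₀ * ‖((s.M - s'.M : D.M) : L2v Ω)‖ ^ 2
    + p.lam * ‖grad ((s.Φ - s'.Φ : D.G) : H1 Ω)‖ ^ 2
    + (2 * p.lam * p.γ * τ / p.ε) * ‖grad (s.Ψ : H1 Ω)‖ ^ 2
    + 2 * τ * (∫ x in Ω, p.ν (fn (s'.Φ : H1 Ω) x) *
        ∑ i, ∑ j, symGrad (s.U : H1v Ω) i j x ^ 2)
    + (p.μ₀ * τ / p.trel) * ‖(s.M : L2v Ω)‖ ^ 2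
    + (2 * p.μ₀ * τ / p.trel) *
        ∫ x in Ω, p.κ (fn (s'.Φ : H1 Ω) x) * ‖(H : L2v Ω) x‖ ^ 2

/-- The discrete norm `‖Ψ‖_{ℓ²(H¹)}` over the time levels `1, …, K`. -/
def l2H1norm {Ω : Set (Sp d)} {D : Discretization Ω} (τ : ℝ) (K : ℕ) (s : ℕ → State D) : ℝ :=
  Real.sqrt (∑ k ∈ Finset.Icc 1 K,
    τ * (‖fn ((s k).Ψ : H1 Ω)‖ ^ 2 + ‖grad ((s k).Ψ : H1 Ω)‖ ^ 2))

end FerroScheme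

end

open FerroScheme

/-! Solvability of one step. The magnetization is sought as `n + H`. Skew symmetry of `Bm` then
cancels the terms with `H` that couple momentum and magnetization, and the only remaining
nonlinearity, `Bm u Z n`, vanishes on the diagonal `Z = n`; so neither `H` nor `κ₀` has to be small.
On discretely divergence free velocities, suitable multiples of the unknowns as test functions make
the linear part positive definite, and the pressure comes back as a multiplier
(`exists_multiplier`). A definite linear part plus a conservative quadratic term points outwards on
large spheres, hence has a zero (`exists_zero_of_inner_pos`, a form of Brouwer's theorem).
`exists_step_of_forms` puts this together.

The transport term is a bilinear form only if its integrand is integrable, which requires `Φ U ∈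
L²`. This is where `d ≤ 3` and convexity enter. `memLp_sq_fn` bounds `u²` in `W^{1,1}` up to the
boundary: `u` is mollified and multiplied by a cutoff that decreases along rays from an inner ball,
and the divergence theorem for a radial field controls the boundary layer like a trace inequality.
The result is `L⁴` for `d = 2` and `L³` for `d = 3`; in the latter case `H¹₀ ⊂ L⁶` supplies the
missing integrability of `U`.

Energy. Momentum is tested with `U`, the phase equation with `Ψ`, the potential equation with `δΦ`,
the magnetization equation with both `H` and `M`. Transport and capillary work cancel; the test with
`H` turns the magnetic work `Bm U H M` into `(δM, H)`, which is summed by parts. Taking `f`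
explicitly costs `‖δΦ‖²` because `F'' ≤ 2`, and the stabilization pays for it since `η ≤ ε`.

Mass is conserved because constants are admissible tests. For the potential, the dissipation bounds
`∇Ψ` and the test `χ = Ψ` bounds `Ψ` itself; the data terms are uniform by the interpolation
estimates, including time differences of the field because `IM` is linear. -/

namespace FerroScheme

/-! ## Zeros of coercive vector fields -/

section Zeros

/-- If the integrands are polynomials in `t` of bounded degree and the integral is constant for
small `t ≥ 0`, then it is constant for all `t`. -/
theorem integral_eq_of_polynomial {X : Type*} [MeasurableSpace X] {μ : Measure X} (n : ℕ)
    (u : X → ℝ → ℝ)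
    (hu : ∀ x, ∃ q : Polynomial ℝ, q.natDegree ≤ n ∧ ∀ t, u x t = q.eval t)
    (hint : ∀ t, Integrable (fun x => u x t) μ) {ε : ℝ} (hε : 0 < ε) (c : ℝ)
    (h : ∀ t, 0 ≤ t → t ≤ ε → ∫ x, u x t ∂μ = c) (t : ℝ) : ∫ x, u x t ∂μ = c := by
  classical
  set s := Finset.range (n + 1) with hs
  set v : ℕ → ℝ := fun j => ε * j / (n + 1) with hv
  have hn : (0 : ℝ) < n + 1 := by positivity
  have hinj : Set.InjOn v s := by
    intro i _ j _ hij
    simp only [hv] at hij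
    have h1 : ε * i = ε * j := by
      have := congrArg (fun z => z * ((n : ℝ) + 1)) hij
      simpa [hn.ne'] using this
    exact_mod_cast mul_left_cancel₀ hε.ne' h1
  -- Lagrange interpolation at `n + 1` nodes in `[0, ε]`. The weights do not depend on `x`, so they
  -- can be pulled out of the integral without knowing that the coefficients of the polynomials are
  -- measurable in `x`.
  have hexp : ∀ x, u x t = ∑ j ∈ s, u x (v j) * (Lagrange.basis s v j).eval t := by
    intro x
    obtain ⟨q, hq, hqe⟩ := hu x
    have hdeg : q.degree < (s.card : WithBot ℕ) := by
      refine lt_of_le_of_lt Polynomial.degree_le_natDegree ?_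
      rw [hs, Finset.card_range]
      exact_mod_cast Nat.lt_succ_of_le hq
    have := congrArg (Polynomial.eval t) (Lagrange.eq_interpolate hinj hdeg)
    rw [Lagrange.interpolate_apply, Polynomial.eval_finsetSum] at this
    simp only [Polynomial.eval_mul, Polynomial.eval_C] at this
    simp only [hqe]
    exact this
  have hsum : ∑ j ∈ s, (Lagrange.basis s v j).eval t = 1 := by
    rw [← Polynomial.eval_finsetSum, Lagrange.sum_basis hinj (by simp [hs])]
    simp
  calc ∫ x, u x t ∂μ = ∫ x, ∑ j ∈ s, u x (v j) * (Lagrange.basis s v j).eval t ∂μ := by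
        simp only [hexp]
    _ = ∑ j ∈ s, (∫ x, u x (v j) ∂μ) * (Lagrange.basis s v j).eval t := by
        rw [integral_finsetSum _ fun j _ => (hint (v j)).mul_const _]
        simp only [integral_mul_const]
    _ = ∑ j ∈ s, c * (Lagrange.basis s v j).eval t := by
        refine Finset.sum_congr rfl fun j hj => ?_
        rw [h (v j) (by simp only [hv]; positivity) ?_]
        simp only [hv]
        rw [div_le_iff₀ hn]
        have : (j : ℝ) ≤ n + 1 := by
          have := Finset.mem_range.1 hj
          exact_mod_cast this.le
        gcongr
    _ = c := by rw [← Finset.mul_sum, hsum, mul_one]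

variable {E : Type*} [NormedAddCommGroup E] [InnerProductSpace ℝ E] [FiniteDimensional ℝ E]

/-- Together with `exists_polynomial_weight` this makes the transformed integrand below a polynomial
in `t`, of a degree independent of the point. -/
theorem exists_polynomial_det (A : E →L[ℝ] E) :
    ∃ q : Polynomial ℝ, q.natDegree ≤ Module.finrank ℝ E ∧
      ∀ t : ℝ, (ContinuousLinearMap.id ℝ E + t • A).det = q.eval t := by
  classical
  let b := Module.finBasis ℝ E
  let M := LinearMap.toMatrix b b (A : E →ₗ[ℝ] E)
  refine ⟨((Polynomial.X : Polynomial ℝ) • M.map Polynomial.C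
    + (1 : Matrix _ _ ℝ).map Polynomial.C).det, ?_, fun t => ?_⟩
  · simpa using Polynomial.natDegree_det_X_add_C_le M 1
  · have h1 : (ContinuousLinearMap.id ℝ E + t • A).det = (1 + t • M).det := by
      rw [ContinuousLinearMap.det, ← LinearMap.det_toMatrix b]
      congr 1
      simp [M]
    rw [h1, ← Polynomial.coe_evalRingHom, RingHom.map_det]
    congr 1
    ext i j
    simp [Matrix.one_apply, add_comm, apply_ite]
    ring

theorem exists_polynomial_weight {E : Type*} [NormedAddCommGroup E] [InnerProductSpace ℝ E]
    (x g : E) (C : ℝ) (N : ℕ) :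
    ∃ q : Polynomial ℝ, q.natDegree ≤ 2 * N ∧
      ∀ t : ℝ, (1 - ‖x + t • g‖ ^ 2 / C ^ 2) ^ N = q.eval t := by
  refine ⟨(Polynomial.C (1 - ‖x‖ ^ 2 / C ^ 2) + Polynomial.C (- (2 * inner ℝ x g / C ^ 2))
    * Polynomial.X + Polynomial.C (- (‖g‖ ^ 2 / C ^ 2)) * Polynomial.X ^ 2) ^ N, ?_, fun t => ?_⟩
  · refine Polynomial.natDegree_pow_le.trans ?_
    rw [mul_comm]
    gcongr
    compute_degree
  · have : ‖x + t • g‖ ^ 2 = ‖x‖ ^ 2 + 2 * (t * inner ℝ x g) + t ^ 2 * ‖g‖ ^ 2 := by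
      rw [norm_add_sq_real, inner_smul_right, norm_smul, mul_pow, Real.norm_eq_abs, sq_abs]
    rw [this]
    simp only [Polynomial.eval_pow, Polynomial.eval_add, Polynomial.eval_mul, Polynomial.eval_C,
      Polynomial.eval_X]
    ring

/-- A perturbation with Lipschitz constant below one is injective, and surjective by the contraction
principle. Being the identity off the ball, the bijection must map the ball onto itself. -/
theorem image_closedBall_id_add {g : E → E} {L : NNReal} (hL : LipschitzWith L g) {ρ : ℝ}
    (hg : ∀ x, x ∉ Metric.closedBall (0 : E) ρ → g x = 0) {t : ℝ} (ht : 0 ≤ t) (htL : t * L < 1) :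
    Function.Injective (fun x => x + t • g x) ∧
      (fun x => x + t • g x) '' Metric.closedBall 0 ρ = Metric.closedBall 0 ρ := by
  have hlip : ∀ x y, ‖t • g x - t • g y‖ ≤ t * L * ‖x - y‖ := by
    intro x y
    rw [← smul_sub, norm_smul, Real.norm_of_nonneg ht, mul_assoc]
    gcongr
    exact hL.norm_sub_le x y
  have hinj : Function.Injective (fun x => x + t • g x) := by
    intro x y hxy
    simp only at hxy
    have h1 : x - y = - (t • g x - t • g y) := by
      rw [neg_sub, sub_eq_sub_iff_add_eq_add, hxy, add_comm]
    have h2 := hlip x y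
    rw [← norm_neg, ← h1] at h2
    have h3 : ‖x - y‖ = 0 := by nlinarith [norm_nonneg (x - y)]
    exact sub_eq_zero.1 (norm_eq_zero.1 h3)
  have hsurj : Function.Surjective (fun x => x + t • g x) := by
    intro y
    have hc : ContractingWith ⟨t * L, by positivity⟩ (fun x => y - t • g x) := by
      refine ⟨by exact_mod_cast htL, LipschitzWith.of_dist_le_mul fun a b => ?_⟩
      rw [dist_eq_norm, dist_eq_norm, sub_sub_sub_cancel_left, norm_sub_rev]
      exact hlip a b
    refine ⟨hc.fixedPoint, ?_⟩
    have := hc.fixedPoint_isFixedPt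
    simp only [Function.IsFixedPt] at this
    simp only
    nth_rewrite 1 [← this]
    abel
  refine ⟨hinj, Set.Subset.antisymm ?_ ?_⟩
  · rintro _ ⟨x, hx, rfl⟩
    by_contra hn
    have h0 := hg _ hn
    have := @hinj (x + t • g x) x (by simp only [h0, smul_zero, add_zero])
    simp only at this hn
    rw [this] at hn
    exact hn hx
  · intro y hy
    obtain ⟨x, rfl⟩ := hsurj y
    by_cases hx : x ∈ Metric.closedBall (0 : E) ρ
    · exact ⟨x, hx, rfl⟩
    · simp only [hg x hx, smul_zero, add_zero] at hy
      exact absurd hy hx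

/-- A compactly supported `C¹` perturbation of the identity has a zero. -/
theorem exists_zero_id_add {g : E → E} (hg : ContDiff ℝ 1 g) {ρ : ℝ} (hρ : 0 < ρ)
    (hg0 : ∀ x, x ∉ Metric.closedBall (0 : E) ρ → g x = 0) : ∃ x, x + g x = 0 := by
  let : MeasurableSpace E := borel E
  have : BorelSpace E := ⟨rfl⟩
  by_contra! hne
  set B := Metric.closedBall (0 : E) ρ with hB
  have hBc : IsCompact B := isCompact_closedBall _ _
  have hcs : HasCompactSupport g := HasCompactSupport.intro hBc hg0
  obtain ⟨L, hL⟩ := ContDiff.lipschitzWith_of_hasCompactSupport hcs hg one_ne_zero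
  have hfd : ∀ x, ‖fderiv ℝ g x‖ ≤ L := fun x => norm_fderiv_le_of_lipschitz ℝ hL
  have hcd : Continuous (fderiv ℝ g) := hg.continuous_fderiv (by simp)
  -- positivity of the Jacobian for small `t`
  obtain ⟨r, hr, hrdet⟩ : ∃ r > 0, ∀ A : E →L[ℝ] E, ‖A‖ < r →
      0 < (ContinuousLinearMap.id ℝ E + A).det := by
    have hc : Continuous fun A : E →L[ℝ] E => (ContinuousLinearMap.id ℝ E + A).det :=
      ContinuousLinearMap.continuous_det.comp (continuous_const.add continuous_id)
    have h0 : 0 < (ContinuousLinearMap.id ℝ E + (0 : E →L[ℝ] E)).det := by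
      simp [ContinuousLinearMap.det]
    obtain ⟨r, hr, h⟩ := Metric.eventually_nhds_iff.1 (hc.continuousAt.eventually (lt_mem_nhds h0))
    exact ⟨r, hr, fun A hA => h (by simpa using hA)⟩
  -- For `t ≤ ε` both `t * L < 1`, so that the map is bijective, and `t * L < r`, so that its
  -- Jacobian is positive.
  set ε : ℝ := min 1 r / (2 * (L + 1)) with hεd
  have hL0 : (0 : ℝ) ≤ L := L.2
  have hm : 0 < min 1 r := lt_min one_pos hr
  have hε : 0 < ε := by positivity
  have hεL : ε * L < min 1 r := by
    rw [hεd, div_mul_eq_mul_div, div_lt_iff₀ (by positivity)]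
    nlinarith
  -- bounds
  obtain ⟨C₀, hC₀⟩ := hBc.exists_bound_of_continuousOn
    (f := fun x => x + g x) (continuous_id.add hg.continuous).continuousOn
  -- `C` dominates both `‖x‖` and `‖x + g x‖` on the ball, so the weights `1 - ‖·‖² / C²` are
  -- nonnegative on both sides.
  set C := max C₀ ρ with hC
  have hCρ : ρ ≤ C := le_max_right _ _
  have hCpos : 0 < C := hρ.trans_le hCρ
  obtain ⟨x₀, hx₀, hmin⟩ := hBc.exists_isMinOn ⟨0, by simp [hB, hρ.le]⟩
    (f := fun x => ‖x + g x‖) (continuous_id.add hg.continuous).norm.continuousOn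
  set δ := min ‖x₀ + g x₀‖ ρ with hδd
  have hδ : 0 < δ := lt_min (norm_pos_iff.2 (hne x₀)) hρ
  have hδρ : δ ≤ ρ := min_le_right _ _
  -- The change of variables formula for small `t`, continued to `t = 1` by polynomiality, although
  -- the map need no longer be injective there.
  have key : ∀ N : ℕ, ∫ x in B, (1 - ‖x + g x‖ ^ 2 / C ^ 2) ^ N
      * (ContinuousLinearMap.id ℝ E + fderiv ℝ g x).det
      = ∫ x in B, (1 - ‖x‖ ^ 2 / C ^ 2) ^ N := by
    intro N
    have := integral_eq_of_polynomial (μ := volume.restrict B) (2 * N + Module.finrank ℝ E)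
      (fun x t => (1 - ‖x + t • g x‖ ^ 2 / C ^ 2) ^ N
        * (ContinuousLinearMap.id ℝ E + t • fderiv ℝ g x).det) ?_ ?_ hε
      (∫ x in B, (1 - ‖x‖ ^ 2 / C ^ 2) ^ N) ?_ 1
    · simpa using this
    · intro x
      obtain ⟨q₁, h₁, e₁⟩ := exists_polynomial_weight x (g x) C N
      obtain ⟨q₂, h₂, e₂⟩ := exists_polynomial_det (fderiv ℝ g x)
      refine ⟨q₁ * q₂, Polynomial.natDegree_mul_le.trans (add_le_add h₁ h₂), fun t => ?_⟩
      rw [e₁, e₂, Polynomial.eval_mul]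
    · intro t
      refine ContinuousOn.integrableOn_compact hBc (Continuous.continuousOn ?_)
      have := hg.continuous
      refine Continuous.mul (by fun_prop) (ContinuousLinearMap.continuous_det.comp (by fun_prop))
    · intro t ht htε
      have htL : t * L < min 1 r := lt_of_le_of_lt (by gcongr) hεL
      obtain ⟨hinj, himg⟩ := image_closedBall_id_add hL hg0 ht (htL.trans_le (min_le_left _ _))
      have hder : ∀ x ∈ B, HasFDerivWithinAt (fun x => x + t • g x)
          (ContinuousLinearMap.id ℝ E + t • fderiv ℝ g x) B x := fun x _ =>
        ((hasFDerivAt_id x).add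
          (((hg.differentiable (by simp)) x).hasFDerivAt.const_smul t)).hasFDerivWithinAt
      have := integral_image_eq_integral_abs_det_fderiv_smul volume hBc.measurableSet hder
        hinj.injOn (fun y => (1 - ‖y‖ ^ 2 / C ^ 2) ^ N)
      rw [himg] at this
      rw [this]
      refine integral_congr_ae (Filter.Eventually.of_forall fun x => ?_)
      simp only [smul_eq_mul]
      rw [abs_of_pos (hrdet _ ?_), mul_comm]
      rw [norm_smul, Real.norm_of_nonneg ht]
      exact lt_of_le_of_lt (by gcongr; exact hfd x) (htL.trans_le (min_le_right _ _))
  -- If the image stays at distance `δ` from the origin, the left side of `key` is at most a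
  -- multiple of `a ^ N`. The right side is at least a multiple of `b ^ N` from the ball of radius
  -- `δ / 2`. As `a < b`, this fails for large `N`.
  set a := 1 - δ ^ 2 / C ^ 2 with ha
  set b := 1 - (δ / 2) ^ 2 / C ^ 2 with hb
  have hδC : δ ^ 2 / C ^ 2 ≤ 1 := by
    rw [div_le_one (by positivity)]
    exact pow_le_pow_left₀ hδ.le (hδρ.trans hCρ) 2
  have ha0 : 0 ≤ a := by linarith
  have hq : 0 < δ ^ 2 / C ^ 2 := by positivity
  have hbe : b = 1 - δ ^ 2 / C ^ 2 / 4 := by rw [hb]; ring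
  have hab : a < b := by rw [hbe]; linarith
  have hb0 : 0 < b := ha0.trans_lt hab
  set D := ∫ x in B, |(ContinuousLinearMap.id ℝ E + fderiv ℝ g x).det| with hD
  have hdetc : Continuous fun x => (ContinuousLinearMap.id ℝ E + fderiv ℝ g x).det :=
    ContinuousLinearMap.continuous_det.comp (by fun_prop)
  set V := volume.real (Metric.closedBall (0 : E) (δ / 2)) with hV
  have hVpos : 0 < V := by
    refine ENNReal.toReal_pos ?_ (isCompact_closedBall _ _).measure_lt_top.ne
    exact (Metric.measure_closedBall_pos volume (0 : E) (by positivity)).ne'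
  have hupper : ∀ N : ℕ, ∫ x in B, (1 - ‖x + g x‖ ^ 2 / C ^ 2) ^ N
      * (ContinuousLinearMap.id ℝ E + fderiv ℝ g x).det ≤ a ^ N * D := by
    intro N
    rw [hD, ← integral_const_mul]
    refine setIntegral_mono_on (ContinuousOn.integrableOn_compact hBc (Continuous.continuousOn ?_))
      (ContinuousOn.integrableOn_compact hBc (Continuous.continuousOn ?_))
      hBc.measurableSet fun x hx => ?_
    · have := hg.continuous
      exact Continuous.mul (by fun_prop) hdetc
    · exact continuous_const.mul hdetc.abs
    · refine (le_abs_self _).trans ?_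
      rw [abs_mul]
      have h1 : δ ≤ ‖x + g x‖ := (min_le_left _ _).trans (hmin hx)
      have h2 : ‖x + g x‖ ≤ C := (hC₀ x hx).trans (le_max_left _ _)
      have h3 : ‖x + g x‖ ^ 2 / C ^ 2 ≤ 1 := by
        rw [div_le_one (by positivity)]
        exact pow_le_pow_left₀ (norm_nonneg _) h2 2
      rw [abs_of_nonneg (pow_nonneg (by linarith) N)]
      have h4 : 1 - ‖x + g x‖ ^ 2 / C ^ 2 ≤ a := by
        rw [ha]
        gcongr
      gcongr
  have hlower : ∀ N : ℕ, b ^ N * V ≤ ∫ x in B, (1 - ‖x‖ ^ 2 / C ^ 2) ^ N := by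
    intro N
    have hcont : Continuous fun x : E => (1 - ‖x‖ ^ 2 / C ^ 2) ^ N := by fun_prop
    have hsub : Metric.closedBall (0 : E) (δ / 2) ⊆ B :=
      Metric.closedBall_subset_closedBall (by linarith)
    have hnn : ∀ x ∈ B, 0 ≤ 1 - ‖x‖ ^ 2 / C ^ 2 := fun x hx => by
      rw [sub_nonneg, div_le_one (by positivity)]
      exact pow_le_pow_left₀ (norm_nonneg _) ((mem_closedBall_zero_iff.1 hx).trans hCρ) 2
    calc b ^ N * V = ∫ x in Metric.closedBall (0 : E) (δ / 2), b ^ N := by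
          rw [setIntegral_const, smul_eq_mul, mul_comm]
      _ ≤ ∫ x in Metric.closedBall (0 : E) (δ / 2), (1 - ‖x‖ ^ 2 / C ^ 2) ^ N := by
          refine setIntegral_mono_on
            (continuous_const.continuousOn.integrableOn_compact (isCompact_closedBall _ _))
            (hcont.continuousOn.integrableOn_compact (isCompact_closedBall _ _))
            (isCompact_closedBall _ _).measurableSet fun x hx => ?_
          have := mem_closedBall_zero_iff.1 hx
          rw [hb]
          gcongr
      _ ≤ _ := by
          refine setIntegral_mono_set (hcont.continuousOn.integrableOn_compact hBc) ?_
            hsub.eventuallyLE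
          filter_upwards [ae_restrict_mem hBc.measurableSet] with x hx
          exact pow_nonneg (hnn x hx) N
  have hcontra : ∀ N : ℕ, V ≤ (a / b) ^ N * D := by
    intro N
    have := (hlower N).trans ((key N).symm.le.trans (hupper N))
    rw [div_pow, div_mul_eq_mul_div, le_div_iff₀ (by positivity)]
    linarith
  have hlim : Filter.Tendsto (fun N : ℕ => (a / b) ^ N * D) Filter.atTop (nhds 0) := by
    simpa using (tendsto_pow_atTop_nhds_zero_of_lt_one (by positivity)
      ((div_lt_one hb0).2 hab)).mul_const D
  exact absurd (ge_of_tendsto' hlim hcontra) (not_le.2 hVpos)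

/-- A `C¹` vector field that points outwards outside of a ball has a zero. -/
theorem exists_zero_of_inner_pos {F : E → E} (hF : ContDiff ℝ 1 F) {R : ℝ}
    (hpos : ∀ x, R ≤ ‖x‖ → 0 < inner ℝ (F x) x) : ∃ x, F x = 0 := by
  set R' := max R 1 with hR'
  have hR0 : 0 < R' := lt_max_of_lt_right one_pos
  -- The perturbed identity is `(1 - χ) x + χ F x`: it equals `F` on the ball of radius `R'` and is
  -- the identity far away.
  let χ : ContDiffBump (0 : E) := ⟨R', R' + 1, hR0, by linarith⟩
  obtain ⟨x, hx⟩ := exists_zero_id_add (g := fun x => χ x • (F x - x)) (ρ := R' + 1)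
    (χ.contDiff.smul (hF.sub contDiff_id)) (by linarith) (fun x hx => by
      have : χ x = 0 := χ.zero_of_le_dist (by
        simp only [Metric.mem_closedBall, not_le] at hx
        exact hx.le)
      simp [this])
  refine ⟨x, ?_⟩
  by_cases hxR : ‖x‖ ≤ R'
  · have : χ x = 1 := χ.one_of_mem_closedBall (by simpa using hxR)
    simpa [this] using hx
  -- Beyond `R'`, pairing the convex combination of `x` and `F x` with `x` gives a positive number,
  -- so no zero lies there.
  · exfalso
    push Not at hxR
    have h1 := hpos x ((le_max_left _ _).trans hxR.le)
    have h2 : (1 - χ x) * ‖x‖ ^ 2 + χ x * inner ℝ (F x) x = 0 := by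
      have := congrArg (fun z => inner ℝ z x) hx
      simp only [inner_add_left, inner_smul_left, inner_sub_left, inner_zero_left,
        real_inner_self_eq_norm_sq] at this
      simp only [RCLike.conj_to_real] at this
      linarith
    have h3 : 0 ≤ χ x := χ.nonneg
    have h4 : χ x ≤ 1 := χ.le_one
    have h5 : 0 < ‖x‖ := hR0.trans hxR
    rcases h3.eq_or_lt with h | h
    · rw [← h] at h2
      nlinarith
    · nlinarith [mul_pos h h1, mul_nonneg (sub_nonneg.2 h4) (sq_nonneg ‖x‖)]

end Zeros

/-- Solvability of a quadratic system `A x y + N x x y = b y` in a finite dimensional space, with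
`A` positive definite and `N` conservative. -/
theorem exists_solution_quadratic {V : Type*} [AddCommGroup V] [Module ℝ V]
    [FiniteDimensional ℝ V] (A : V →ₗ[ℝ] V →ₗ[ℝ] ℝ) (N : V →ₗ[ℝ] V →ₗ[ℝ] V →ₗ[ℝ] ℝ)
    (b : V →ₗ[ℝ] ℝ) (hA : ∀ x, x ≠ 0 → 0 < A x x) (hN : ∀ x, N x x x = 0) :
    ∃ x, ∀ y, A x y + N x x y = b y := by
  let n := Module.finrank ℝ V
  let E := EuclideanSpace ℝ (Fin n)
  obtain ⟨e⟩ : Nonempty (E ≃ₗ[ℝ] V) :=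
    FiniteDimensional.nonempty_linearEquiv_of_finrank_eq (by simp [n, E])
  let J : (E →ₗ[ℝ] ℝ) ≃ₗ[ℝ] E :=
    LinearMap.toContinuousLinearMap.trans (InnerProductSpace.toDual ℝ E).symm.toLinearEquiv
  have hJ : ∀ l x, inner ℝ (J l) x = l x := fun l x => by
    simp [J]
  let A' : E →ₗ[ℝ] E := J.toLinearMap ∘ₗ (LinearMap.lcomp ℝ ℝ e.toLinearMap) ∘ₗ A ∘ₗ e.toLinearMap
  let N' : E →ₗ[ℝ] E →ₗ[ℝ] E := LinearMap.mk₂ ℝ (fun x y => J (N (e x) (e y) ∘ₗ e.toLinearMap))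
    (by intros; simp [LinearMap.add_comp]) (by intros; simp [LinearMap.smul_comp])
    (by intros; simp [LinearMap.add_comp]) (by intros; simp [LinearMap.smul_comp])
  let b' : E := J (b ∘ₗ e.toLinearMap)
  let F : E → E := fun x => A' x + N' x x - b'
  have hFi : ∀ x y, inner ℝ (F x) y = A (e x) (e y) + N (e x) (e x) (e y) - b (e y) := by
    intro x y
    simp only [F, A', N', b', inner_sub_left, inner_add_left]
    simp [hJ]
  have hF : ContDiff ℝ 1 F := by
    have h1 : ContDiff ℝ 1 A' := (LinearMap.toContinuousLinearMap A').contDiff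
    have h2 : ContDiff ℝ 1 fun x => N' x x := by
      let N₁ : E →ₗ[ℝ] E →L[ℝ] E := LinearMap.toContinuousLinearMap.toLinearMap ∘ₗ N'
      have h3 : ContDiff ℝ 1 N₁ := (LinearMap.toContinuousLinearMap N₁).contDiff
      exact h3.clm_apply contDiff_id
    exact (h1.add h2).sub contDiff_const
  -- Definiteness becomes coercivity by compactness of the unit sphere; the sphere is empty when the
  -- space is trivial.
  obtain ⟨α, hα, hcoer⟩ : ∃ α > 0, ∀ x, α * ‖x‖ ^ 2 ≤ A (e x) (e x) := by
    have hc : Continuous fun x : E => A (e x) (e x) := by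
      have : ∀ x : E, A (e x) (e x) = inner ℝ (A' x) x := fun x => by simp [A', hJ]
      simp only [this]
      have := A'.continuous_of_finiteDimensional
      fun_prop
    by_cases hne : (Metric.sphere (0 : E) 1).Nonempty
    · obtain ⟨x₀, hx₀, hmin⟩ := (isCompact_sphere (0 : E) 1).exists_isMinOn hne hc.continuousOn
      refine ⟨A (e x₀) (e x₀), hA _ ?_, fun x => ?_⟩
      · intro h
        rw [e.map_eq_zero_iff] at h
        simp [h] at hx₀
      · by_cases hx : x = 0
        · simp [hx]
        · have hx' : 0 < ‖x‖ := norm_pos_iff.2 hx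
          have h1 := hmin (a := ‖x‖⁻¹ • x) (by simp [norm_smul, hx'.ne'])
          simp only [Set.mem_ofPred_eq, map_smul, LinearMap.smul_apply, smul_eq_mul] at h1
          calc A (e x₀) (e x₀) * ‖x‖ ^ 2 ≤ ‖x‖⁻¹ * (‖x‖⁻¹ * A (e x) (e x)) * ‖x‖ ^ 2 := by gcongr
            _ = A (e x) (e x) := by field_simp
    · refine ⟨1, one_pos, fun x => ?_⟩
      have hx : x = 0 := by
        by_contra hx
        exact hne ⟨‖x‖⁻¹ • x, by simp [norm_smul, (norm_pos_iff.2 hx).ne']⟩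
      simp [hx]
  -- Beyond this radius `α ‖x‖ > ‖b'‖`. The quadratic term has dropped out on the diagonal, so its
  -- size does not matter.
  obtain ⟨x, hx⟩ := exists_zero_of_inner_pos hF (R := ‖b'‖ / α + 1) (fun x hx => by
    have h1 : inner ℝ (F x) x = A (e x) (e x) - inner ℝ b' x := by
      rw [hFi, hN]
      simp [b', hJ]
    have h2 := hcoer x
    have h3 := real_inner_le_norm b' x
    have h4 : ‖b'‖ + α ≤ α * ‖x‖ := by
      calc ‖b'‖ + α = α * (‖b'‖ / α + 1) := by field_simp
        _ ≤ _ := by gcongr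
    have h5 : 0 < ‖x‖ := lt_of_lt_of_le (by positivity) hx
    rw [h1]
    nlinarith)
  refine ⟨e x, fun y => ?_⟩
  have h := hFi x (e.symm y)
  rw [hx, inner_zero_left] at h
  simp only [LinearEquiv.apply_symm_apply] at h
  linarith

/-! ## Weak gradients -/

section WeakGradient

variable {d : ℕ} {Ω : Set (Sp d)}

theorem integral_pderiv_mul_eq_neg {f g : Sp d → ℝ} (hf : ContDiff ℝ 1 f) (hg : ContDiff ℝ 1 g)
    (hc : HasCompactSupport g) (i : Fin d) :
    ∫ x, f x * pderiv i g x = - ∫ x, pderiv i f x * g x := by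
  have hpc : ∀ {k : Sp d → ℝ}, ContDiff ℝ 1 k → Continuous (pderiv i k) := fun hk =>
    (hk.continuous_fderiv (by simp)).clm_apply continuous_const
  have hcs : HasCompactSupport (pderiv i g) :=
    (hc.fderiv (𝕜 := ℝ)).comp_left (g := fun L : Sp d →L[ℝ] ℝ =>
      L (EuclideanSpace.single i 1)) (by simp)
  exact integral_mul_fderiv_eq_neg_fderiv_mul_of_integrable
    (((hpc hf).mul hg.continuous).integrable_of_hasCompactSupport hc.mul_left)
    ((hf.continuous.mul (hpc hg)).integrable_of_hasCompactSupport hcs.mul_left)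
    ((hf.continuous.mul hg.continuous).integrable_of_hasCompactSupport hc.mul_left)
    (fun x _ => hf.differentiable (by simp) x) (fun x _ => hg.differentiable (by simp) x)

theorem IsTest.setIntegral_pderiv {φ : Sp d → ℝ} (hφ : IsTest Ω φ) (i : Fin d) :
    ∫ x in Ω, pderiv i φ x = 0 := by
  have hsub : Function.support (pderiv i φ) ⊆ Ω := by
    refine (Function.support_subset_iff'.2 fun x hx => ?_).trans hφ.supp
    simp [pderiv, fderiv_of_notMem_tsupport (𝕜 := ℝ) hx]
  rw [setIntegral_eq_integral_of_forall_compl_eq_zero fun x hx =>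
    Function.notMem_support.1 fun h => hx (hsub h)]
  have := integral_pderiv_mul_eq_neg (f := fun _ => 1) contDiff_const
    (hφ.smooth.of_le (by simp)) hφ.compact i
  simpa [pderiv] using this

/-- A function whose integral against all test functions vanishes is zero. -/
theorem ae_eq_zero_of_integral_test (hΩ : IsOpen Ω) {f : Sp d → ℝ}
    (hf : MemLp f 2 ((volume : Measure (Sp d)).restrict Ω))
    (h : ∀ φ, IsTest Ω φ → ∫ x in Ω, f x * φ x = 0) :
    f =ᵐ[(volume : Measure (Sp d)).restrict Ω] 0 := by
  have hloc : LocallyIntegrableOn f Ω (volume : Measure (Sp d)) := by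
    rw [locallyIntegrableOn_iff hΩ.isLocallyClosed]
    intro k hk hkc
    have : IsFiniteMeasure ((volume : Measure (Sp d)).restrict k) :=
      ⟨by simpa using hkc.measure_lt_top⟩
    exact ((hf.mono_measure (Measure.restrict_mono hk le_rfl))).integrable (by norm_num)
  have := hΩ.ae_eq_zero_of_integral_contDiff_smul_eq_zero hloc fun g hg hgc hgs => by
    rw [← h g ⟨hg, hgc, hgs⟩]
    rw [setIntegral_eq_integral_of_forall_compl_eq_zero fun x hx => ?_]
    · simp only [smul_eq_mul, mul_comm]
    · simp [image_eq_zero_of_notMem_tsupport fun hh => hx (hgs hh)]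
  rw [Filter.EventuallyEq, ae_restrict_iff' hΩ.measurableSet]
  simpa using this

/-- With `c = 0` this is uniqueness of the weak gradient; with `c = 1` it provides the test function
for conservation of mass. -/
theorem grad_eq_zero_of_const (hΩ : IsOpen Ω) (u : H1 Ω) (c : ℝ)
    (hu : fn u =ᵐ[(volume : Measure (Sp d)).restrict Ω] fun _ => c) : grad u = 0 := by
  have hw : IsWeakGrad Ω (fn u) (grad u) := u.2
  have hi : ∀ i : Fin d, (fun x => grad u x i) =ᵐ[(volume : Measure (Sp d)).restrict Ω] 0 := by
    intro i
    refine ae_eq_zero_of_integral_test hΩ (memLp_coord _ i) fun φ hφ => ?_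
    have h1 := hw φ hφ i
    have h2 : ∫ x in Ω, fn u x * pderiv i φ x = 0 := by
      rw [← mul_zero c, ← hφ.setIntegral_pderiv i, ← integral_const_mul]
      refine integral_congr_ae ?_
      filter_upwards [hu] with x hx
      rw [hx]
    linarith
  refine Lp.ext ?_
  filter_upwards [ae_all_iff.2 hi, Lp.coeFn_zero (Sp d) 2 ((volume : Measure (Sp d)).restrict Ω)]
    with x hx h0
  rw [h0]
  ext i
  exact hx i

/-- Makes the `L²` inner product definite on subspaces of `H1 Ω`, whose elements are pairs. -/
theorem fn_injective (hΩ : IsOpen Ω) : Function.Injective (fn : H1 Ω → L2 Ω) := by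
  rw [← LinearMap.ker_eq_bot, LinearMap.ker_eq_bot']
  intro u hu
  have hg : grad u = 0 := grad_eq_zero_of_const hΩ u 0 (by
    rw [hu]
    exact Lp.coeFn_zero ℝ 2 _)
  exact Subtype.ext (Prod.ext hu hg)

end WeakGradient

/-! ## Mollification -/

section Mollification

variable {d : ℕ}

/-- Mollification of `f` with a normed bump function. -/
noncomputable def moll (φ : ContDiffBump (0 : Sp d)) (f : Sp d → ℝ) (x : Sp d) : ℝ :=
  ∫ t, f t * φ.normed volume (x - t)

theorem moll_eq_convolution (φ : ContDiffBump (0 : Sp d)) (f : Sp d → ℝ) :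
    moll φ f = convolution f (φ.normed volume) (ContinuousLinearMap.mul ℝ ℝ) volume := by
  ext x
  simp [moll, convolution_def]

theorem moll_apply' (φ : ContDiffBump (0 : Sp d)) (f : Sp d → ℝ) (x : Sp d) :
    moll φ f x = ∫ t, φ.normed volume t * f (x - t) := by
  rw [moll, ← integral_sub_left_eq_self _ _ x]
  simp [mul_comm]

theorem moll_eq_convolution' (φ : ContDiffBump (0 : Sp d)) (f : Sp d → ℝ) (x : Sp d) :
    moll φ f x
      = convolution (φ.normed volume) f (ContinuousLinearMap.lsmul ℝ ℝ) volume x := by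
  rw [moll_apply', convolution_def]
  simp

theorem contDiff_moll (φ : ContDiffBump (0 : Sp d)) {f : Sp d → ℝ} (hf : LocallyIntegrable f) :
    ContDiff ℝ ∞ (moll φ f) := by
  rw [moll_eq_convolution]
  exact φ.hasCompactSupport_normed.contDiff_convolution_right _ hf φ.contDiff_normed

/-- Cauchy–Schwarz after writing `a` as the square of its root. For a weight of mass one it is
Jensen's inequality for the square. -/
theorem sq_lintegral_mul_le {X : Type*} [MeasurableSpace X] (μ : Measure X)
    {a g : X → ENNReal} (ha : AEMeasurable a μ) (hg : AEMeasurable g μ) :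
    (∫⁻ x, a x * g x ∂μ) ^ 2 ≤ (∫⁻ x, a x ∂μ) * ∫⁻ x, a x * g x ^ 2 ∂μ := by
  have h := ENNReal.lintegral_mul_le_Lp_mul_Lq μ Real.HolderConjugate.two_two
    (f := fun x => a x ^ (1 / 2 : ℝ)) (g := fun x => a x ^ (1 / 2 : ℝ) * g x)
    (ha.pow_const _) ((ha.pow_const _).mul hg)
  have e0 : ∀ y : ENNReal, y ^ (1 / 2 : ℝ) * y ^ (1 / 2 : ℝ) = y := fun y => by
    rw [← ENNReal.rpow_add_of_nonneg _ _ (by norm_num) (by norm_num)]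
    norm_num
  have e1 : ∀ x, ((fun x => a x ^ (1 / 2 : ℝ)) * fun x => a x ^ (1 / 2 : ℝ) * g x) x
      = a x * g x := fun x => by
    simp only [Pi.mul_apply]
    rw [← mul_assoc, e0]
  have e2 : ∀ x, (a x ^ (1 / 2 : ℝ)) ^ (2 : ℝ) = a x := fun x => by
    rw [← ENNReal.rpow_mul]
    norm_num
  have e3 : ∀ x, (a x ^ (1 / 2 : ℝ) * g x) ^ (2 : ℝ) = a x * g x ^ 2 := fun x => by
    rw [ENNReal.mul_rpow_of_nonneg _ _ (by norm_num), e2]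
    norm_num
  simp only [e1, e2, e3] at h
  calc (∫⁻ x, a x * g x ∂μ) ^ 2
      ≤ ((∫⁻ x, a x ∂μ) ^ (1 / 2 : ℝ) * (∫⁻ x, a x * g x ^ 2 ∂μ) ^ (1 / 2 : ℝ)) ^ 2 := by
        gcongr
    _ = _ := by
        rw [sq, mul_mul_mul_comm, e0, e0]

theorem lintegral_enorm_normed (φ : ContDiffBump (0 : Sp d)) :
    ∫⁻ t, ‖φ.normed volume t‖ₑ = 1 := by
  rw [← ofReal_integral_norm_eq_lintegral_enorm φ.integrable_normed]
  have : ∀ t, ‖φ.normed volume t‖ = φ.normed volume t := fun t =>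
    Real.norm_of_nonneg (φ.nonneg_normed t)
  simp only [this, φ.integral_normed, ENNReal.ofReal_one]

/-- Young's inequality: the weighted Cauchy–Schwarz inequality under the integral, Tonelli,
translation invariance. A strongly measurable representative is chosen so that Tonelli applies to `f
(x - t)`. -/
theorem lintegral_enorm_moll_sq_le (φ : ContDiffBump (0 : Sp d)) {f : Sp d → ℝ}
    (hf : AEStronglyMeasurable f volume) :
    ∫⁻ x, ‖moll φ f x‖ₑ ^ 2 ≤ ∫⁻ x, ‖f x‖ₑ ^ 2 := by
  wlog hfm : StronglyMeasurable f generalizing f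
  · have := this hf.stronglyMeasurable_mk.aestronglyMeasurable hf.stronglyMeasurable_mk
    have h1 : moll φ f = moll φ (hf.mk f) := by
      ext x
      refine integral_congr_ae ?_
      filter_upwards [hf.ae_eq_mk] with t ht
      rw [ht]
    have h2 : ∫⁻ x, ‖f x‖ₑ ^ 2 = ∫⁻ x, ‖hf.mk f x‖ₑ ^ 2 := by
      refine lintegral_congr_ae ?_
      filter_upwards [hf.ae_eq_mk] with t ht
      rw [ht]
    rwa [h1, h2]
  have hfme : Measurable fun x => ‖f x‖ₑ := hfm.enorm
  have hηm : Measurable fun t => ‖φ.normed (volume : Measure (Sp d)) t‖ₑ :=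
    (φ.continuous_normed.measurable).enorm
  calc ∫⁻ x, ‖moll φ f x‖ₑ ^ 2
      ≤ ∫⁻ x, ∫⁻ t, ‖φ.normed volume t‖ₑ * ‖f (x - t)‖ₑ ^ 2 := by
        refine lintegral_mono fun x => ?_
        calc ‖moll φ f x‖ₑ ^ 2 ≤ (∫⁻ t, ‖φ.normed volume t‖ₑ * ‖f (x - t)‖ₑ) ^ 2 := by
              gcongr
              rw [moll_apply']
              refine (enorm_integral_le_lintegral_enorm _).trans_eq ?_
              simp only [enorm_mul]
          _ ≤ _ := by
              refine (sq_lintegral_mul_le volume hηm.aemeasurable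
                (hfme.comp (measurable_const.sub measurable_id)).aemeasurable).trans_eq ?_
              rw [lintegral_enorm_normed, one_mul]
              rfl
    _ = ∫⁻ t, ∫⁻ x, ‖φ.normed volume t‖ₑ * ‖f (x - t)‖ₑ ^ 2 := by
        refine lintegral_lintegral_swap (Measurable.aemeasurable ?_)
        exact (hηm.comp measurable_snd).mul
          ((hfme.comp (measurable_fst.sub measurable_snd)).pow_const 2)
    _ = ∫⁻ t, ‖φ.normed volume t‖ₑ * ∫⁻ x, ‖f x‖ₑ ^ 2 := by
        refine lintegral_congr fun t => ?_
        have hm : Measurable fun x => ‖f (x - t)‖ₑ ^ 2 :=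
          (hfme.comp (measurable_id.sub measurable_const)).pow_const 2
        rw [lintegral_const_mul _ hm, lintegral_sub_right_eq_self (fun x => ‖f x‖ₑ ^ 2) t]
    _ = _ := by
        rw [lintegral_mul_const _ hηm, lintegral_enorm_normed, one_mul]

theorem eLpNorm_two_eq {F X : Type*} [NormedAddCommGroup F] [MeasurableSpace X] {μ : Measure X}
    (f : X → F) : eLpNorm f 2 μ = (∫⁻ x, ‖f x‖ₑ ^ 2 ∂μ) ^ (1 / 2 : ℝ) := by
  rw [eLpNorm_eq_lintegral_rpow_enorm_toReal (by norm_num) (by norm_num)]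
  simp

theorem memLp_moll (φ : ContDiffBump (0 : Sp d)) {f : Sp d → ℝ} (hf : MemLp f 2 volume) :
    MemLp (moll φ f) 2 volume ∧
      eLpNorm (moll φ f) 2 volume ≤ eLpNorm f 2 volume := by
  have h : eLpNorm (moll φ f) 2 volume ≤ eLpNorm f 2 volume := by
    rw [eLpNorm_two_eq, eLpNorm_two_eq]
    exact ENNReal.rpow_le_rpow (lintegral_enorm_moll_sq_le φ hf.1) (by norm_num)
  exact ⟨⟨(contDiff_moll φ (hf.locallyIntegrable (by norm_num))).continuous.aestronglyMeasurable,
    h.trans_lt hf.2⟩, h⟩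

/-- Extension by zero destroys weak differentiability across the boundary. But if the ball around
`x` lies in `Ω`, the shifted kernel is a test function in `Ω`, and the definition of the weak
gradient applies to it. The sign from the reflection `t ↦ x - t` cancels the one in that definition.
-/
theorem pderiv_moll (φ : ContDiffBump (0 : Sp d)) {Ω : Set (Sp d)} (hΩ : IsOpen Ω)
    {u : L2 Ω} {g : L2v Ω} (hw : IsWeakGrad Ω u g)
    (hu : LocallyIntegrable (Ω.indicator u) volume) {x : Sp d}
    (hx : Metric.closedBall x φ.rOut ⊆ Ω) (i : Fin d) :
    pderiv i (moll φ (Ω.indicator u)) x = moll φ (Ω.indicator fun y => g y i) x := by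
  have hη1 : ContDiff ℝ 1 (φ.normed (volume : Measure (Sp d))) := φ.contDiff_normed (n := 1)
  have hd := φ.hasCompactSupport_normed.hasFDerivAt_convolution_right
    (ContinuousLinearMap.mul ℝ ℝ) hu hη1 x
  rw [pderiv, moll_eq_convolution, hd.fderiv,
    convolution_precompR_apply _ hu (φ.hasCompactSupport_normed.fderiv (𝕜 := ℝ))
      (hη1.continuous_fderiv (by simp)), convolution_def, moll]
  set ψ : Sp d → ℝ := fun t => φ.normed volume (x - t) with hψ
  have hψs : ContDiff ℝ ∞ ψ :=
    (φ.contDiff_normed (μ := volume) (n := ⊤)).comp (contDiff_const.sub contDiff_id)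
  have hsupp : Function.support ψ ⊆ Metric.closedBall x φ.rOut := by
    intro t ht
    have : x - t ∈ Function.support (φ.normed (volume : Measure (Sp d))) := ht
    rw [φ.support_normed_eq] at this
    rw [Metric.mem_closedBall, dist_comm, dist_eq_norm]
    simpa using (Metric.ball_subset_closedBall this)
  have hts : tsupport ψ ⊆ Metric.closedBall x φ.rOut :=
    closure_minimal hsupp Metric.isClosed_closedBall
  have htest : IsTest Ω ψ :=
    ⟨hψs, HasCompactSupport.of_support_subset_isCompact (isCompact_closedBall _ _) hsupp,
      hts.trans hx⟩
  have hpd : ∀ t, pderiv i ψ t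
      = - fderiv ℝ (φ.normed volume) (x - t) (EuclideanSpace.single i 1) := by
    intro t
    have h1 : HasFDerivAt ψ ((fderiv ℝ (φ.normed volume) (x - t)).comp
        (-ContinuousLinearMap.id ℝ (Sp d))) t := by
      refine HasFDerivAt.comp t (hη1.differentiable (by simp) _).hasFDerivAt ?_
      simpa using (hasFDerivAt_id t).const_sub x
    rw [pderiv, h1.fderiv]
    simp
  have h := hw ψ htest i
  have e1 : ∫ t, (ContinuousLinearMap.mul ℝ ℝ (Ω.indicator u t))
      ((fun a => fderiv ℝ (φ.normed volume) a (EuclideanSpace.single i 1)) (x - t))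
      = - ∫ t in Ω, u t * pderiv i ψ t := by
    rw [← integral_indicator hΩ.measurableSet, ← integral_neg]
    refine integral_congr_ae (Filter.Eventually.of_forall fun t => ?_)
    by_cases ht : t ∈ Ω <;> simp [ht, hpd]
  have e2 : ∫ t, Ω.indicator (fun y => g y i) t * φ.normed volume (x - t)
      = ∫ t in Ω, g t i * ψ t := by
    rw [← integral_indicator hΩ.measurableSet]
    refine integral_congr_ae (Filter.Eventually.of_forall fun t => ?_)
    by_cases ht : t ∈ Ω <;> simp [ht, hψ]
  rw [e1, e2, h, neg_neg]

end Mollification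

/-! ## Cutoff functions in convex domains -/

section Cutoff

variable {d : ℕ} {Ω : Set (Sp d)}

/-- The points of `Ω` with distance at least `δ` from the complement. -/
def innerSet (Ω : Set (Sp d)) (δ : ℝ) : Set (Sp d) := {x | Metric.ball x δ ⊆ Ω}

theorem isClosed_innerSet (Ω : Set (Sp d)) (δ : ℝ) : IsClosed (innerSet Ω δ) := by
  have : innerSet Ω δ = ⋂ y ∈ Ωᶜ, {x | δ ≤ dist y x} := by
    ext x
    simp only [innerSet, Set.mem_ofPred_eq, Set.mem_iInter, Set.subset_def, Metric.mem_ball,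
      Set.mem_compl_iff]
    refine forall_congr' fun y => ?_
    rw [← not_imp_not, not_lt]
  rw [this]
  exact isClosed_biInter fun y _ => isClosed_le continuous_const (by fun_prop)

theorem convex_innerSet (hΩ : Convex ℝ Ω) (δ : ℝ) : Convex ℝ (innerSet Ω δ) := by
  intro x hx y hy a b ha hb hab z hz
  -- A point near the convex combination is the same combination of the two end points, both shifted
  -- by the same small vector.
  have h1 : x + (z - (a • x + b • y)) ∈ Ω := hx (by simpa [dist_eq_norm] using hz)
  have h2 : y + (z - (a • x + b • y)) ∈ Ω := hy (by simpa [dist_eq_norm] using hz)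
  have h3 := hΩ h1 h2 ha hb hab
  have h4 : a • (x + (z - (a • x + b • y))) + b • (y + (z - (a • x + b • y))) = z := by
    obtain rfl : b = 1 - a := by linarith
    module
  rwa [h4] at h3

theorem innerSet_subset {δ : ℝ} (hδ : 0 < δ) : innerSet Ω δ ⊆ Ω := fun _ hx =>
  hx (Metric.mem_ball_self hδ)

/-- Smooth cutoff function of a domain, made from a mollifier. -/
noncomputable def cutoff (Ω : Set (Sp d)) (φ : ContDiffBump (0 : Sp d)) : Sp d → ℝ :=
  moll φ ((innerSet Ω (3 * φ.rOut)).indicator fun _ => 1)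

variable (φ : ContDiffBump (0 : Sp d))

theorem locallyIntegrable_indicator_innerSet (δ : ℝ) :
    LocallyIntegrable ((innerSet Ω δ).indicator fun _ => (1 : ℝ)) volume :=
  (locallyIntegrable_const (1 : ℝ)).indicator (isClosed_innerSet Ω δ).measurableSet

theorem contDiff_cutoff : ContDiff ℝ ∞ (cutoff Ω φ) :=
  contDiff_moll φ (locallyIntegrable_indicator_innerSet _)

theorem integrable_normed_mul_indicator (s : Set (Sp d)) (hs : MeasurableSet s) (x : Sp d) :
    Integrable fun t => φ.normed volume t * s.indicator (fun _ => (1 : ℝ)) (x - t) := by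
  refine φ.integrable_normed.mul_bdd (c := 1) ?_ ?_
  · exact ((measurable_const.indicator hs).comp
      (measurable_const.sub measurable_id)).aestronglyMeasurable
  · refine Filter.Eventually.of_forall fun t => ?_
    by_cases h : x - t ∈ s <;> simp [h]

theorem cutoff_nonneg (x : Sp d) : 0 ≤ cutoff Ω φ x := by
  rw [cutoff, moll_apply']
  refine integral_nonneg fun t => mul_nonneg (φ.nonneg_normed t) ?_
  exact Set.indicator_nonneg (fun _ _ => zero_le_one) _

theorem cutoff_le_one (x : Sp d) : cutoff Ω φ x ≤ 1 := by
  rw [cutoff, moll_apply']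
  refine le_of_le_of_eq ?_ (φ.integral_normed (μ := volume))
  refine integral_mono (integrable_normed_mul_indicator φ _
    (isClosed_innerSet Ω _).measurableSet x) φ.integrable_normed fun t => ?_
  refine mul_le_of_le_one_right (φ.nonneg_normed t) ?_
  exact Set.indicator_le_self' (fun _ _ => zero_le_one) _

theorem norm_lt_of_normed_ne_zero {t : Sp d} (ht : φ.normed volume t ≠ 0) : ‖t‖ < φ.rOut := by
  have : t ∈ Function.support (φ.normed (volume : Measure (Sp d))) := ht
  rw [φ.support_normed_eq] at this
  simpa using this

/-- The indicator is taken at depth `3 * rOut` and mollification blurs by one radius: value one from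
depth four, support within depth two. Depth two leaves room for the closed balls required by
`pderiv_moll`. -/
theorem cutoff_eq_one {x : Sp d} (hx : x ∈ innerSet Ω (4 * φ.rOut)) : cutoff Ω φ x = 1 := by
  rw [cutoff, moll_apply']
  refine Eq.trans ?_ (φ.integral_normed (μ := volume))
  refine integral_congr_ae (Filter.Eventually.of_forall fun t => ?_)
  simp only
  by_cases ht : φ.normed volume t = 0
  · simp [ht]
  · have ht' := norm_lt_of_normed_ne_zero φ ht
    have : x - t ∈ innerSet Ω (3 * φ.rOut) := by
      refine Set.Subset.trans (Metric.ball_subset_ball' ?_) hx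
      rw [dist_eq_norm]
      simp only [sub_sub_cancel_left, norm_neg]
      linarith
    simp [this]

theorem tsupport_cutoff_subset : tsupport (cutoff Ω φ) ⊆ innerSet Ω (2 * φ.rOut) := by
  refine closure_minimal (fun x hx => ?_) (isClosed_innerSet Ω _)
  by_contra hn
  refine hx ?_
  rw [cutoff, moll_apply']
  refine integral_eq_zero_of_ae (Filter.Eventually.of_forall fun t => ?_)
  simp only [Pi.zero_apply]
  by_cases ht : φ.normed volume t = 0
  · simp [ht]
  · have ht' := norm_lt_of_normed_ne_zero φ ht
    have : x - t ∉ innerSet Ω (3 * φ.rOut) := by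
      intro h
      refine hn (Set.Subset.trans (Metric.ball_subset_ball' ?_) h)
      rw [dist_eq_norm]
      simp only [sub_sub_cancel]
      linarith
    simp [this]

theorem hasCompactSupport_cutoff (hb : Bornology.IsBounded Ω) :
    HasCompactSupport (cutoff Ω φ) :=
  Metric.isCompact_of_isClosed_isBounded (isClosed_tsupport _)
    (hb.subset ((tsupport_cutoff_subset φ).trans (innerSet_subset (by linarith [φ.rOut_pos]))))

/-- The cutoff function decreases along the rays from the points of a ball. -/
theorem cutoff_add_smul_le (hΩ : Convex ℝ Ω) {x₀ : Sp d} {r : ℝ}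
    (hr : Metric.ball x₀ (2 * r) ⊆ Ω) (hφ : 4 * φ.rOut ≤ r) (x : Sp d) {b : Sp d} (hb : ‖b‖ ≤ r)
    {s : ℝ} (hs : 0 ≤ s) : cutoff Ω φ (x + s • (x - x₀ + b)) ≤ cutoff Ω φ x := by
  rw [cutoff, moll_apply', moll_apply']
  have hm := (isClosed_innerSet Ω (3 * φ.rOut)).measurableSet
  refine integral_mono (integrable_normed_mul_indicator φ _ hm _)
    (integrable_normed_mul_indicator φ _ hm _) fun t => ?_
  simp only
  by_cases ht : φ.normed volume t = 0
  · simp [ht]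
  refine mul_le_mul_of_nonneg_left ?_ (φ.nonneg_normed t)
  have ht' := norm_lt_of_normed_ne_zero φ ht
  by_cases h : x + s • (x - x₀ + b) - t ∈ innerSet Ω (3 * φ.rOut)
  · have h2 : x₀ - b - t ∈ innerSet Ω (3 * φ.rOut) := by
      refine Set.Subset.trans (Metric.ball_subset_ball' ?_) hr
      rw [dist_eq_norm]
      have : ‖x₀ - b - t - x₀‖ ≤ ‖b‖ + ‖t‖ := by
        rw [show x₀ - b - t - x₀ = -(b + t) by abel, norm_neg]
        exact norm_add_le _ _
      linarith
    have h3 := convex_innerSet hΩ (3 * φ.rOut) h h2 (a := 1 / (1 + s)) (b := s / (1 + s))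
      (by positivity) (by positivity) (by field_simp)
    have h4 : (1 / (1 + s)) • (x + s • (x - x₀ + b) - t) + (s / (1 + s)) • (x₀ - b - t)
        = x - t := by
      have hs' : (1 + s) ≠ 0 := by positivity
      rw [div_eq_inv_mul, div_eq_inv_mul, mul_smul, mul_smul, ← smul_add, inv_smul_eq_iff₀ hs']
      module
    rw [h4] at h3
    rw [Set.indicator_of_mem h, Set.indicator_of_mem h3]
  · simp only [h, not_false_eq_true, Set.indicator_of_notMem]
    exact Set.indicator_nonneg (fun _ _ => zero_le_one) _

/-- Along `x - x₀ + b` the cutoff does not increase, for every `‖b‖ ≤ r`; optimizing over `b` gives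
the full gradient. It is the smooth counterpart of the bound `n · (x - x₀) ≥ r` for the outer normal
of a domain that is star-shaped about a ball. -/
theorem norm_fderiv_cutoff_le (hΩ : Convex ℝ Ω) {x₀ : Sp d} {r : ℝ} (hr0 : 0 < r)
    (hr : Metric.ball x₀ (2 * r) ⊆ Ω) (hφ : 4 * φ.rOut ≤ r) (x : Sp d) :
    r * ‖fderiv ℝ (cutoff Ω φ) x‖ ≤ - fderiv ℝ (cutoff Ω φ) x (x - x₀) := by
  set L := fderiv ℝ (cutoff Ω φ) x with hL
  have hder : HasFDerivAt (cutoff Ω φ) L x :=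
    ((contDiff_cutoff φ).differentiable (by simp) x).hasFDerivAt
  have hneg : ∀ b, ‖b‖ ≤ r → L b ≤ - L (x - x₀) := by
    intro b hb
    have h1 := (hder.hasLineDerivAt (x - x₀ + b)).tendsto_slope_zero_right
    have h2 : L (x - x₀ + b) ≤ 0 := by
      refine le_of_tendsto h1 ?_
      filter_upwards [self_mem_nhdsWithin] with s hs
      have hs : 0 < s := hs
      have := cutoff_add_smul_le φ hΩ hr hφ x hb hs.le
      rw [smul_eq_mul]
      exact mul_nonpos_of_nonneg_of_nonpos (by positivity) (by linarith)
    rw [map_add] at h2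
    linarith
  have h0 : 0 ≤ - L (x - x₀) := by simpa using hneg 0 (by simpa using hr0.le)
  rw [← le_div_iff₀' hr0]
  refine L.opNorm_le_bound (by positivity) fun v => ?_
  by_cases hv : v = 0
  · simp [hv]
  have hv' : 0 < ‖v‖ := norm_pos_iff.2 hv
  have hn : ‖(r / ‖v‖) • v‖ = r := by
    rw [norm_smul, Real.norm_of_nonneg (by positivity)]
    field_simp
  have h1 := hneg _ hn.le
  have h2 := hneg (-((r / ‖v‖) • v)) (by rw [norm_neg, hn])
  rw [map_smul, smul_eq_mul] at h1
  rw [map_neg, map_smul, smul_eq_mul] at h2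
  have h3 : r / ‖v‖ * |L v| ≤ - L (x - x₀) := by
    rcases abs_cases (L v) with ⟨h, _⟩ | ⟨h, _⟩ <;> rw [h] <;> linarith
  rw [Real.norm_eq_abs]
  calc |L v| = (r / ‖v‖ * |L v|) * (‖v‖ / r) := by field_simp
    _ ≤ (- L (x - x₀)) * (‖v‖ / r) := by gcongr
    _ = _ := by ring

end Cutoff

/-! ## Sobolev embedding in convex domains -/

section Sobolev

variable {d : ℕ} {Ω : Set (Sp d)}

theorem clm_apply_eq_sum (L : Sp d →L[ℝ] ℝ) (v : Sp d) :
    L v = ∑ i, v i * L (EuclideanSpace.single i 1) := by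
  conv_lhs => rw [← (EuclideanSpace.basisFun (Fin d) ℝ).sum_repr v, map_sum]
  simp

theorem norm_clm_le_sum (L : Sp d →L[ℝ] ℝ) :
    ‖L‖ ≤ ∑ i, |L (EuclideanSpace.single i 1)| := by
  refine L.opNorm_le_bound (Finset.sum_nonneg fun _ _ => abs_nonneg _) fun v => ?_
  rw [clm_apply_eq_sum, Finset.sum_mul]
  refine (norm_sum_le _ _).trans (Finset.sum_le_sum fun i _ => ?_)
  rw [norm_mul, mul_comm]
  gcongr
  · exact le_rfl
  · exact PiLp.norm_apply_le v i

/-- The divergence theorem for the field `f(x) (x - x₀)` with `f` of compact support. -/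
theorem integral_fderiv_radial {f : Sp d → ℝ} (hf : ContDiff ℝ 1 f) (hc : HasCompactSupport f)
    (x₀ : Sp d) : ∫ x, fderiv ℝ f x (x - x₀) = - (d * ∫ x, f x) := by
  have hpc : ∀ i, Continuous (pderiv i f) := fun i =>
    (hf.continuous_fderiv (by simp)).clm_apply continuous_const
  have hcs : ∀ i, HasCompactSupport (pderiv i f) := fun i =>
    (hc.fderiv (𝕜 := ℝ)).comp_left (g := fun L : Sp d →L[ℝ] ℝ =>
      L (EuclideanSpace.single i 1)) (by simp)
  have hlin : ∀ i : Fin d, ContDiff ℝ 1 fun x : Sp d => (x - x₀) i := fun i => by fun_prop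
  have hpl : ∀ (i : Fin d) (x : Sp d), pderiv i (fun x : Sp d => (x - x₀) i) x = 1 := by
    intro i x
    have : HasFDerivAt (fun x : Sp d => (x - x₀) i) (EuclideanSpace.proj (𝕜 := ℝ) i) x := by
      have := (EuclideanSpace.proj (𝕜 := ℝ) i : Sp d →L[ℝ] ℝ).hasFDerivAt.comp x
        ((hasFDerivAt_id x).sub_const x₀)
      exact this
    rw [pderiv, this.fderiv]
    simp
  calc ∫ x, fderiv ℝ f x (x - x₀) = ∫ x, ∑ i, (x - x₀) i * pderiv i f x := by
        refine integral_congr_ae (Filter.Eventually.of_forall fun x => ?_)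
        exact clm_apply_eq_sum _ _
    _ = ∑ i, ∫ x, (x - x₀) i * pderiv i f x := by
        refine integral_finsetSum _ fun i _ => ?_
        exact ((hlin i).continuous.mul (hpc i)).integrable_of_hasCompactSupport (hcs i).mul_left
    _ = ∑ i : Fin d, - ∫ x, f x := by
        refine Finset.sum_congr rfl fun i _ => ?_
        rw [integral_pderiv_mul_eq_neg (hlin i) hf hc]
        simp only [hpl, one_mul]
    _ = _ := by simp

/-- `W^{1,1}` bound of `w² χ`, where `χ` decreases in the radial directions. -/
theorem integral_norm_fderiv_sq_mul_le {w χ G : Sp d → ℝ} (hw : ContDiff ℝ 1 w)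
    (hχ : ContDiff ℝ 1 χ) (hχc : HasCompactSupport χ) (hχ0 : ∀ x, 0 ≤ χ x) (hχ1 : ∀ x, χ x ≤ 1)
    {x₀ : Sp d} {r R : ℝ} (hr : 0 < r) (hR : 0 ≤ R)
    (hrad : ∀ x, r * ‖fderiv ℝ χ x‖ ≤ - fderiv ℝ χ x (x - x₀))
    (hsupp : ∀ x, χ x ≠ 0 → ‖x - x₀‖ ≤ R ∧ ‖fderiv ℝ w x‖ ≤ G x)
    (hw2 : Integrable fun x => w x ^ 2) (hG2 : Integrable fun x => G x ^ 2) :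
    ∫ x, ‖fderiv ℝ (fun x => w x ^ 2 * χ x) x‖
      ≤ (1 + (d + R) / r) * ((∫ x, w x ^ 2) + ∫ x, G x ^ 2) := by
  have hf : ContDiff ℝ 1 fun x => w x ^ 2 * χ x := (hw.pow 2).mul hχ
  have hfc : HasCompactSupport fun x => w x ^ 2 * χ x := hχc.mul_left
  have hder : ∀ x, fderiv ℝ (fun x => w x ^ 2 * χ x) x
      = (2 * w x * χ x) • fderiv ℝ w x + w x ^ 2 • fderiv ℝ χ x := by
    intro x
    have h1 := (hw.differentiable (by simp) x).hasFDerivAt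
    have h2 := (hχ.differentiable (by simp) x).hasFDerivAt
    have h3 := (h1.pow 2).mul h2
    refine h3.fderiv.trans ?_
    ext v
    simp
    ring
  have hpt : ∀ x, 2 * |w x| * χ x * ‖fderiv ℝ w x‖ ≤ w x ^ 2 + G x ^ 2 := by
    intro x
    by_cases h : χ x = 0
    · rw [h, mul_zero, zero_mul]
      positivity
    · have h1 := (hsupp x h).2
      have h2 : |w x| ^ 2 = w x ^ 2 := sq_abs _
      have h3 : 2 * |w x| * χ x * ‖fderiv ℝ w x‖ ≤ 2 * |w x| * 1 * G x := by
        gcongr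
        exact hχ1 x
      nlinarith [sq_nonneg (|w x| - G x)]
  have hptR : ∀ x, 2 * w x * χ x * fderiv ℝ w x (x - x₀) ≤ R * (w x ^ 2 + G x ^ 2) := by
    intro x
    by_cases h : χ x = 0
    · rw [h, mul_zero, zero_mul]
      positivity
    · have h1 := (hsupp x h).1
      have h2 : |fderiv ℝ w x (x - x₀)| ≤ ‖fderiv ℝ w x‖ * R :=
        ((fderiv ℝ w x).le_opNorm _).trans (by gcongr)
      calc 2 * w x * χ x * fderiv ℝ w x (x - x₀)
          ≤ |2 * w x * χ x * fderiv ℝ w x (x - x₀)| := le_abs_self _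
        _ = 2 * |w x| * χ x * |fderiv ℝ w x (x - x₀)| := by
            rw [abs_mul, abs_mul, abs_mul, abs_of_nonneg (hχ0 x)]
            norm_num
        _ ≤ 2 * |w x| * χ x * (‖fderiv ℝ w x‖ * R) := by
            have := hχ0 x
            gcongr
        _ = R * (2 * |w x| * χ x * ‖fderiv ℝ w x‖) := by ring
        _ ≤ _ := by
            gcongr
            exact hpt x
  -- the trace term
  have hint1 : Integrable fun x => w x ^ 2 * - fderiv ℝ χ x (x - x₀) := by
    refine Continuous.integrable_of_hasCompactSupport ?_ ?_
    · have := hw.continuous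
      have h2 := hχ.continuous_fderiv (by simp)
      fun_prop
    · refine HasCompactSupport.mul_left ?_
      refine (hχc.fderiv (𝕜 := ℝ)).mono ?_
      intro x hx h
      simp only [Function.mem_support, ne_eq, neg_eq_zero] at hx
      exact hx (by rw [h]; simp)
  have hI : Integrable fun x => w x ^ 2 + G x ^ 2 := hw2.add hG2
  -- The gradient of the cutoff blows up as its layer shrinks. Its contribution is still bounded,
  -- because the divergence theorem for `w² χ (x - x₀)` expresses it through integrals without
  -- derivatives of `χ`.
  have htrace : ∫ x, w x ^ 2 * - fderiv ℝ χ x (x - x₀)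
      ≤ (d + R) * ((∫ x, w x ^ 2) + ∫ x, G x ^ 2) := by
    have hdiv := integral_fderiv_radial hf hfc x₀
    have hint2 : Integrable fun x => 2 * w x * χ x * fderiv ℝ w x (x - x₀) := by
      refine Continuous.integrable_of_hasCompactSupport ?_ (hχc.mul_left.mul_right)
      have h0 := hw.continuous
      have h1 := hχ.continuous
      have h2 := hw.continuous_fderiv (by simp)
      fun_prop
    have e1 : ∫ x, fderiv ℝ (fun x => w x ^ 2 * χ x) x (x - x₀)
        = (∫ x, 2 * w x * χ x * fderiv ℝ w x (x - x₀))
          - ∫ x, w x ^ 2 * - fderiv ℝ χ x (x - x₀) := by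
      rw [← integral_sub hint2 hint1]
      refine integral_congr_ae (Filter.Eventually.of_forall fun x => ?_)
      simp only [hder]
      simp
      ring
    have e2 : ∫ x, w x ^ 2 * χ x ≤ ∫ x, w x ^ 2 := by
      refine integral_mono ((hf.continuous).integrable_of_hasCompactSupport hfc) hw2 fun x => ?_
      exact mul_le_of_le_one_right (sq_nonneg _) (hχ1 x)
    have e3 : ∫ x, 2 * w x * χ x * fderiv ℝ w x (x - x₀)
        ≤ R * ((∫ x, w x ^ 2) + ∫ x, G x ^ 2) := by
      rw [← integral_add hw2 hG2, ← integral_const_mul]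
      exact integral_mono hint2 (hI.const_mul R) hptR
    have e4 : 0 ≤ ∫ x, G x ^ 2 := integral_nonneg fun x => sq_nonneg _
    have hd : (0 : ℝ) ≤ d := Nat.cast_nonneg d
    nlinarith
  calc ∫ x, ‖fderiv ℝ (fun x => w x ^ 2 * χ x) x‖
      ≤ ∫ x, ((w x ^ 2 + G x ^ 2) + r⁻¹ * (w x ^ 2 * - fderiv ℝ χ x (x - x₀))) := by
        refine integral_mono ?_ (hI.add (hint1.const_mul _)) fun x => ?_
        · exact ((hf.continuous_fderiv (by simp)).integrable_of_hasCompactSupport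
            (hfc.fderiv (𝕜 := ℝ))).norm
        · simp only [hder]
          refine (norm_add_le _ _).trans (add_le_add ?_ ?_)
          · rw [norm_smul, Real.norm_eq_abs, abs_mul, abs_mul, abs_of_nonneg (hχ0 x)]
            simpa using hpt x
          · rw [norm_smul, Real.norm_of_nonneg (sq_nonneg _), mul_left_comm]
            gcongr
            rw [le_inv_mul_iff₀ hr]
            exact hrad x
    _ = ((∫ x, w x ^ 2) + ∫ x, G x ^ 2) + r⁻¹ * ∫ x, w x ^ 2 * - fderiv ℝ χ x (x - x₀) := by
        rw [integral_add hI (hint1.const_mul _), integral_add hw2 hG2, integral_const_mul]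
    _ ≤ ((∫ x, w x ^ 2) + ∫ x, G x ^ 2)
          + r⁻¹ * ((d + R) * ((∫ x, w x ^ 2) + ∫ x, G x ^ 2)) := by gcongr
    _ = _ := by
        field_simp

end Sobolev

/-! ### Limit passage: integrability of `H¹` and `H¹₀` functions and of their products -/

section Embedding

variable {d : ℕ} {Ω : Set (Sp d)}

theorem integral_sq_eq {X : Type*} [MeasurableSpace X] {μ : Measure X} {f : X → ℝ}
    (hf : MemLp f 2 μ) : ∫ x, f x ^ 2 ∂μ = (eLpNorm f 2 μ).toReal ^ 2 := by
  have h : ENNReal.ofReal (∫ x, f x ^ 2 ∂μ) = eLpNorm f 2 μ ^ 2 := by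
    rw [ofReal_integral_eq_lintegral_ofReal hf.integrable_sq
      (Filter.Eventually.of_forall fun _ => sq_nonneg _), eLpNorm_two_eq, ← ENNReal.rpow_natCast,
      ← ENNReal.rpow_mul]
    norm_num
    refine lintegral_congr fun x => ?_
    rw [← sq_abs, ENNReal.ofReal_pow (abs_nonneg _), Real.enorm_eq_ofReal_abs]
  rw [← ENNReal.toReal_pow, ← h, ENNReal.toReal_ofReal (integral_nonneg fun _ => sq_nonneg _)]

theorem memLp_indicator_fn (hΩ : IsOpen Ω) (u : L2 Ω) :
    MemLp (Ω.indicator u) 2 (volume : Measure (Sp d)) :=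
  (memLp_indicator_iff_restrict hΩ.measurableSet).2 (Lp.memLp u)

theorem memLp_indicator_coord (hΩ : IsOpen Ω) (g : L2v Ω) (i : Fin d) :
    MemLp (Ω.indicator fun y => g y i) 2 (volume : Measure (Sp d)) :=
  (memLp_indicator_iff_restrict hΩ.measurableSet).2 (memLp_coord g i)

/-- Approximations of the identity adapted to a domain containing a ball of radius `2 r`. -/
noncomputable def bumpSeq (d : ℕ) {r : ℝ} (hr : 0 < r) (n : ℕ) : ContDiffBump (0 : Sp d) where
  rIn := r / (8 * (n + 1))
  rOut := r / (4 * (n + 1))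
  rIn_pos := by positivity
  rIn_lt_rOut := by
    have : (0 : ℝ) < n + 1 := by positivity
    gcongr
    linarith

theorem tendsto_bumpSeq_rOut {r : ℝ} (hr : 0 < r) :
    Filter.Tendsto (fun n => (bumpSeq d hr n).rOut) Filter.atTop (nhds 0) := by
  have := (tendsto_one_div_add_atTop_nhds_zero_nat (𝕜 := ℝ)).const_mul (r / 4)
  rw [mul_zero] at this
  refine this.congr fun n => ?_
  simp only [bumpSeq]
  field_simp

/-- The Sobolev embedding of `H¹(Ω)` for convex `Ω`: the squares belong to `L^{d/(d-1)}`. -/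
theorem memLp_sq_fn (hΩo : IsOpen Ω) (hΩc : Convex ℝ Ω) (hΩb : Bornology.IsBounded Ω)
    (hΩn : Ω.Nonempty) (u : H1 Ω) {p : NNReal}
    (hp : NNReal.HolderConjugate (Module.finrank ℝ (Sp d)) p) :
    MemLp (fun x => fn u x ^ 2) p ((volume : Measure (Sp d)).restrict Ω) := by
  obtain ⟨x₀, hx₀⟩ := hΩn
  obtain ⟨r', hr', hball'⟩ := Metric.isOpen_iff.1 hΩo x₀ hx₀
  set r := r' / 2 with hrd
  have hr : 0 < r := by positivity
  have hball : Metric.ball x₀ (2 * r) ⊆ Ω := by rwa [show 2 * r = r' by rw [hrd]; ring]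
  obtain ⟨R, hR0, hR⟩ : ∃ R, 0 ≤ R ∧ ∀ x ∈ Ω, ‖x - x₀‖ ≤ R := by
    obtain ⟨R, hR⟩ := hΩb.subset_closedBall x₀
    refine ⟨max R 0, le_max_right _ _, fun x hx => ?_⟩
    have := hR hx
    rw [Metric.mem_closedBall, dist_eq_norm] at this
    exact this.trans (le_max_left _ _)
  let φ := bumpSeq d hr
  have hφr : ∀ n, 4 * (φ n).rOut ≤ r := fun n => by
    simp only [φ, bumpSeq]
    rw [← mul_div_assoc, mul_div_mul_left _ _ (by norm_num)]
    exact div_le_self hr.le (by simp)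
  have hweak : IsWeakGrad Ω (fn u) (grad u) := u.2
  set ut := Ω.indicator (fn u) with hut
  have hum : MemLp ut 2 volume := memLp_indicator_fn hΩo _
  have hgm := memLp_indicator_coord hΩo (grad u)
  have hloc : LocallyIntegrable ut volume := hum.locallyIntegrable (by norm_num)
  let w : ℕ → Sp d → ℝ := fun n => moll (φ n) ut
  let χ : ℕ → Sp d → ℝ := fun n => cutoff Ω (φ n)
  -- `G n` uses the mollified weak gradient extended by zero. It is square integrable uniformly in
  -- `n` and bounds the derivative of `w n` where the cutoff lives; near the boundary it need not.
  let G : ℕ → Sp d → ℝ := fun n x => ∑ i, |moll (φ n) (Ω.indicator fun y => grad u y i) x|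
  have hGm : ∀ n, MemLp (G n) 2 volume := fun n =>
    memLp_finsetSum _ fun i _ => (memLp_moll (φ n) (hgm i)).1.abs
  have hw2 : ∀ n, ∫ x, w n x ^ 2 ≤ (eLpNorm ut 2 volume).toReal ^ 2 := fun n => by
    rw [integral_sq_eq (memLp_moll (φ n) hum).1]
    exact pow_le_pow_left₀ ENNReal.toReal_nonneg
      (ENNReal.toReal_mono hum.2.ne (memLp_moll (φ n) hum).2) 2
  set B := ∑ i, eLpNorm (Ω.indicator fun y => grad u y i) 2 volume with hB
  have hBt : B ≠ ⊤ := (ENNReal.sum_lt_top.2 fun i _ => (hgm i).2).ne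
  have hG2 : ∀ n, ∫ x, G n x ^ 2 ≤ B.toReal ^ 2 := fun n => by
    have hGB : eLpNorm (G n) 2 volume ≤ B := by
      have hGs : G n = ∑ i, fun x => ‖moll (φ n) (Ω.indicator fun y => grad u y i) x‖ := by
        ext x
        simp only [Finset.sum_apply, G, Real.norm_eq_abs]
      rw [hGs]
      refine (eLpNorm_sum_le (fun i _ => (memLp_moll (φ n) (hgm i)).1.norm.1)
        (by norm_num)).trans ?_
      refine Finset.sum_le_sum fun i _ => ?_
      rw [eLpNorm_norm]
      exact (memLp_moll (φ n) (hgm i)).2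
    rw [integral_sq_eq (hGm n)]
    exact pow_le_pow_left₀ ENNReal.toReal_nonneg (ENNReal.toReal_mono hBt hGB) 2
  -- This bound does not involve `n`: the geometry enters only through the inner radius `r` and the
  -- outer radius `R`.
  set K := (1 + (d + R) / r) * ((eLpNorm ut 2 volume).toReal ^ 2 + B.toReal ^ 2) with hK
  have hwχ : ∀ n, ContDiff ℝ 1 fun x => w n x ^ 2 * χ n x := fun n =>
    (((contDiff_moll (φ n) hloc).of_le (by simp)).pow 2).mul
      ((contDiff_cutoff (φ n)).of_le (by simp))
  have hbound : ∀ n, eLpNorm (fun x => w n x ^ 2 * χ n x) p volume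
      ≤ eLpNormLESNormFDerivOneConst (volume : Measure (Sp d)) p * ENNReal.ofReal K := fun n => by
    have hcs : HasCompactSupport fun x => w n x ^ 2 * χ n x :=
      (hasCompactSupport_cutoff (φ n) hΩb).mul_left
    refine (eLpNorm_le_eLpNorm_fderiv_one volume (hwχ n) hcs hp).trans ?_
    gcongr
    rw [eLpNorm_one_eq_lintegral_enorm, ← ofReal_integral_norm_eq_lintegral_enorm
      (((hwχ n).continuous_fderiv (by simp)).integrable_of_hasCompactSupport
        (hcs.fderiv (𝕜 := ℝ)))]
    refine ENNReal.ofReal_le_ofReal ?_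
    have h := integral_norm_fderiv_sq_mul_le (w := w n) (χ := χ n) (G := G n)
      ((contDiff_moll (φ n) hloc).of_le (by simp)) ((contDiff_cutoff (φ n)).of_le (by simp))
      (hasCompactSupport_cutoff (φ n) hΩb) (cutoff_nonneg (φ n)) (cutoff_le_one (φ n)) hr hR0
      (fun x => norm_fderiv_cutoff_le (φ n) hΩc hr hball (hφr n) x) (fun x hx => ?_)
      (memLp_moll (φ n) hum).1.integrable_sq (hGm n).integrable_sq
    · refine h.trans ?_
      rw [hK]
      have : 0 ≤ (d + R) / r := by positivity
      gcongr
      · exact hw2 n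
      · exact hG2 n
    · have hin : x ∈ innerSet Ω (2 * (φ n).rOut) :=
        tsupport_cutoff_subset (φ n) (subset_tsupport _ hx)
      have hpos := (φ n).rOut_pos
      refine ⟨hR x (innerSet_subset (by linarith) hin), ?_⟩
      refine (norm_clm_le_sum _).trans_eq (Finset.sum_congr rfl fun i _ => ?_)
      rw [← pderiv_moll (φ n) hΩo hweak hloc
        ((Metric.closedBall_subset_ball (by linarith)).trans hin) i]
      rfl
  -- Almost every point is a Lebesgue point of `u`, and the cutoff is eventually one at every point
  -- of the open set. Fatou's lemma then carries the uniform bound to the limit.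
  have hlim : ∀ᵐ x ∂((volume : Measure (Sp d)).restrict Ω),
      Filter.Tendsto (fun n => w n x ^ 2 * χ n x) Filter.atTop (nhds (fn u x ^ 2)) := by
    have h1 := ContDiffBump.ae_convolution_tendsto_right_of_locallyIntegrable (K := 2)
      (φ := φ) (l := Filter.atTop) (tendsto_bumpSeq_rOut hr)
      (Filter.Eventually.of_forall fun n => by
        simp only [φ, bumpSeq]
        refine le_of_eq ?_
        field_simp
        norm_num) hloc
    filter_upwards [ae_restrict_of_ae h1, ae_restrict_mem hΩo.measurableSet] with x hx hxΩ
    have h2 : Filter.Tendsto (fun n => w n x) Filter.atTop (nhds (fn u x)) := by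
      have h3 : ut x = fn u x := by simp [hut, hxΩ]
      rw [← h3]
      exact hx.congr fun n => (moll_eq_convolution' (φ n) ut x).symm
    have h4 : Filter.Tendsto (fun n => χ n x) Filter.atTop (nhds 1) := by
      obtain ⟨ρ, hρ, hρb⟩ := Metric.isOpen_iff.1 hΩo x hxΩ
      refine tendsto_const_nhds.congr' ?_
      filter_upwards [(tendsto_bumpSeq_rOut (d := d) hr).eventually_lt_const
        (show (0 : ℝ) < ρ / 4 by positivity)] with n hn
      refine (cutoff_eq_one (φ n) ((Metric.ball_subset_ball ?_).trans hρb)).symm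
      have : (φ n).rOut < ρ / 4 := hn
      linarith
    simpa using (h2.pow 2).mul h4
  refine ⟨((Lp.memLp (fn u)).1.pow 2), ?_⟩
  refine lt_of_le_of_lt (Lp.eLpNorm_lim_le_liminf_eLpNorm
    (fun n => (hwχ n).continuous.aestronglyMeasurable) _ hlim) ?_
  refine lt_of_le_of_lt (Filter.liminf_le_of_frequently_le' (Filter.Frequently.of_forall fun n =>
    (eLpNorm_mono_measure _ Measure.restrict_le_self).trans (hbound n))) ?_
  exact ENNReal.mul_lt_top ENNReal.coe_lt_top ENNReal.ofReal_lt_top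

theorem memLp_of_sq {X : Type*} [MeasurableSpace X] {μ : Measure X} {f : X → ℝ}
    (hf : AEStronglyMeasurable f μ) {p : ENNReal} (h : MemLp (fun x => f x ^ 2) p μ) :
    MemLp f (2 * p) μ := by
  rw [← memLp_norm_rpow_iff hf (q := 2) (by norm_num) (by norm_num), mul_comm,
    ENNReal.mul_div_cancel_right (by norm_num) (by norm_num)]
  refine h.congr_norm (hf.norm.aemeasurable.pow_const _).aestronglyMeasurable ?_
  refine Filter.Eventually.of_forall fun x => ?_
  norm_num

/-- `H¹₀(Ω) ⊂ L⁶(Ω)` in dimension three. -/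
theorem memLp_six_of_mem_H10 {Ω : Set (Sp 3)} {q : L2 Ω × L2v Ω}
    (hq : q ∈ H10 Ω) : MemLp q.1 6 ((volume : Measure (Sp 3)).restrict Ω) := by
  obtain ⟨s, hs, hlim⟩ := mem_closure_iff_seq_limit.1 hq
  choose φ hφ h1 h2 using hs
  have hl1 : Filter.Tendsto (fun n => (s n).1) Filter.atTop (nhds q.1) :=
    (continuous_fst.tendsto q).comp hlim
  have hl2 : Filter.Tendsto (fun n => (s n).2) Filter.atTop (nhds q.2) :=
    (continuous_snd.tendsto q).comp hlim
  obtain ⟨B, hB⟩ := (Metric.isBounded_range_of_tendsto _ hl2).exists_norm_le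
  have hB : ∀ n, ‖(s n).2‖ ≤ B := fun n => hB _ ⟨n, rfl⟩
  -- Convergence in `L²` gives an almost everywhere convergent subsequence, along which the
  -- Gagliardo–Nirenberg–Sobolev bound of the test functions survives by Fatou. The factor `3` below
  -- comes from bounding the derivative by the sum of three partial derivatives.
  obtain ⟨ns, -, hns⟩ := (tendstoInMeasure_of_tendsto_Lp hl1).exists_seq_tendsto_ae
  set C := SNormLESNormFDerivOfEqConst ℝ (volume : Measure (Sp 3)) (2 : NNReal)
  have hbound : ∀ n, eLpNorm (s n).1 6 ((volume : Measure (Sp 3)).restrict Ω)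
      ≤ C * ENNReal.ofReal (3 * B) := fun n => by
    rw [eLpNorm_congr_ae (h1 n)]
    refine (eLpNorm_mono_measure _ Measure.restrict_le_self).trans ?_
    have hgns := eLpNorm_le_eLpNorm_fderiv_of_eq (volume : Measure (Sp 3))
      ((hφ n).smooth.of_le (by simp)) (hφ n).compact (p := 2) (p' := 6) (by norm_num)
      (by simp) (by simp; norm_num)
    refine (show _ ≤ _ from hgns).trans ?_
    gcongr
    change eLpNorm (fderiv ℝ (φ n)) 2 volume ≤ _
    have hsupp : Function.support (fderiv ℝ (φ n)) ⊆ Ω :=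
      (support_fderiv_subset ℝ).trans (hφ n).supp
    have heq := eLpNorm_restrict_eq_of_support_subset (p := 2) (μ := (volume : Measure (Sp 3)))
      (f := fun x => ‖fderiv ℝ (φ n) x‖) (s := Ω) (by
        rw [show (fun x => ‖fderiv ℝ (φ n) x‖) = norm ∘ fderiv ℝ (φ n) from rfl,
          Function.support_comp_eq _ norm_eq_zero]
        exact hsupp)
    rw [eLpNorm_norm, eLpNorm_norm] at heq
    refine heq.symm.le.trans ?_
    have hle : eLpNorm (fderiv ℝ (φ n)) 2 ((volume : Measure (Sp 3)).restrict Ω)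
        ≤ eLpNorm (fun x => (3 : ℝ) * ‖(s n).2 x‖) 2 ((volume : Measure (Sp 3)).restrict Ω) := by
      refine eLpNorm_mono_ae_real ?_
      filter_upwards [ae_all_iff.2 (h2 n)] with x hx
      refine (norm_clm_le_sum _).trans ?_
      calc ∑ i, |fderiv ℝ (φ n) x (EuclideanSpace.single i 1)| ≤ ∑ i : Fin 3, ‖(s n).2 x‖ := by
            refine Finset.sum_le_sum fun i _ => ?_
            have := hx i
            rw [pderiv] at this
            rw [← this]
            exact PiLp.norm_apply_le ((s n).2 x) i
        _ = _ := by simp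
    refine hle.trans ?_
    rw [show (fun x => (3 : ℝ) * ‖(s n).2 x‖) = (3 : ℝ) • fun x => ‖(s n).2 x‖ from rfl,
      eLpNorm_const_smul, eLpNorm_norm, ← Lp.enorm_def, ENNReal.ofReal_mul (by norm_num)]
    gcongr
    · simp [Real.enorm_eq_ofReal_abs]
    · rw [← ofReal_norm]
      exact ENNReal.ofReal_le_ofReal (hB n)
  refine ⟨(Lp.memLp q.1).1, lt_of_le_of_lt (Lp.eLpNorm_lim_le_liminf_eLpNorm
    (fun n => (Lp.memLp (s (ns n)).1).1) _ hns) ?_⟩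
  refine lt_of_le_of_lt (Filter.liminf_le_of_frequently_le'
    (Filter.Frequently.of_forall fun n => hbound (ns n))) ?_
  exact ENNReal.mul_lt_top ENNReal.coe_lt_top ENNReal.ofReal_lt_top

/-- Products of functions in `H¹(Ω)` and `H¹₀(Ω)` are square integrable if `d ∈ {2, 3}`. -/
theorem memLp_mul_fn (hd : d = 2 ∨ d = 3) (hΩo : IsOpen Ω) (hΩc : Convex ℝ Ω)
    (hΩb : Bornology.IsBounded Ω) (hΩn : Ω.Nonempty) (u v : H1 Ω)
    (hv : (fn v, grad v) ∈ H10 Ω) :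
    MemLp (fun x => fn u x * fn v x) 2 ((volume : Measure (Sp d)).restrict Ω) := by
  rcases hd with rfl | rfl
  -- Here `d / (d - 1) = 2`, so both factors are in `L⁴`.
  · have hp : NNReal.HolderConjugate (Module.finrank ℝ (Sp 2)) 2 := by
      rw [finrank_euclideanSpace_fin]
      exact_mod_cast NNReal.HolderConjugate.two_two
    have h4 : ∀ z : H1 Ω, MemLp (fn z) 4 ((volume : Measure (Sp 2)).restrict Ω) := fun z => by
      have := memLp_of_sq (Lp.memLp (fn z)).1 (memLp_sq_fn hΩo hΩc hΩb hΩn z hp)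
      convert this using 1
      norm_num
    have : ENNReal.HolderTriple 4 4 2 := ⟨by
      rw [← two_mul, show (4 : ENNReal) = 2 * 2 by norm_num,
        ENNReal.mul_inv (by norm_num) (by norm_num), ← mul_assoc,
        ENNReal.mul_inv_cancel (by norm_num) (by norm_num), one_mul]⟩
    exact (h4 v).mul (h4 u)
  · have hp : NNReal.HolderConjugate (Module.finrank ℝ (Sp 3)) (3 / 2) := by
      rw [finrank_euclideanSpace_fin, NNReal.holderConjugate_iff]
      refine ⟨by norm_num, ?_⟩
      ext
      push_cast
      norm_num
    -- The square of `u` is only in `L^{3/2}`. For the product to be in `L²` the other factor has to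
    -- be in `L⁶`, and this is where its zero boundary values are used: `1/6 + 1/3 = 1/2`.
    have h3 : MemLp (fn u) 3 ((volume : Measure (Sp 3)).restrict Ω) := by
      have := memLp_of_sq (Lp.memLp (fn u)).1 (memLp_sq_fn hΩo hΩc hΩb hΩn u hp)
      convert this using 1
      rw [ENNReal.coe_div (by norm_num)]
      push_cast
      rw [ENNReal.mul_div_cancel (by norm_num) (by norm_num)]
    have h6 : MemLp (fn v) 6 ((volume : Measure (Sp 3)).restrict Ω) :=
      memLp_six_of_mem_H10 hv
    have : ENNReal.HolderTriple 6 3 2 := ⟨by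
      have e1 : ENNReal.ofReal (6⁻¹ + 3⁻¹) = ENNReal.ofReal 2⁻¹ := by norm_num
      rw [ENNReal.ofReal_add (by norm_num) (by norm_num), ENNReal.ofReal_inv_of_pos (by norm_num),
        ENNReal.ofReal_inv_of_pos (by norm_num), ENNReal.ofReal_inv_of_pos (by norm_num)] at e1
      simpa using e1⟩
    exact h6.mul h3

end Embedding

/-! ## The double well potential -/

section DoubleWell

/-- The derivative of the double well potential, in explicit form. -/
noncomputable def dwfun (s : ℝ) : ℝ :=
  if s ≤ -1 then 2 * (s + 1) else if s ≤ 1 then s * (s ^ 2 - 1) else 2 * (s - 1)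

theorem dwF_of_le {s : ℝ} (h : s ≤ -1) : dwF s = (s + 1) ^ 2 := if_pos h

theorem dwF_of_mid {s : ℝ} (h1 : -1 ≤ s) (h2 : s ≤ 1) : dwF s = (s ^ 2 - 1) ^ 2 / 4 := by
  rcases h1.eq_or_lt with rfl | h
  · norm_num [dwF]
  · rw [dwF, if_neg (not_le.2 h), if_pos h2]

theorem dwF_of_ge {s : ℝ} (h : 1 ≤ s) : dwF s = (s - 1) ^ 2 := by
  rcases h.eq_or_lt with rfl | h
  · norm_num [dwF]
  · rw [dwF, if_neg (by linarith), if_neg (by linarith)]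

theorem dwfun_of_le {s : ℝ} (h : s ≤ -1) : dwfun s = 2 * (s + 1) := if_pos h

theorem dwfun_of_mid {s : ℝ} (h1 : -1 ≤ s) (h2 : s ≤ 1) : dwfun s = s * (s ^ 2 - 1) := by
  rcases h1.eq_or_lt with rfl | h
  · norm_num [dwfun]
  · rw [dwfun, if_neg (not_le.2 h), if_pos h2]

theorem dwfun_of_ge {s : ℝ} (h : 1 ≤ s) : dwfun s = 2 * (s - 1) := by
  rcases h.eq_or_lt with rfl | h
  · norm_num [dwfun]
  · rw [dwfun, if_neg (by linarith), if_neg (by linarith)]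

/-- The potential lies below its osculating parabolas with second derivative `2`. -/
theorem dwF_le (a b : ℝ) : dwF b ≤ dwF a + dwfun a * (b - a) + (b - a) ^ 2 := by
  rcases le_total a (-1) with ha | ha
  · rw [dwF_of_le ha, dwfun_of_le ha]
    rcases le_total b (-1) with hb | hb
    · rw [dwF_of_le hb]
      nlinarith
    rcases le_total b 1 with hb' | hb'
    · rw [dwF_of_mid hb hb']
      nlinarith [mul_nonneg (sq_nonneg (b + 1)) (mul_nonneg (show 0 ≤ b + 1 by linarith)
        (show 0 ≤ 3 - b by linarith))]
    · rw [dwF_of_ge hb']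
      nlinarith
  rcases le_total a 1 with ha' | ha'
  · rw [dwF_of_mid ha ha', dwfun_of_mid ha ha']
    rcases le_total b (-1) with hb | hb
    · rw [dwF_of_le hb]
      nlinarith [mul_nonneg (mul_nonneg (show 0 ≤ 1 - a by linarith) (show 0 ≤ a + 1 by linarith))
        (mul_nonneg (show 0 ≤ a + 1 by linarith) (show 0 ≤ -1 - b by linarith)),
        mul_nonneg (sq_nonneg (a + 1)) (mul_nonneg (show 0 ≤ 1 - a by linarith)
          (show 0 ≤ 3 + a by linarith)),
        mul_nonneg (sq_nonneg (a + 1)) (show 0 ≤ 1 - a by linarith),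
        mul_nonneg (mul_nonneg (show 0 ≤ a + 1 by linarith) (show 0 ≤ 2 - a by linarith))
          (show 0 ≤ -1 - b by linarith),
        mul_nonneg (mul_nonneg (sq_nonneg (a + 1)) (show 0 ≤ 2 - a by linarith))
          (show 0 ≤ -1 - b by linarith)]
    rcases le_total b 1 with hb' | hb'
    · rw [dwF_of_mid hb hb']
      -- Between the wells the gap in the inequality is exactly `(b - a)²` times a quarter of this
      -- quantity.
      have h6 : 0 ≤ 6 - b ^ 2 - 2 * a * b - 3 * a ^ 2 := by nlinarith
      nlinarith [mul_nonneg (sq_nonneg (b - a)) h6]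
    · rw [dwF_of_ge hb']
      nlinarith [mul_nonneg (mul_nonneg (sq_nonneg (1 - a)) (show 0 ≤ 2 + a by linarith))
          (show 0 ≤ b - 1 by linarith),
        mul_nonneg (sq_nonneg (1 - a)) (mul_nonneg (show 0 ≤ 1 + a by linarith)
          (show 0 ≤ 3 - a by linarith)),
        mul_nonneg (sq_nonneg (1 - a)) (show 0 ≤ 1 + a by linarith)]
  · rw [dwF_of_ge ha', dwfun_of_ge ha']
    rcases le_total b (-1) with hb | hb
    · rw [dwF_of_le hb]
      nlinarith
    rcases le_total b 1 with hb' | hb'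
    · rw [dwF_of_mid hb hb']
      nlinarith [mul_nonneg (sq_nonneg (b - 1)) (mul_nonneg (show 0 ≤ 1 - b by linarith)
        (show 0 ≤ 3 + b by linarith))]
    · rw [dwF_of_ge hb']
      nlinarith

theorem continuous_dwF : Continuous dwF := by
  refine Continuous.if_le (by fun_prop) ?_ continuous_id continuous_const ?_
  · refine Continuous.if_le (by fun_prop) (by fun_prop) continuous_id continuous_const ?_
    rintro s rfl
    norm_num
  · rintro s rfl
    norm_num

theorem continuous_dwfun : Continuous dwfun := by
  refine Continuous.if_le (by fun_prop) ?_ continuous_id continuous_const ?_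
  · refine Continuous.if_le (by fun_prop) (by fun_prop) continuous_id continuous_const ?_
    rintro s rfl
    norm_num
  · rintro s rfl
    norm_num

/-- `dwF_le` used at `(a, b)` and at `(b, a)` squeezes the remainder between multiples of `|b - a|`
that are `o(1)` times it. Only continuity of `dwfun` is needed, with no separate treatment of the
points `±1`. -/
theorem hasDerivAt_dwF (a : ℝ) : HasDerivAt dwF (dwfun a) a := by
  rw [hasDerivAt_iff_tendsto]
  have hlim : Filter.Tendsto (fun b => |dwfun b - dwfun a| + |b - a|) (nhds a) (nhds 0) := by
    have : Continuous fun b => |dwfun b - dwfun a| + |b - a| :=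
      (continuous_dwfun.sub continuous_const).abs.add (continuous_id.sub continuous_const).abs
    simpa using this.tendsto a
  refine squeeze_zero (fun b => by positivity) (fun b => ?_) hlim
  by_cases hb : b = a
  · simp [hb]
  have hpos : 0 < |b - a| := abs_pos.2 (sub_ne_zero.2 hb)
  rw [Real.norm_eq_abs, Real.norm_eq_abs, inv_mul_le_iff₀ hpos, smul_eq_mul, abs_le]
  have h1 := dwF_le a b
  have h2 := dwF_le b a
  have h3 := neg_abs_le ((dwfun b - dwfun a) * (b - a))
  rw [abs_mul] at h3
  have h4 : |b - a| * |b - a| = (b - a) ^ 2 := by rw [← sq, sq_abs]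
  have h5 : 0 ≤ |b - a| * |dwfun b - dwfun a| := by positivity
  constructor <;> nlinarith

theorem dwf_eq : dwf = dwfun := funext fun a => (hasDerivAt_dwF a).deriv

theorem dwF_nonneg (s : ℝ) : 0 ≤ dwF s := by
  rw [dwF]
  split_ifs <;> positivity

theorem dwF_le_sq_add_one (s : ℝ) : dwF s ≤ s ^ 2 + 1 := by
  rw [dwF]
  split_ifs with h1 h2
  · nlinarith
  · have : s ^ 2 ≤ 1 := by nlinarith
    nlinarith [sq_nonneg s]
  · nlinarith

/-- Through this bound the energy controls the `L²` norm of the phase field, without a Poincaré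
inequality. -/
theorem sq_le_dwF (s : ℝ) : s ^ 2 ≤ 2 * dwF s + 2 := by
  rw [dwF]
  split_ifs with h1 h2
  · nlinarith [sq_nonneg (s + 2)]
  · nlinarith [sq_nonneg (s ^ 2 - 1)]
  · nlinarith [sq_nonneg (s - 2)]

theorem dwfun_sq_le (s : ℝ) : dwfun s ^ 2 ≤ 4 * dwF s := by
  rw [dwF, dwfun]
  split_ifs with h1 h2
  · nlinarith
  · have : s ^ 2 ≤ 1 := by nlinarith
    nlinarith [sq_nonneg (s ^ 2 - 1), mul_nonneg (sub_nonneg.2 this) (sq_nonneg (s ^ 2 - 1))]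
  · nlinarith

end DoubleWell

/-! ## Solvability of one time step, in terms of abstract forms -/

section AbstractStep

/-- Lagrange multipliers: a functional that vanishes on the kernel of a finite dimensional family
of functionals belongs to the family. -/
theorem exists_multiplier {U P : Type*} [AddCommGroup U] [Module ℝ U] [AddCommGroup P]
    [Module ℝ P] [FiniteDimensional ℝ P] (q : P →ₗ[ℝ] U →ₗ[ℝ] ℝ) (r : U →ₗ[ℝ] ℝ)
    (hr : ∀ u, (∀ a, q a u = 0) → r u = 0) : ∃ a, ∀ u, q a u = r u := by
  have h1 : r ∈ (LinearMap.ker q.flip).dualAnnihilator := by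
    rw [Submodule.mem_dualAnnihilator]
    intro u hu
    refine hr u fun a => ?_
    rw [← LinearMap.flip_apply, LinearMap.mem_ker.1 hu, LinearMap.zero_apply]
  rw [← LinearMap.range_dualMap_eq_dualAnnihilator_ker] at h1
  obtain ⟨ψ, hψ⟩ := h1
  refine ⟨(Module.evalEquiv ℝ P).symm ψ, fun u => ?_⟩
  rw [← hψ, LinearMap.dualMap_apply]
  exact Module.apply_evalEquiv_symm_apply ℝ P (q.flip u) ψ

theorem form_self_nonneg {W : Type*} [AddCommGroup W] [Module ℝ W] (m : W →ₗ[ℝ] W →ₗ[ℝ] ℝ)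
    (hm : ∀ x, x ≠ 0 → 0 < m x x) (x : W) : 0 ≤ m x x := by
  by_cases h : x = 0
  · simp [h]
  · exact (hm x h).le

/-- Completing the square: used with `t = s * τ / 2` to absorb the mixed terms between increment and
potential. -/
theorem quad_form_nonneg {G : Type*} [AddCommGroup G] [Module ℝ G] (k : G →ₗ[ℝ] G →ₗ[ℝ] ℝ)
    (hs : ∀ x y, k x y = k y x) (hk : ∀ x, 0 ≤ k x x) (x y : G) (t : ℝ) :
    0 ≤ k x x + 2 * t * k x y + t ^ 2 * k y y := by
  have := hk (x + t • y)
  simp only [map_add, map_smul, LinearMap.add_apply, LinearMap.smul_apply, smul_eq_mul,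
    hs y x] at this
  linarith

variable {G M U P : Type*} [AddCommGroup G] [Module ℝ G] [AddCommGroup M] [Module ℝ M]
  [AddCommGroup U] [Module ℝ U] [AddCommGroup P] [Module ℝ P] [FiniteDimensional ℝ G]
  [FiniteDimensional ℝ M] [FiniteDimensional ℝ U] [FiniteDimensional ℝ P]

-- The unknowns are `δ = Φ - Φ'`, `ψ`, `n = m - H` and a velocity in the kernel `X` of the
-- divergence constraints. The equations are combined into one: minus the phase equation tested with
-- `y.2.1`, plus the potential equation tested with `y.1 / τ + s * y.2.1`, with factor `c`; the
-- magnetization equation with factor `μ`; the momentum equation. On the diagonal the two terms with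
-- `T` cancel, and so do the terms with `H` in `Bm`. The phase equation alone sees only the gradient
-- of `ψ`; the extra direction with weight `s` makes the form definite in `ψ` itself.
set_option maxHeartbeats 1000000 in
theorem exists_step_of_forms (mG kG : G →ₗ[ℝ] G →ₗ[ℝ] ℝ) (mM : M →ₗ[ℝ] M →ₗ[ℝ] ℝ)
    (mU visc adv : U →ₗ[ℝ] U →ₗ[ℝ] ℝ) (T : U →ₗ[ℝ] G →ₗ[ℝ] ℝ) (q : P →ₗ[ℝ] U →ₗ[ℝ] ℝ)
    (Bm : U →ₗ[ℝ] M →ₗ[ℝ] M →ₗ[ℝ] ℝ) (lf : G →ₗ[ℝ] ℝ) (lκ : M →ₗ[ℝ] ℝ)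
    (mG_symm : ∀ x y, mG x y = mG y x) (mG_pos : ∀ x, x ≠ 0 → 0 < mG x x)
    (kG_symm : ∀ x y, kG x y = kG y x) (kG_nonneg : ∀ x, 0 ≤ kG x x)
    (mM_pos : ∀ x, x ≠ 0 → 0 < mM x x) (mU_pos : ∀ x, x ≠ 0 → 0 < mU x x)
    (visc_nonneg : ∀ x, 0 ≤ visc x x) (adv_skew : ∀ x, adv x x = 0)
    (Bm_skew : ∀ u v w, Bm u v w = - Bm u w v)
    {ε γ c μ tr τ η : ℝ} (hε : 0 < ε) (hγ : 0 < γ) (hc : 0 < c) (hμ : 0 < μ) (htr : 0 < tr)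
    (hτ : 0 < τ) (hη : 0 < η) (Φ' : G) (M' H : M) (U' : U) :
    ∃ (Φ Ψ : G) (m : M) (u : U) (a : P),
      (∀ Λ, mG (Φ - Φ') Λ / τ - T u Λ - γ * kG Ψ Λ = 0) ∧
      (∀ χ, mG Ψ χ + ε * kG Φ χ + (1 / ε) * lf χ + (1 / η) * mG (Φ - Φ') χ = 0) ∧
      (∀ Z, mM (m - M') Z / τ - Bm u Z m + (1 / tr) * mM m Z = (1 / tr) * lκ Z) ∧
      (∀ V, mU (u - U') V / τ + adv u V + visc u V - q a V = μ * Bm V H m + c * T V Ψ) ∧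
      (∀ b, q b u = 0) := by
  -- the weight of the additional test direction of the potential equation
  set s := min 1 (min (4 * γ / (ε * τ)) (2 * η / τ)) with hs
  have hs0 : 0 < s := by positivity
  have hs1 : s ≤ 1 := min_le_left _ _
  -- With `s ≤ 1` this makes the form in the gradients semidefinite; the bound `s * τ ≤ 2 * η`
  -- leaves half of `s * mG ψ ψ` after the mixed `L²` term is absorbed.
  have hs2 : s * (ε * τ) ≤ 4 * γ := by
    rw [← le_div_iff₀ (by positivity)]
    exact (min_le_right _ _).trans (min_le_left _ _)
  have hs3 : s * τ ≤ 2 * η := by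
    rw [← le_div_iff₀ (by positivity)]
    exact (min_le_right _ _).trans (min_le_right _ _)
  let X : Submodule ℝ U := LinearMap.ker q.flip
  have hX : ∀ u : U, u ∈ X ↔ ∀ b, q b u = 0 := fun u => by
    simp only [X, LinearMap.mem_ker, LinearMap.ext_iff, LinearMap.flip_apply, LinearMap.zero_apply]
  obtain ⟨A, hAd⟩ : ∃ A : (G × G × M × X) →ₗ[ℝ] (G × G × M × X) →ₗ[ℝ] ℝ, ∀ x y, A x y =
      c * (-(mG x.1 y.2.1 / τ - T x.2.2.2 y.2.1 - γ * kG x.2.1 y.2.1)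
        + (mG x.2.1 ((1 / τ) • y.1 + s • y.2.1) + ε * kG x.1 ((1 / τ) • y.1 + s • y.2.1)
          + (1 / η) * mG x.1 ((1 / τ) • y.1 + s • y.2.1)))
      + μ * (mM x.2.2.1 y.2.2.1 / τ - Bm x.2.2.2 y.2.2.1 H + (1 / tr) * mM x.2.2.1 y.2.2.1)
      + (mU x.2.2.2 y.2.2.2 / τ + adv x.2.2.2 y.2.2.2 + visc x.2.2.2 y.2.2.2
        - μ * Bm y.2.2.2 H x.2.2.1 - c * T y.2.2.2 x.2.1) := ⟨LinearMap.mk₂ ℝ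
    (fun x y =>
      c * (-(mG x.1 y.2.1 / τ - T x.2.2.2 y.2.1 - γ * kG x.2.1 y.2.1)
        + (mG x.2.1 ((1 / τ) • y.1 + s • y.2.1) + ε * kG x.1 ((1 / τ) • y.1 + s • y.2.1)
          + (1 / η) * mG x.1 ((1 / τ) • y.1 + s • y.2.1)))
      + μ * (mM x.2.2.1 y.2.2.1 / τ - Bm x.2.2.2 y.2.2.1 H + (1 / tr) * mM x.2.2.1 y.2.2.1)
      + (mU x.2.2.2 y.2.2.2 / τ + adv x.2.2.2 y.2.2.2 + visc x.2.2.2 y.2.2.2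
        - μ * Bm y.2.2.2 H x.2.2.1 - c * T y.2.2.2 x.2.1))
    (by
      intro x x' y
      simp only [Prod.fst_add, Prod.snd_add, Submodule.coe_add, map_add, LinearMap.add_apply]
      ring)
    (by
      intro r x y
      simp only [Prod.smul_fst, Prod.smul_snd, Submodule.coe_smul, map_smul, LinearMap.smul_apply,
        smul_eq_mul]
      ring)
    (by
      intro x y y'
      simp only [Prod.fst_add, Prod.snd_add, Submodule.coe_add, map_add, LinearMap.add_apply,
        smul_add]
      ring)
    (by
      intro r x y
      simp only [Prod.smul_fst, Prod.smul_snd, Submodule.coe_smul, map_smul, LinearMap.smul_apply,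
        smul_eq_mul, map_add]
      ring), fun x y => rfl⟩
  let pn : (G × G × M × X) →ₗ[ℝ] M :=
    LinearMap.fst ℝ M X ∘ₗ LinearMap.snd ℝ G (M × X) ∘ₗ LinearMap.snd ℝ G (G × M × X)
  obtain ⟨N, hN⟩ : ∃ N : (G × G × M × X) →ₗ[ℝ] (G × G × M × X) →ₗ[ℝ] (G × G × M × X) →ₗ[ℝ] ℝ,
      ∀ x x' y, N x x' y = - μ * Bm x.2.2.2 y.2.2.1 x'.2.2.1 :=
    ⟨LinearMap.mk₂ ℝ (fun x x' => (-μ) • ((Bm x.2.2.2).flip x'.2.2.1 ∘ₗ pn))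
    (by
      intro x y z
      refine LinearMap.ext fun w => ?_
      simp
      ring)
    (by
      intro r x y
      refine LinearMap.ext fun w => ?_
      simp
      ring)
    (by
      intro x y z
      refine LinearMap.ext fun w => ?_
      simp
      ring)
    (by
      intro r x y
      refine LinearMap.ext fun w => ?_
      simp
      ring), fun x x' y => by simp [pn]⟩
  -- Everything that involves the old time level, `f`, `κ` or the shift `m = n + H`. The term `Bm V
  -- H H` is zero and does not appear.
  obtain ⟨b, hb⟩ : ∃ b : (G × G × M × X) →ₗ[ℝ] ℝ, ∀ y, b y =
        - (c * (ε * kG Φ' ((1 / τ) • y.1 + s • y.2.1) + (1 / ε) * lf ((1 / τ) • y.1 + s • y.2.1))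
          + μ * (mM (H - M') y.2.2.1 / τ + (1 / tr) * mM H y.2.2.1 - (1 / tr) * lκ y.2.2.1)
          - mU U' y.2.2.2 / τ) :=
   ⟨{ toFun := fun y =>
        - (c * (ε * kG Φ' ((1 / τ) • y.1 + s • y.2.1) + (1 / ε) * lf ((1 / τ) • y.1 + s • y.2.1))
          + μ * (mM (H - M') y.2.2.1 / τ + (1 / tr) * mM H y.2.2.1 - (1 / tr) * lκ y.2.2.1)
          - mU U' y.2.2.2 / τ)
      map_add' := by
        intro y y'
        simp only [Prod.fst_add, Prod.snd_add, Submodule.coe_add, map_add, smul_add]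
        ring
      map_smul' := by
        intro r y
        simp only [Prod.smul_fst, Prod.smul_snd, Submodule.coe_smul, map_smul, smul_eq_mul,
          map_add, RingHom.id_apply]
        ring }, fun y => rfl⟩
  have hBm0 : ∀ u v, Bm u v v = 0 := fun u v => by
    have := Bm_skew u v v
    linarith
  have hA : ∀ x, x ≠ 0 → 0 < A x x := by
    rintro ⟨δ, ψ, n, u⟩ hx
    have hAx : A (δ, ψ, n, u) (δ, ψ, n, u)
        = c * ((γ * kG ψ ψ + s * ε * kG δ ψ + ε / τ * kG δ δ)
          + (s * mG ψ ψ + s / η * mG δ ψ + 1 / (η * τ) * mG δ δ))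
          + μ * (1 / τ + 1 / tr) * mM n n + (mU u u / τ + visc u u) := by
      simp only [hAd, map_add, map_smul, smul_eq_mul, adv_skew,
        mG_symm ψ δ, Bm_skew u n H]
      field_simp
      ring
    have hk : 0 ≤ γ * kG ψ ψ + s * ε * kG δ ψ + ε / τ * kG δ δ := by
      have h1 := mul_nonneg (div_nonneg hε.le hτ.le)
        (quad_form_nonneg kG kG_symm kG_nonneg δ ψ (s * τ / 2))
      have h2 : ε / τ * (kG δ δ + 2 * (s * τ / 2) * kG δ ψ + (s * τ / 2) ^ 2 * kG ψ ψ)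
          = ε / τ * kG δ δ + s * ε * kG δ ψ + s * (s * (ε * τ)) / 4 * kG ψ ψ := by
        field_simp
        ring
      have h3 : s * (s * (ε * τ)) / 4 ≤ γ := by nlinarith
      have h4 := mul_le_mul_of_nonneg_right h3 (kG_nonneg ψ)
      linarith
    have hm : s / 2 * mG ψ ψ ≤ s * mG ψ ψ + s / η * mG δ ψ + 1 / (η * τ) * mG δ δ := by
      have h1 := mul_nonneg (div_nonneg zero_le_one (mul_pos hη hτ).le)
        (quad_form_nonneg mG mG_symm (form_self_nonneg mG mG_pos) δ ψ (s * τ / 2))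
      have h2 : 1 / (η * τ) * (mG δ δ + 2 * (s * τ / 2) * mG δ ψ + (s * τ / 2) ^ 2 * mG ψ ψ)
          = 1 / (η * τ) * mG δ δ + s / η * mG δ ψ + s * ((s * τ) / η) / 4 * mG ψ ψ := by
        field_simp
        ring
      have h3 : (s * τ) / η ≤ 2 := by rwa [div_le_iff₀ hη]
      have h4 : s * ((s * τ) / η) / 4 ≤ s / 2 := by nlinarith
      have h5 := mul_le_mul_of_nonneg_right h4 (form_self_nonneg mG mG_pos ψ)
      linarith
    have hψ := form_self_nonneg mG mG_pos ψ
    have hn := form_self_nonneg mM mM_pos n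
    have hu := form_self_nonneg mU mU_pos u
    have hv := visc_nonneg (u : U)
    have p1 : 0 ≤ μ * (1 / τ + 1 / tr) * mM n n := by positivity
    have p2 : 0 ≤ mU u u / τ := by positivity
    have p3 : 0 ≤ c * (s / 2 * mG ψ ψ) := by positivity
    have p4 := mul_nonneg hc.le hk
    have p5 := mul_le_mul_of_nonneg_left hm hc.le
    rw [hAx, mul_add]
    by_cases h1 : ψ = 0
    · subst h1
      by_cases h2 : δ = 0
      · subst h2
        by_cases h3 : n = 0
        · subst h3
          have h4 : (u : U) ≠ 0 := by
            intro h
            apply hx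
            simp only [Prod.mk_eq_zero, true_and]
            exact Subtype.ext h
          have := div_pos (mU_pos _ h4) hτ
          linarith
        · have := mM_pos n h3
          have : 0 < μ * (1 / τ + 1 / tr) * mM n n := by positivity
          linarith
      · have := mG_pos δ h2
        have : 0 < c * (1 / (η * τ) * mG δ δ) := by positivity
        simp only [map_zero, mul_zero, zero_add] at p4 ⊢
        linarith
    · have := mG_pos ψ h1
      have : 0 < c * (s / 2 * mG ψ ψ) := by positivity
      linarith
  obtain ⟨⟨δ, ψ, n, u⟩, hsol⟩ := exists_solution_quadratic A N b hA (fun x => by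
    rw [hN, hBm0, mul_zero])
  simp only [hN, hAd, hb] at hsol
  let r : U →ₗ[ℝ] ℝ := (1 / τ) • mU (u - U') + adv u + visc u - μ • (Bm.flip H).flip (n + H)
    - c • T.flip ψ
  have hr : ∀ V, r V = mU (u - U') V / τ + adv u V + visc u V - μ * Bm V H (n + H)
      - c * T V ψ := fun V => by
    simp only [r, LinearMap.sub_apply, LinearMap.add_apply, LinearMap.smul_apply, smul_eq_mul,
      LinearMap.flip_apply]
    ring
  -- The momentum residual vanishes on the kernel of the constraints, hence is a combination of
  -- them: the pressure.
  obtain ⟨a, ha⟩ := exists_multiplier q r (fun v hv => by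
    have := hsol (0, 0, 0, ⟨v, (hX v).2 hv⟩)
    simp only [map_zero, smul_zero, add_zero, zero_div, mul_zero, LinearMap.zero_apply, sub_zero,
      neg_zero, zero_add, zero_sub, neg_neg] at this
    rw [hr]
    simp only [map_sub, map_add, LinearMap.sub_apply, hBm0, add_zero]
    rw [← sub_eq_zero] at this
    rw [← this]
    ring)
  refine ⟨Φ' + δ, ψ, n + H, u, a, fun Λ => ?_, fun χ => ?_, fun Z => ?_, fun V => ?_,
    (hX u).1 u.2⟩
  -- This choice of the first entry makes the test function of the potential equation vanish, which
  -- isolates the phase equation.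
  · have := hsol (-(s * τ) • Λ, Λ, 0, 0)
    have hz : (1 / τ) • (-(s * τ) • Λ) + s • Λ = 0 := by
      rw [smul_smul, ← add_smul]
      have : 1 / τ * -(s * τ) + s = 0 := by field_simp; ring
      rw [this, zero_smul]
    simp only [hz, map_zero, add_zero, zero_div, mul_zero, LinearMap.zero_apply,
      sub_zero, neg_zero, Submodule.coe_zero] at this
    rw [add_sub_cancel_left]
    have h2 := (mul_eq_zero.1 this).resolve_left hc.ne'
    linarith
  · have := hsol (τ • χ, 0, 0, 0)
    have hz : (1 / τ) • τ • χ = χ := by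
      rw [smul_smul, one_div_mul_cancel hτ.ne', one_smul]
    simp only [hz, map_zero, smul_zero, add_zero, zero_div, mul_zero, LinearMap.zero_apply,
      sub_zero, neg_zero, Submodule.coe_zero, zero_add] at this
    rw [add_sub_cancel_left, map_add, LinearMap.add_apply]
    have h2 : c * (mG ψ χ + ε * (kG Φ' χ + kG δ χ) + 1 / ε * lf χ + 1 / η * mG δ χ) = 0 := by
      linear_combination this
    exact (mul_eq_zero.1 h2).resolve_left hc.ne'
  · have := hsol (0, 0, Z, 0)
    simp only [map_zero, smul_zero, add_zero, zero_div, mul_zero, LinearMap.zero_apply,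
      sub_zero, neg_zero, Submodule.coe_zero, zero_add] at this
    have h2 : μ * (mM (n + H - M') Z / τ - Bm u Z (n + H) + (1 / tr) * mM (n + H) Z
        - (1 / tr) * lκ Z) = 0 := by
      simp only [map_add, map_sub, LinearMap.add_apply, LinearMap.sub_apply] at this ⊢
      linear_combination this
    have h3 := (mul_eq_zero.1 h2).resolve_left hμ.ne'
    linarith
  · rw [ha, hr]
    ring

end AbstractStep

/-! ## Integral forms -/

section Forms

/-- A map into functions that is linear up to null sets. -/
structure AELinear {α X : Type*} [MeasurableSpace α] [AddCommGroup X] [Module ℝ X]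
    (μ : Measure α) (f : X → α → ℝ) : Prop where
  add : ∀ u v, f (u + v) =ᵐ[μ] fun x => f u x + f v x
  smul : ∀ (c : ℝ) u, f (c • u) =ᵐ[μ] fun x => c * f u x

/-- Representatives of `L²` classes add only up to null sets, so linearity has to be checked under
the integral. Additivity requires the integrability hypothesis. -/
theorem exists_bilinear_of_integral {α X Y ι : Type*} [MeasurableSpace α] [AddCommGroup X]
    [Module ℝ X] [AddCommGroup Y] [Module ℝ Y] [Fintype ι] {μ : Measure α} (a : α → ℝ)
    {f : ι → X → α → ℝ} {g : ι → Y → α → ℝ} (hf : ∀ i, AELinear μ (f i))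
    (hg : ∀ i, AELinear μ (g i))
    (hi : ∀ u v, Integrable (fun x => a x * ∑ i, f i u x * g i v x) μ) :
    ∃ B : X →ₗ[ℝ] Y →ₗ[ℝ] ℝ, ∀ u v, B u v = ∫ x, a x * ∑ i, f i u x * g i v x ∂μ := by
  refine ⟨LinearMap.mk₂ ℝ (fun u v => ∫ x, a x * ∑ i, f i u x * g i v x ∂μ) ?_ ?_ ?_ ?_,
    fun u v => rfl⟩
  · intro u u' v
    rw [← integral_add (hi u v) (hi u' v)]
    refine integral_congr_ae ?_
    filter_upwards [ae_all_iff.2 fun i => (hf i).add u u'] with x hx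
    simp only [hx, add_mul, Finset.sum_add_distrib, mul_add]
  · intro c u v
    rw [smul_eq_mul, ← integral_const_mul]
    refine integral_congr_ae ?_
    filter_upwards [ae_all_iff.2 fun i => (hf i).smul c u] with x hx
    simp only [hx, mul_assoc, ← Finset.mul_sum]
    ring
  · intro u v v'
    rw [← integral_add (hi u v) (hi u v')]
    refine integral_congr_ae ?_
    filter_upwards [ae_all_iff.2 fun i => (hg i).add v v'] with x hx
    simp only [hx, mul_add, Finset.sum_add_distrib]
  · intro c u v
    rw [smul_eq_mul, ← integral_const_mul]
    refine integral_congr_ae ?_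
    filter_upwards [ae_all_iff.2 fun i => (hg i).smul c v] with x hx
    simp only [hx, mul_left_comm _ c, ← Finset.mul_sum]

variable {d : ℕ} {Ω : Set (Sp d)}

theorem aeLinear_L2 {X : Type*} [AddCommGroup X] [Module ℝ X] (T : X →ₗ[ℝ] L2 Ω) :
    AELinear ((volume : Measure (Sp d)).restrict Ω) fun u x => T u x where
  add u v := by
    simp only [map_add]
    exact Lp.coeFn_add _ _
  smul c u := by
    simp only [map_smul]
    exact Lp.coeFn_smul _ _

theorem aeLinear_L2v {X : Type*} [AddCommGroup X] [Module ℝ X] (T : X →ₗ[ℝ] L2v Ω) (i : Fin d) :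
    AELinear ((volume : Measure (Sp d)).restrict Ω) fun u x => T u x i where
  add u v := by
    simp only [map_add]
    filter_upwards [Lp.coeFn_add (T u) (T v)] with x hx
    rw [hx]
    rfl
  smul c u := by
    simp only [map_smul]
    filter_upwards [Lp.coeFn_smul c (T u)] with x hx
    rw [hx]
    rfl

theorem aeLinear_symGrad (S : Submodule ℝ (H1v Ω)) (i j : Fin d) :
    AELinear ((volume : Measure (Sp d)).restrict Ω) fun (u : S) x => symGrad (u : H1v Ω) i j x := by
  have h := fun k l => aeLinear_L2v (grad ∘ₗ comp k ∘ₗ S.subtype) l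
  refine ⟨fun u v => ?_, fun c u => ?_⟩
  · filter_upwards [(h i j).add u v, (h j i).add u v] with x h1 h2
    simp only [LinearMap.comp_apply, Submodule.subtype_apply] at h1 h2
    simp only [symGrad, h1, h2]
    ring
  · filter_upwards [(h i j).smul c u, (h j i).smul c u] with x h1 h2
    simp only [LinearMap.comp_apply, Submodule.subtype_apply] at h1 h2
    simp only [symGrad, h1, h2]
    ring

theorem aeLinear_divg (S : Submodule ℝ (H1v Ω)) :
    AELinear ((volume : Measure (Sp d)).restrict Ω) fun (u : S) x => divg (u : H1v Ω) x := by
  have h := fun k => aeLinear_L2v (grad ∘ₗ comp k ∘ₗ S.subtype) k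
  refine ⟨fun u v => ?_, fun c u => ?_⟩
  · filter_upwards [ae_all_iff.2 fun k => (h k).add u v] with x h1
    simp only [LinearMap.comp_apply, Submodule.subtype_apply] at h1
    simp only [divg, h1, Finset.sum_add_distrib]
  · filter_upwards [ae_all_iff.2 fun k => (h k).smul c u] with x h1
    simp only [LinearMap.comp_apply, Submodule.subtype_apply] at h1
    simp only [divg, h1, Finset.mul_sum]

theorem memLp_symGrad (u : H1v Ω) (i j : Fin d) :
    MemLp (symGrad u i j) 2 ((volume : Measure (Sp d)).restrict Ω) := by
  have := ((memLp_coord (grad (comp i u)) j).add (memLp_coord (grad (comp j u)) i)).const_mul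
    (2⁻¹ : ℝ)
  refine this.congr_norm this.1 ?_ |>.ae_eq ?_
  · exact Filter.Eventually.of_forall fun x => rfl
  · refine Filter.Eventually.of_forall fun x => ?_
    simp [symGrad]
    ring

theorem memLp_divg (u : H1v Ω) : MemLp (divg u) 2 ((volume : Measure (Sp d)).restrict Ω) :=
  memLp_finsetSum _ fun i _ => memLp_coord (grad (comp i u)) i

/-- A continuous bounded function of an `L²` function, times an `L²` function. -/
theorem memLp_comp_mul {F : Type*} [NormedAddCommGroup F] [NormedSpace ℝ F] {κ : ℝ → ℝ}
    (hκ : Continuous κ) {C : ℝ} (hC : ∀ s, |κ s| ≤ C) (u : L2 Ω) {g : Sp d → F}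
    (hg : MemLp g 2 ((volume : Measure (Sp d)).restrict Ω)) :
    MemLp (fun x => κ (u x) • g x) 2 ((volume : Measure (Sp d)).restrict Ω) := by
  have hm : AEStronglyMeasurable (fun x => κ (u x)) ((volume : Measure (Sp d)).restrict Ω) :=
    hκ.comp_aestronglyMeasurable (Lp.memLp u).1
  refine MemLp.of_le_mul (c := C) hg (hm.smul hg.1) (Filter.Eventually.of_forall fun x => ?_)
  rw [norm_smul]
  gcongr
  exact hC _

theorem memLp_dwfun_comp (hb : Bornology.IsBounded Ω) (u : L2 Ω) :
    MemLp (fun x => dwfun (u x)) 2 ((volume : Measure (Sp d)).restrict Ω) := by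
  have : IsFiniteMeasure ((volume : Measure (Sp d)).restrict Ω) :=
    ⟨by simpa using hb.measure_lt_top⟩
  have h1 : MemLp (fun x => 2 * |u x| + 2) 2 ((volume : Measure (Sp d)).restrict Ω) :=
    ((Lp.memLp u).abs.const_mul 2).add (memLp_const 2)
  refine h1.mono (continuous_dwfun.comp_aestronglyMeasurable (Lp.memLp u).1)
    (Filter.Eventually.of_forall fun x => ?_)
  rw [Real.norm_eq_abs, Real.norm_eq_abs]
  refine sq_le_sq.1 ?_
  have h2 := dwfun_sq_le (u x)
  have h3 := dwF_le_sq_add_one (u x)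
  have h4 : |u x| ^ 2 = u x ^ 2 := sq_abs _
  nlinarith [abs_nonneg (u x)]

theorem inner_toLp_left {F : Type*} [NormedAddCommGroup F] [InnerProductSpace ℝ F]
    {α : Type*} [MeasurableSpace α] {μ : Measure α} {f : α → F} (hf : MemLp f 2 μ)
    (g : Lp F 2 μ) : inner ℝ (hf.toLp f) g = ∫ x, inner ℝ (f x) (g x) ∂μ := by
  rw [L2.inner_def]
  refine integral_congr_ae ?_
  filter_upwards [hf.coeFn_toLp] with x hx
  rw [hx]

theorem ipV_self_pos (hΩ : IsOpen Ω) {u : H1v Ω} (hu : u ≠ 0) : 0 < ipV u u := by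
  have hn : ∀ i, 0 ≤ inner ℝ (fn (comp i u)) (fn (comp i u)) := fun i => real_inner_self_nonneg
  refine lt_of_le_of_ne (Finset.sum_nonneg fun i _ => hn i) fun h => hu ?_
  have h0 := (Finset.sum_eq_zero_iff_of_nonneg fun i _ => hn i).1 h.symm
  funext i
  have h1 : fn (comp i u) = 0 := inner_self_eq_zero.1 (h0 i (Finset.mem_univ i))
  exact fn_injective hΩ (h1.trans (map_zero fn).symm)

end Forms

/-! ## Existence -/

section Existence

variable {d : ℕ} {Ω : Set (Sp d)}

theorem Params.continuous_ν (p : Params) : Continuous p.ν :=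
  p.ν_lip.choose_spec.continuous

theorem Params.continuous_κ (p : Params) : Continuous p.κ :=
  p.κ_lip.choose_spec.continuous

theorem Params.ν_pos (p : Params) (s : ℝ) : 0 < p.ν s :=
  (lt_min p.νw_pos p.νf_pos).trans_le (p.ν_bounds s).1

theorem Params.abs_ν_le (p : Params) (s : ℝ) : |p.ν s| ≤ max p.νw p.νf := by
  rw [abs_of_pos (p.ν_pos s)]
  exact (p.ν_bounds s).2

theorem Params.abs_κ_le (p : Params) (s : ℝ) : |p.κ s| ≤ p.κ₀ := by
  rw [abs_of_nonneg (p.κ_bounds s).1]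
  exact (p.κ_bounds s).2

/-- The only use of the embedding, hence of the dimension and of convexity. The estimates below do
not need it, since they compare the transport and capillary integrals without splitting them. -/
theorem integrable_transport (hd : d = 2 ∨ d = 3) (hΩo : IsOpen Ω) (hΩc : Convex ℝ Ω)
    (hΩb : Bornology.IsBounded Ω) (hΩn : Ω.Nonempty) (φ : H1 Ω) (u : H1v Ω)
    (hu : ∀ i, (fn (comp i u), grad (comp i u)) ∈ H10 Ω) (g : L2v Ω) :
    Integrable (fun x => fn φ x * ∑ i, fn (comp i u) x * g x i)
      ((volume : Measure (Sp d)).restrict Ω) := by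
  simp only [Finset.mul_sum, ← mul_assoc]
  exact integrable_finsetSum _ fun i _ =>
    (memLp_mul_fn hd hΩo hΩc hΩb hΩn φ (comp i u) (hu i)).integrable_mul (memLp_coord g i)

theorem exists_isStep (hd : d = 2 ∨ d = 3) (hΩo : IsOpen Ω) (hΩc : Convex ℝ Ω)
    (hΩb : Bornology.IsBounded Ω) (hΩn : Ω.Nonempty) (D : Discretization Ω) (p : Params)
    {η τ : ℝ} (hη : 0 < η) (hτ : 0 < τ) (H : D.M) (s' : State D) :
    ∃ s : State D, IsStep D p η τ H s' s := by
  have := D.finG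
  have := D.finM
  have := D.finU
  have := D.finP
  set μ := (volume : Measure (Sp d)).restrict Ω with hμ
  let fG : D.G →ₗ[ℝ] L2 Ω := fn ∘ₗ D.G.subtype
  let gG : D.G →ₗ[ℝ] L2v Ω := grad ∘ₗ D.G.subtype
  let fU : Fin d → D.U →ₗ[ℝ] L2 Ω := fun i => fn ∘ₗ comp i ∘ₗ D.U.subtype
  obtain ⟨T, hT⟩ := exists_bilinear_of_integral (μ := μ) (fn (s'.Φ : H1 Ω))
    (fun i => aeLinear_L2 (fU i)) (fun i => aeLinear_L2v gG i)
    (fun u Λ => integrable_transport hd hΩo hΩc hΩb hΩn s'.Φ u (D.U_zero u u.2) (gG Λ))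
  obtain ⟨visc, hvisc⟩ := exists_bilinear_of_integral (μ := μ) (ι := Fin d × Fin d)
    (fun x => p.ν (fn (s'.Φ : H1 Ω) x))
    (fun i => aeLinear_symGrad D.U i.1 i.2) (fun i => aeLinear_symGrad D.U i.1 i.2)
    (fun u v => by
      simp only [Finset.mul_sum, ← mul_assoc]
      exact integrable_finsetSum _ fun i _ =>
        (memLp_comp_mul p.continuous_ν p.abs_ν_le _ (memLp_symGrad _ i.1 i.2)).integrable_mul
          (memLp_symGrad _ i.1 i.2))
  obtain ⟨q, hq⟩ := exists_bilinear_of_integral (μ := μ) (ι := Unit) (fun _ => 1)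
    (fun _ => aeLinear_L2 D.P.subtype) (fun _ => aeLinear_divg D.U)
    (fun a v => by
      simp only [Finset.univ_unique, Finset.sum_singleton, one_mul]
      exact (Lp.memLp (a : L2 Ω)).integrable_mul (memLp_divg _))
  let mG : D.G →ₗ[ℝ] D.G →ₗ[ℝ] ℝ := (innerₗ (L2 Ω)).compl₁₂ fG fG
  let kG : D.G →ₗ[ℝ] D.G →ₗ[ℝ] ℝ := (innerₗ (L2v Ω)).compl₁₂ gG gG
  let mM : D.M →ₗ[ℝ] D.M →ₗ[ℝ] ℝ := (innerₗ (L2v Ω)).compl₁₂ D.M.subtype D.M.subtype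
  let mU : D.U →ₗ[ℝ] D.U →ₗ[ℝ] ℝ := ∑ i, (innerₗ (L2 Ω)).compl₁₂ (fU i) (fU i)
  have hmU : ∀ u v, mU u v = ipV (u : H1v Ω) (v : H1v Ω) := fun u v => by
    simp only [mU, LinearMap.sum_apply]
    rfl
  let lf : D.G →ₗ[ℝ] ℝ :=
    innerₗ (L2 Ω) ((memLp_dwfun_comp hΩb (fn (s'.Φ : H1 Ω))).toLp _) ∘ₗ fG
  have hlf : ∀ χ : D.G, lf χ = ∫ x in Ω, dwf (fn (s'.Φ : H1 Ω) x) * fn (χ : H1 Ω) x := fun χ => by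
    refine (inner_toLp_left _ _).trans (integral_congr_ae (Filter.Eventually.of_forall fun x => ?_))
    simp only [dwf_eq, RCLike.inner_apply, conj_trivial]
    exact mul_comm _ _
  let lκ : D.M →ₗ[ℝ] ℝ :=
    innerₗ (L2v Ω) ((memLp_comp_mul p.continuous_κ p.abs_κ_le (fn (s'.Φ : H1 Ω))
      (Lp.memLp (H : L2v Ω))).toLp _) ∘ₗ D.M.subtype
  have hlκ : ∀ Z : D.M, lκ Z = ∫ x in Ω, p.κ (fn (s'.Φ : H1 Ω) x) *
      inner ℝ ((H : L2v Ω) x) ((Z : L2v Ω) x) := fun Z => by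
    refine (inner_toLp_left _ _).trans (integral_congr_ae (Filter.Eventually.of_forall fun x => ?_))
    simp only [inner_smul_left, conj_trivial]
    rfl
  obtain ⟨Φ, Ψ, m, u, a, h1, h2, h3, h4, h5⟩ := exists_step_of_forms mG kG mM mU visc
    (D.Bh s'.U) T q D.Bm lf lκ (fun x y => real_inner_comm (F := L2 Ω) (fG y) (fG x))
    (fun x hx => (real_inner_self_pos (F := L2 Ω)).2 fun h => hx (Subtype.ext (fn_injective hΩo
      (h.trans (map_zero fn).symm))))
    (fun x y => real_inner_comm (F := L2v Ω) (gG y) (gG x)) (fun x => real_inner_self_nonneg (F := L2v Ω) (x := gG x))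
    (fun x hx => (real_inner_self_pos (F := L2v Ω)).2 fun h => hx (Subtype.ext h))
    (fun x hx => by
      rw [hmU]
      exact ipV_self_pos hΩo fun h => hx (Subtype.ext h))
    (fun x => by
      rw [hvisc]
      refine integral_nonneg fun y => mul_nonneg (p.ν_pos _).le ?_
      exact Finset.sum_nonneg fun i _ => mul_self_nonneg _)
    (fun x => by
      have := D.Bh_skew s'.U x x
      linarith)
    D.Bm_skew p.ε_pos p.γ_pos (div_pos p.lam_pos p.ε_pos) p.μ₀_pos p.trel_pos hτ hη
    s'.Φ s'.M H s'.U
  have hT' : ∀ (V : D.U) (χ : D.G), T V χ = ∫ x in Ω, fn (s'.Φ : H1 Ω) x *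
      ∑ i, grad (χ : H1 Ω) x i * fn (comp i (V : H1v Ω)) x := fun V χ => by
    rw [hT]
    simp only [mul_comm (grad _ _ _)]
    rfl
  refine ⟨⟨Φ, ⟨Ψ, D.Y_eq.ge Ψ.2⟩, m, u, a⟩, ⟨fun Λ => ?_, fun χ => ?_, fun Z => ?_, fun V => ?_,
    fun Q => ?_⟩⟩
  · refine Eq.trans ?_ (h1 Λ)
    rw [hT]
    rfl
  · refine Eq.trans ?_ (h2 ⟨χ, D.Y_eq.le χ.2⟩)
    rw [hlf]
    rfl
  · refine Eq.trans ?_ ((h3 Z).trans ?_)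
    · rfl
    · rw [hlκ]
  · refine Eq.trans ?_ ((h4 V).trans ?_)
    · rw [hmU, hvisc, hq]
      simp only [Fintype.sum_prod_type, Finset.univ_unique, Finset.sum_singleton, one_mul]
      rfl
    · rw [hT']
  · refine Eq.trans ?_ (h5 Q)
    rw [hq]
    simp only [Finset.univ_unique, Finset.sum_singleton, one_mul]
    rfl

end Existence

/-! ## Energy stability -/

section Energy

variable {d : ℕ} {Ω : Set (Sp d)}

theorem polarization_sub {F : Type*} [NormedAddCommGroup F] [InnerProductSpace ℝ F] (x y : F) :
    2 * inner ℝ (x - y) x = ‖x‖ ^ 2 - ‖y‖ ^ 2 + ‖x - y‖ ^ 2 := by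
  rw [norm_sub_sq_real, inner_sub_left, real_inner_self_eq_norm_sq, real_inner_comm]
  ring

theorem ipV_self (u : H1v Ω) : ipV u u = ∑ i, ‖fn (comp i u)‖ ^ 2 :=
  Finset.sum_congr rfl fun _ _ => real_inner_self_eq_norm_sq _

theorem two_mul_ipV_sub (u v : H1v Ω) :
    2 * ipV (u - v) u = ipV u u - ipV v v + ipV (u - v) (u - v) := by
  rw [ipV_self, ipV_self, ipV_self, ipV, Finset.mul_sum, ← Finset.sum_sub_distrib,
    ← Finset.sum_add_distrib]
  refine Finset.sum_congr rfl fun i _ => ?_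
  rw [map_sub, map_sub]
  exact polarization_sub _ _

theorem isFiniteMeasure_restrict (hb : Bornology.IsBounded Ω) :
    IsFiniteMeasure ((volume : Measure (Sp d)).restrict Ω) :=
  ⟨by simpa using hb.measure_lt_top⟩

theorem integrable_dwF_comp (hb : Bornology.IsBounded Ω) (u : L2 Ω) :
    Integrable (fun x => dwF (u x)) ((volume : Measure (Sp d)).restrict Ω) := by
  have := isFiniteMeasure_restrict hb
  refine ((Lp.memLp u).integrable_sq.add (integrable_const (1 : ℝ))).mono
    (continuous_dwF.comp_aestronglyMeasurable (Lp.memLp u).1)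
    (Filter.Eventually.of_forall fun x => ?_)
  rw [Real.norm_of_nonneg (dwF_nonneg _)]
  exact (dwF_le_sq_add_one _).trans (le_abs_self _)

theorem norm_sq_eq_integral {F : Type*} [NormedAddCommGroup F] [InnerProductSpace ℝ F]
    {α : Type*} [MeasurableSpace α] {μ : Measure α} (f : Lp F 2 μ) :
    ‖f‖ ^ 2 = ∫ x, ‖f x‖ ^ 2 ∂μ := by
  rw [← real_inner_self_eq_norm_sq, L2.inner_def]
  simp only [real_inner_self_eq_norm_sq]

/-- The change of the potential energy, with the derivative taken explicitly. -/
theorem integral_dwF_le (hb : Bornology.IsBounded Ω) (u v : L2 Ω) :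
    ∫ x in Ω, dwF (u x) ≤ (∫ x in Ω, dwF (v x)) + (∫ x in Ω, dwf (v x) * (u - v : L2 Ω) x)
      + ‖u - v‖ ^ 2 := by
  have h1 : Integrable (fun x => dwf (v x) * (u - v : L2 Ω) x)
      ((volume : Measure (Sp d)).restrict Ω) := by
    rw [dwf_eq]
    exact (memLp_dwfun_comp hb v).integrable_mul (Lp.memLp (u - v))
  have h2 : Integrable (fun x => ‖(u - v : L2 Ω) x‖ ^ 2)
      ((volume : Measure (Sp d)).restrict Ω) := (Lp.memLp (u - v)).norm.integrable_sq
  rw [norm_sq_eq_integral, ← integral_add (integrable_dwF_comp hb v) h1,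
    ← integral_add (by exact (integrable_dwF_comp hb v).add h1) h2]
  refine integral_mono_ae (integrable_dwF_comp hb u)
    (((integrable_dwF_comp hb v).add h1).add h2) ?_
  filter_upwards [Lp.coeFn_sub u v] with x hx
  simp only [hx, Pi.sub_apply, dwf_eq, Real.norm_eq_abs, sq_abs]
  exact dwF_le _ _

/-- `h1` is multiplied by `2 * τ`, `h2` by `2 * lam * τ / ε` and `h3` by `2 * lam / ε`; then `X`
cancels. By `h6` the explicit potential costs `2 * lam / ε ^ 2 * dn`, against `2 * lam / (ε * η) *
dn` gained from the stabilization, which suffices as `η ≤ ε`. -/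
theorem energy_balance_arith
    {ε lam γ τ η μ₀ u u' du iu adv vis pr B X X' I g k k' dk ik Fd dn P P' : ℝ}
    (hε : 0 < ε) (hl : 0 < lam) (hη : 0 < η) (hηε : η ≤ ε) (hτ : 0 < τ) (hdn : 0 ≤ dn)
    (h1 : iu / τ + adv + vis - pr = μ₀ * B + lam / ε * X') (hadv : adv = 0) (hpr : pr = 0)
    (hX : X' = X) (h2 : I / τ - X - γ * g = 0)
    (h3 : I + ε * ik + 1 / ε * Fd + 1 / η * dn = 0) (h4 : 2 * iu = u - u' + du)
    (h5 : 2 * ik = k - k' + dk) (h6 : P ≤ P' + Fd + dn) :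
    u + lam * k + 2 * lam / ε ^ 2 * P + du + lam * dk + 2 * lam * γ * τ / ε * g + 2 * τ * vis
      ≤ u' + lam * k' + 2 * lam / ε ^ 2 * P' + 2 * τ * μ₀ * B := by
  subst hadv hpr hX
  have e2 : I = τ * X' + τ * γ * g := by
    field_simp at h2
    linarith
  have e1 : 2 * iu + 2 * τ * vis = 2 * τ * μ₀ * B + 2 * τ * (lam / ε * X') := by
    have : iu = τ * (iu / τ) := by field_simp
    rw [this]
    linear_combination 2 * τ * h1
  have e3 : 2 * lam / ε * I + 2 * lam * ik + 2 * lam / ε ^ 2 * Fd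
      + 2 * lam / (ε * η) * dn = 0 := by
    have : 2 * lam / ε * (I + ε * ik + 1 / ε * Fd + 1 / η * dn) = 0 := by rw [h3, mul_zero]
    rw [← this]
    field_simp
  have e4 : 2 * lam / ε * I = 2 * τ * (lam / ε * X') + 2 * lam * γ * τ / ε * g := by
    rw [e2]
    ring
  have e5 : 2 * lam / ε ^ 2 * P ≤ 2 * lam / ε ^ 2 * (P' + Fd + dn) := by gcongr
  have e6 : 2 * lam / ε ^ 2 * dn ≤ 2 * lam / (ε * η) * dn := by
    rw [sq]
    gcongr
  linear_combination e5 + e6 + e1 + e3 - e4 - h4 - lam * h5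

/-- The part of the energy estimate of one step that comes from the phase field and the
velocity. -/
theorem IsStep.energy_le (hb : Bornology.IsBounded Ω) {D : Discretization Ω} {p : Params}
    {η τ : ℝ} (hη : 0 < η) (hηε : η ≤ p.ε) (hτ : 0 < τ) {H : D.M} {s' s : State D}
    (h : IsStep D p η τ H s' s) :
    energy p s + ipV ((s.U - s'.U : D.U) : H1v Ω) ((s.U - s'.U : D.U) : H1v Ω)
      + p.lam * ‖grad ((s.Φ - s'.Φ : D.G) : H1 Ω)‖ ^ 2
      + (2 * p.lam * p.γ * τ / p.ε) * ‖grad (s.Ψ : H1 Ω)‖ ^ 2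
      + 2 * τ * (∫ x in Ω, p.ν (fn (s'.Φ : H1 Ω) x) *
        ∑ i, ∑ j, symGrad (s.U : H1v Ω) i j x ^ 2)
    ≤ energy p s' + 2 * τ * p.μ₀ * D.Bm s.U H s.M := by
  have hε := p.ε_pos
  have hl := p.lam_pos
  -- velocity
  have e1 := h.momentum s.U
  have e1' := h.incompressible s.P
  have e1s : D.Bh s'.U s.U s.U = 0 := by
    have := D.Bh_skew s'.U s.U s.U
    linarith
  have e1p := two_mul_ipV_sub (s.U : H1v Ω) (s'.U : H1v Ω)
  -- phase field and potential
  have e2 := h.phase ⟨s.Ψ, D.Y_eq.le s.Ψ.2⟩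
  have e3 := h.chemical ⟨(s.Φ - s'.Φ : D.G), D.Y_eq.ge (s.Φ - s'.Φ).2⟩
  have e4 := integral_dwF_le hb (fn (s.Φ : H1 Ω)) (fn (s'.Φ : H1 Ω))
  have e5 := polarization_sub (grad (s.Φ : H1 Ω)) (grad (s'.Φ : H1 Ω))
  have e6 : ∫ x in Ω, fn (s'.Φ : H1 Ω) x *
      ∑ i, grad (s.Ψ : H1 Ω) x i * fn (comp i (s.U : H1v Ω)) x
      = ∫ x in Ω, fn (s'.Φ : H1 Ω) x *
        ∑ i, fn (comp i (s.U : H1v Ω)) x * grad (s.Ψ : H1 Ω) x i := by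
    simp only [mul_comm (grad _ _ _)]
  simp only [Submodule.coe_sub, map_sub] at e1 e2 e3 ⊢
  rw [real_inner_self_eq_norm_sq] at e2
  rw [real_inner_comm, real_inner_comm (grad _ - grad _), real_inner_self_eq_norm_sq] at e3
  simp only [energy, pow_two (symGrad _ _ _ _)]
  exact energy_balance_arith hε hl hη hηε hτ (sq_nonneg _) e1 e1s e1' e6 e2 e3 e1p e5 e4

/-- `m1`, the test with `H`, replaces the magnetic work `B`; `m2`, the test with `M`, is multiplied
by `2 * μ * τ`. Of the relaxation term `2 * μ * τ / tr * n`, each of the two Young inequalities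
takes a sixth. One half stays as dissipation, and the last sixth, `μ * τ / (3 * tr) * n`, is saved
for the summation over time. -/
theorem magnetic_balance_arith {μ τ tr κ E E' du g1 g2 g3 B B' dMH MH kHH dMM n n' dn kHM h : ℝ}
    (hμ : 0 < μ) (htr : 0 < tr) (hτ : 0 < τ)
    (h0 : E + du + g1 + g2 + g3 ≤ E' + 2 * τ * μ * B)
    (m1 : dMH / τ - B + 1 / tr * MH = 1 / tr * kHH)
    (m2 : dMM / τ - B' + 1 / tr * n = 1 / tr * kHM) (hB' : B' = 0)
    (hpol : 2 * dMM = n - n' + dn) (hMH : 2 * MH ≤ n / 3 + 3 * h)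
    (hkH : 2 * kHM ≤ n / 3 + 3 * κ ^ 2 * h) :
    E + μ * n + (du + μ * dn + g1 + g2 + g3 + μ * τ / tr * n + 2 * μ * τ / tr * kHH)
        + μ * τ / (3 * tr) * n
      ≤ E' + μ * n' + 2 * μ * dMH + 3 * μ * τ / tr * (1 + κ ^ 2) * h := by
  subst hB'
  have a1 : 2 * τ * μ * B = 2 * μ * dMH + μ * τ / tr * (2 * MH) - 2 * μ * τ / tr * kHH := by
    have : B = dMH / τ + 1 / tr * MH - 1 / tr * kHH := by linarith
    rw [this]
    field_simp
  have a2 : μ * (2 * dMM) + 2 * (μ * τ / tr) * n = μ * τ / tr * (2 * kHM) := by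
    have := congrArg (fun z => 2 * μ * τ * z) m2
    field_simp at this ⊢
    linarith
  have hq : 0 < μ * τ / tr := by positivity
  have b1 := mul_le_mul_of_nonneg_left hMH hq.le
  have b2 := mul_le_mul_of_nonneg_left hkH hq.le
  rw [hpol] at a2
  have c1 : μ * τ / (3 * tr) = μ * τ / tr / 3 := by field_simp
  have c2 : 3 * μ * τ / tr = 3 * (μ * τ / tr) := by ring
  rw [c1, c2]
  linear_combination h0 + a1 + a2 + b1 + b2

/-- The energy estimate of one step. -/
theorem IsStep.energy_add_dissipation_le (hb : Bornology.IsBounded Ω) {D : Discretization Ω}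
    {p : Params} {η τ : ℝ} (hη : 0 < η) (hηε : η ≤ p.ε) (hτ : 0 < τ) {H : D.M} {s' s : State D}
    (h : IsStep D p η τ H s' s) :
    energy p s + p.μ₀ * ‖(s.M : L2v Ω)‖ ^ 2 + dissipation p τ H s' s
      + p.μ₀ * τ / (3 * p.trel) * ‖(s.M : L2v Ω)‖ ^ 2
    ≤ energy p s' + p.μ₀ * ‖(s'.M : L2v Ω)‖ ^ 2
      + 2 * p.μ₀ * inner ℝ ((s.M : L2v Ω) - s'.M) (H : L2v Ω)
      + 3 * p.μ₀ * τ / p.trel * (1 + p.κ₀ ^ 2) * ‖(H : L2v Ω)‖ ^ 2 := by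
  have h0 := h.energy_le hb hη hηε hτ
  have hμ := p.μ₀_pos
  have htr := p.trel_pos
  have m1 := h.magnetization H
  have m2 := h.magnetization s.M
  have hB2 : D.Bm s.U s.M s.M = 0 := by
    have := D.Bm_skew s.U s.M s.M
    linarith
  have hpol := polarization_sub (s.M : L2v Ω) (s'.M : L2v Ω)
  have hMH : 2 * inner ℝ (s.M : L2v Ω) (H : L2v Ω)
      ≤ ‖(s.M : L2v Ω)‖ ^ 2 / 3 + 3 * ‖(H : L2v Ω)‖ ^ 2 := by
    have := real_inner_le_norm (s.M : L2v Ω) (H : L2v Ω)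
    nlinarith [sq_nonneg (‖(s.M : L2v Ω)‖ - 3 * ‖(H : L2v Ω)‖)]
  let kHM := ∫ x in Ω, p.κ (fn (s'.Φ : H1 Ω) x) * inner ℝ ((H : L2v Ω) x) ((s.M : L2v Ω) x)
  have hkH : 2 * kHM ≤ ‖(s.M : L2v Ω)‖ ^ 2 / 3 + 3 * p.κ₀ ^ 2 * ‖(H : L2v Ω)‖ ^ 2 := by
    have hm := memLp_comp_mul p.continuous_κ p.abs_κ_le (fn (s'.Φ : H1 Ω)) (Lp.memLp (H : L2v Ω))
    have h1 : kHM = inner ℝ (hm.toLp _) (s.M : L2v Ω) := by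
      rw [inner_toLp_left]
      simp only [inner_smul_left, conj_trivial, kHM]
    have h2 : ‖hm.toLp _‖ ≤ p.κ₀ * ‖(H : L2v Ω)‖ := by
      refine Lp.norm_le_mul_norm_of_ae_le_mul ?_
      filter_upwards [hm.coeFn_toLp] with x hx
      rw [hx, norm_smul]
      gcongr
      exact p.abs_κ_le _
    have h3 := real_inner_le_norm (hm.toLp _) (s.M : L2v Ω)
    have h4 : ‖hm.toLp _‖ * ‖(s.M : L2v Ω)‖ ≤ p.κ₀ * ‖(H : L2v Ω)‖ * ‖(s.M : L2v Ω)‖ := by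
      gcongr
    nlinarith [sq_nonneg (‖(s.M : L2v Ω)‖ - 3 * (p.κ₀ * ‖(H : L2v Ω)‖))]
  simp only [real_inner_self_eq_norm_sq] at m1
  rw [real_inner_self_eq_norm_sq] at m2
  exact magnetic_balance_arith hμ htr hτ h0 m1 m2 hB2 hpol hMH hkH

/-- Summation of the energy estimates of the single steps. -/
theorem energy_sum_arith {F : Type*} [NormedAddCommGroup F] [InnerProductSpace ℝ F]
    {m H : ℕ → F} {e dis : ℕ → ℝ} {μ₀ τ tr C : ℝ} (hμ : 0 < μ₀) (hτ : 0 < τ) (htr : 0 < tr) {K : ℕ}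
    (hstep : ∀ k, 1 ≤ k → k ≤ K → e k + μ₀ * ‖m k‖ ^ 2 + dis k + μ₀ * τ / (3 * tr) * ‖m k‖ ^ 2
      ≤ e (k - 1) + μ₀ * ‖m (k - 1)‖ ^ 2 + 2 * μ₀ * inner ℝ (m k - m (k - 1)) (H k)
        + C * ‖H k‖ ^ 2) {n : ℕ} (hn : 1 ≤ n) (hnK : n ≤ K) :
    e n + μ₀ / 2 * ‖m n‖ ^ 2 + ∑ k ∈ Finset.Icc 1 n, dis k
      ≤ e 0 + 2 * μ₀ * ‖m 0‖ ^ 2 + μ₀ * ‖H 1‖ ^ 2 + 2 * μ₀ * ‖H n‖ ^ 2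
        + ∑ k ∈ Finset.Icc 1 n, C * ‖H k‖ ^ 2
        + 3 * μ₀ * tr * ∑ k ∈ Finset.Icc 1 (n - 1), τ * ‖τ⁻¹ • (H (k + 1) - H k)‖ ^ 2 := by
  -- Summation by parts: only the boundary products `(m 0, H 1)` and `(m n, H n)` and the pairings
  -- of `m k` with `H (k + 1) - H k` remain. The saved term of level `n` stays on the left, to pay
  -- for the increment of `H` in the next step. For `n = 1` the last sum is empty.
  have key : ∀ n, 1 ≤ n → n ≤ K →
      e n + μ₀ * ‖m n‖ ^ 2 + μ₀ * τ / (3 * tr) * ‖m n‖ ^ 2 + ∑ k ∈ Finset.Icc 1 n, dis k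
      ≤ e 0 + μ₀ * ‖m 0‖ ^ 2 - 2 * μ₀ * inner ℝ (m 0) (H 1) + 2 * μ₀ * inner ℝ (m n) (H n)
        + ∑ k ∈ Finset.Icc 1 n, C * ‖H k‖ ^ 2
        + 3 * μ₀ * tr * ∑ k ∈ Finset.Icc 1 (n - 1), τ * ‖τ⁻¹ • (H (k + 1) - H k)‖ ^ 2 := by
    intro n hn
    induction n, hn using Nat.le_induction with
    | base =>
      intro hK
      have := hstep 1 le_rfl hK
      simp only [Nat.sub_self, inner_sub_left] at this
      simp
      linarith
    | succ n hn ih =>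
      intro hK
      have h1 := ih (by omega)
      have h2 := hstep (n + 1) (by omega) hK
      simp only [Nat.add_sub_cancel, inner_sub_left] at h2
      rw [Finset.sum_Icc_succ_top (by omega), Finset.sum_Icc_succ_top (by omega),
        Nat.add_sub_cancel]
      have h3 : ∑ k ∈ Finset.Icc 1 n, τ * ‖τ⁻¹ • (H (k + 1) - H k)‖ ^ 2
          = ∑ k ∈ Finset.Icc 1 (n - 1), τ * ‖τ⁻¹ • (H (k + 1) - H k)‖ ^ 2
            + τ * ‖τ⁻¹ • (H (n + 1) - H n)‖ ^ 2 := by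
        obtain ⟨j, rfl⟩ : ∃ j, n = j + 1 := ⟨n - 1, by omega⟩
        rw [Finset.sum_Icc_succ_top (by omega), Nat.add_sub_cancel]
      rw [h3]
      set X := τ⁻¹ • (H (n + 1) - H n) with hX
      have h4 : H (n + 1) = H n + τ • X := by
        rw [hX, smul_inv_smul₀ hτ.ne']
        abel
      have h5 : inner ℝ (m n) (H (n + 1)) = inner ℝ (m n) (H n) + τ * inner ℝ (m n) X := by
        rw [h4, inner_add_right, inner_smul_right]
      have h6 : - (2 * μ₀ * (τ * inner ℝ (m n) X))
          ≤ μ₀ * τ / (3 * tr) * ‖m n‖ ^ 2 + 3 * μ₀ * tr * (τ * ‖X‖ ^ 2) := by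
        have h7 := abs_real_inner_le_norm (m n) X
        have h8 := neg_abs_le (inner ℝ (m n) X)
        have h9 : 2 * (‖m n‖ * ‖X‖) ≤ 1 / (3 * tr) * ‖m n‖ ^ 2 + 3 * tr * ‖X‖ ^ 2 := by
          have : 0 ≤ 1 / (3 * tr) * (‖m n‖ - 3 * tr * ‖X‖) ^ 2 := by positivity
          have e : 1 / (3 * tr) * (‖m n‖ - 3 * tr * ‖X‖) ^ 2
              = 1 / (3 * tr) * ‖m n‖ ^ 2 + 3 * tr * ‖X‖ ^ 2 - 2 * (‖m n‖ * ‖X‖) := by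
            field_simp
            ring
          linarith
        have h10 : - (2 * inner ℝ (m n) X) ≤ 1 / (3 * tr) * ‖m n‖ ^ 2 + 3 * tr * ‖X‖ ^ 2 := by
          linarith
        have h11 := mul_le_mul_of_nonneg_left h10 (mul_pos hμ hτ).le
        have e : μ₀ * τ / (3 * tr) = μ₀ * τ * (1 / (3 * tr)) := by ring
        rw [e]
        linarith
      rw [h5] at h2
      linarith
  have h := key n hn hnK
  have h1 : - (2 * inner ℝ (m 0) (H 1)) ≤ ‖m 0‖ ^ 2 + ‖H 1‖ ^ 2 := by
    have := norm_add_sq_real (m 0) (H 1)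
    nlinarith [sq_nonneg ‖m 0 + H 1‖]
  -- This takes half of `μ₀ * ‖m n‖ ^ 2`; the other half is the one in the conclusion.
  have h2 : 2 * inner ℝ (m n) (H n) ≤ ‖m n‖ ^ 2 / 2 + 2 * ‖H n‖ ^ 2 := by
    have := real_inner_le_norm (m n) (H n)
    nlinarith [sq_nonneg (‖m n‖ - 2 * ‖H n‖)]
  have h3 := mul_le_mul_of_nonneg_left h1 hμ.le
  have h4 := mul_le_mul_of_nonneg_left h2 hμ.le
  have h5 : 0 ≤ μ₀ * τ / (3 * tr) * ‖m n‖ ^ 2 := by positivity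
  linarith

/-- Given for every level `n ≤ K`, because the bound of the potential needs the energy at all times
and not only at the last one. -/
theorem IsSolution.energy_le (hb : Bornology.IsBounded Ω) {D : Discretization Ω} {p : Params}
    {η tF : ℝ} (hη : 0 < η) (hηε : η ≤ p.ε) (htF : 0 < tF) {dat : SmoothData Ω} {K : ℕ}
    {s : ℕ → State D} (hs : IsSolution D p η tF dat K s) {n : ℕ} (hn : 1 ≤ n) (hnK : n ≤ K) :
    energy p (s n) + p.μ₀ / 2 * ‖((s n).M : L2v Ω)‖ ^ 2
        + ∑ k ∈ Finset.Icc 1 n, dissipation p (tF / K) (Hk D dat (tF / K) k) (s (k - 1)) (s k)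
      ≤ energy p (s 0) + 2 * p.μ₀ * ‖((s 0).M : L2v Ω)‖ ^ 2
        + p.μ₀ * ‖(Hk D dat (tF / K) 1 : L2v Ω)‖ ^ 2
        + 2 * p.μ₀ * ‖(Hk D dat (tF / K) n : L2v Ω)‖ ^ 2
        + ∑ k ∈ Finset.Icc 1 n, 3 * p.μ₀ * (tF / K) / p.trel * (1 + p.κ₀ ^ 2)
            * ‖(Hk D dat (tF / K) k : L2v Ω)‖ ^ 2
        + 3 * p.μ₀ * p.trel * ∑ k ∈ Finset.Icc 1 (n - 1), (tF / K)
            * ‖((tF / K)⁻¹ • (Hk D dat (tF / K) (k + 1) - Hk D dat (tF / K) k : D.M) :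
                L2v Ω)‖ ^ 2 := by
  have hτ : 0 < tF / K := div_pos htF (by exact_mod_cast (by omega : 0 < K))
  exact energy_sum_arith (m := fun k => ((s k).M : L2v Ω))
    (H := fun k => (Hk D dat (tF / K) k : L2v Ω)) (e := fun k => energy p (s k))
    p.μ₀_pos hτ p.trel_pos (fun k h1 h2 =>
      (hs.step k (Finset.mem_Icc.2 ⟨h1, h2⟩)).energy_add_dissipation_le hb hη hηε hτ) hn hnK

end Energy

/-! ## Conservation of mass -/

section Mass

variable {d : ℕ} {Ω : Set (Sp d)}

/-- The constant one is an admissible test function in the phase equation, and its gradient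
annihilates transport and diffusion. -/
theorem IsStep.mass (hΩ : IsOpen Ω) (hb : Bornology.IsBounded Ω) {D : Discretization Ω}
    {p : Params} {η τ : ℝ} (hτ : 0 < τ) {H : D.M} {s' s : State D} (h : IsStep D p η τ H s' s) :
    ∫ x in Ω, fn (s.Φ : H1 Ω) x = ∫ x in Ω, fn (s'.Φ : H1 Ω) x := by
  have := isFiniteMeasure_restrict hb
  obtain ⟨g, hg, hg1⟩ := D.one_mem
  have hgrad := grad_eq_zero_of_const hΩ g 1 hg1
  have h1 := h.phase ⟨g, hg⟩
  simp only [hgrad, inner_zero_right, mul_zero, sub_zero] at h1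
  have h2 : ∫ x in Ω, fn (s'.Φ : H1 Ω) x *
      ∑ i, fn (comp i (s.U : H1v Ω)) x * ((0 : L2v Ω) : Sp d → Sp d) x i = 0 := by
    refine integral_eq_zero_of_ae ?_
    filter_upwards [Lp.coeFn_zero (Sp d) 2 ((volume : Measure (Sp d)).restrict Ω)] with x hx
    rw [hx]
    simp
  rw [h2, sub_zero, div_eq_zero_iff, or_iff_left hτ.ne', L2.inner_def] at h1
  have h3 : ∫ x in Ω, inner ℝ (fn ((s.Φ - s'.Φ : D.G) : H1 Ω) x) (fn g x)
      = ∫ x in Ω, (fn (s.Φ : H1 Ω) x - fn (s'.Φ : H1 Ω) x) := by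
    refine integral_congr_ae ?_
    rw [Submodule.coe_sub, map_sub]
    filter_upwards [hg1, Lp.coeFn_sub (fn (s.Φ : H1 Ω)) (fn (s'.Φ : H1 Ω))] with x hx hy
    rw [hx, hy]
    simp
  rw [h3, integral_sub ((Lp.memLp _).integrable (by norm_num))
    ((Lp.memLp _).integrable (by norm_num))] at h1
  linarith

theorem IsSolution.mass (hΩ : IsOpen Ω) (hb : Bornology.IsBounded Ω) {D : Discretization Ω}
    {p : Params} {η tF : ℝ} (htF : 0 < tF) {dat : SmoothData Ω} {K : ℕ} (hK : 0 < K)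
    {s : ℕ → State D} (hs : IsSolution D p η tF dat K s) {k : ℕ} (hk : k ≤ K) :
    ∫ x in Ω, fn ((s k).Φ : H1 Ω) x = ∫ x in Ω, fn ((s 0).Φ : H1 Ω) x := by
  have hτ : 0 < tF / K := div_pos htF (by exact_mod_cast hK)
  induction k with
  | zero => rfl
  | succ k ih =>
    rw [← ih (by omega)]
    exact (hs.step (k + 1) (Finset.mem_Icc.2 ⟨by omega, hk⟩)).mass hΩ hb hτ

end Mass

/-! ## Bounds of the interpolated data -/

section Data

variable {d : ℕ} {Ω : Set (Sp d)}

theorem memLp_of_continuous {F : Type*} [NormedAddCommGroup F] (hb : Bornology.IsBounded Ω)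
    (hΩ : IsOpen Ω) {f : Sp d → F} (hf : Continuous f) :
    MemLp f 2 ((volume : Measure (Sp d)).restrict Ω) := by
  have := isFiniteMeasure_restrict hb
  have hc : IsCompact (closure Ω) := hb.isCompact_closure
  obtain ⟨C, hC⟩ := hc.exists_bound_of_continuousOn hf.continuousOn
  have hm : AEStronglyMeasurable f ((volume : Measure (Sp d)).restrict (closure Ω)) :=
    hf.continuousOn.aestronglyMeasurable_of_isCompact hc hc.measurableSet
  refine MemLp.of_bound (hm.mono_measure (Measure.restrict_mono subset_closure le_rfl)) C ?_
  filter_upwards [ae_restrict_mem hΩ.measurableSet] with x hx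
  exact hC x (subset_closure hx)

theorem l2norm_le_of_bound {F : Type*} [NormedAddCommGroup F] (hb : Bornology.IsBounded Ω)
    (hΩ : IsOpen Ω) {f : Sp d → F} {C : ℝ} (hC0 : 0 ≤ C) (hC : ∀ x ∈ Ω, ‖f x‖ ≤ C) :
    l2norm Ω f ≤ (volume Ω ^ (2 : ℝ)⁻¹).toReal * C := by
  have := isFiniteMeasure_restrict hb
  have h := eLpNorm_le_of_ae_bound (p := 2) (μ := (volume : Measure (Sp d)).restrict Ω) (f := f)
    (C := C) (by
      filter_upwards [ae_restrict_mem hΩ.measurableSet] with x hx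
      exact hC x hx)
  simp only [Measure.restrict_apply MeasurableSet.univ, Set.univ_inter,
    ENNReal.toReal_ofNat] at h
  have hfin : volume Ω ^ (2 : ℝ)⁻¹ ≠ ⊤ :=
    ENNReal.rpow_ne_top_of_nonneg (by norm_num) hb.measure_lt_top.ne
  refine (ENNReal.toReal_mono (ENNReal.mul_ne_top hfin ENNReal.ofReal_ne_top) h).trans_eq ?_
  rw [ENNReal.toReal_mul, ENNReal.toReal_ofReal hC0]

theorem l2norm_nonneg {F : Type*} [NormedAddCommGroup F] (f : Sp d → F) : 0 ≤ l2norm Ω f :=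
  ENNReal.toReal_nonneg

theorem l2norm_le_add {F : Type*} [NormedAddCommGroup F] {f g : Sp d → F}
    (hf : MemLp f 2 ((volume : Measure (Sp d)).restrict Ω))
    (hg : MemLp g 2 ((volume : Measure (Sp d)).restrict Ω)) :
    l2norm Ω f ≤ l2norm Ω (fun x => f x - g x) + l2norm Ω g := by
  have hfg : MemLp (fun x => f x - g x) 2 ((volume : Measure (Sp d)).restrict Ω) := hf.sub hg
  have h1 : f = (fun x => f x - g x) + g := by
    ext x
    simp
  have h2 : eLpNorm f 2 ((volume : Measure (Sp d)).restrict Ω)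
      ≤ eLpNorm (fun x => f x - g x) 2 ((volume : Measure (Sp d)).restrict Ω)
        + eLpNorm g 2 ((volume : Measure (Sp d)).restrict Ω) := by
    conv_lhs => rw [h1]
    exact eLpNorm_add_le hfg.1 hg.1 (by norm_num)
  rw [l2norm, l2norm, l2norm, ← ENNReal.toReal_add hfg.2.ne hg.2.ne]
  exact ENNReal.toReal_mono (ENNReal.add_ne_top.2 ⟨hfg.2.ne, hg.2.ne⟩) h2

/-- The constants `c` and `hmax` are arbitrary reals; absolute values make the bound monotone. -/
theorem mul_pow_le_abs_mul_pow {c h hmax : ℝ} (hh : 0 < h) (hm : h ≤ hmax) (n : ℕ) {X : ℝ}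
    (hX : 0 ≤ X) : c * h ^ n * X ≤ |c| * |hmax| ^ n * X := by
  have : h ≤ |hmax| := hm.trans (le_abs_self _)
  gcongr
  exact le_abs_self c

theorem Discretization.Approximates.norm_IM_le (hb : Bornology.IsBounded Ω) (hΩ : IsOpen Ω)
    {D : Discretization Ω} {c hmax : ℝ} {lG lM lU : ℕ} (hD : D.Approximates c lG lM lU)
    (hh : D.h ≤ hmax) (φ : C(Sp d, Sp d)) (hφ : ContDiff ℝ ∞ φ) :
    ‖(D.IM (φ.restrict (closure Ω)) : L2v Ω)‖
      ≤ l2norm Ω φ + |c| * |hmax| ^ (lM + 1) * l2norm Ω (iteratedFDeriv ℝ (lM + 1) φ) := by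
  have h1 := l2norm_le_add (Lp.memLp (D.IM (φ.restrict (closure Ω)) : L2v Ω))
    (memLp_of_continuous hb hΩ φ.continuous)
  have h2 := hD.approxM φ hφ
  have h3 := mul_pow_le_abs_mul_pow (c := c) D.h_pos hh (lM + 1)
    (l2norm_nonneg (Ω := Ω) (iteratedFDeriv ℝ (lM + 1) φ))
  rw [Lp.norm_def]
  exact h1.trans (by linarith)

theorem Discretization.Approximates.norm_fn_IG_le (hb : Bornology.IsBounded Ω) (hΩ : IsOpen Ω)
    {D : Discretization Ω} {c hmax : ℝ} {lG lM lU : ℕ} (hD : D.Approximates c lG lM lU)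
    (hh : D.h ≤ hmax) (φ : C(Sp d, ℝ)) (hφ : ContDiff ℝ ∞ φ) :
    ‖fn (D.IG (φ.restrict (closure Ω)) : H1 Ω)‖
      ≤ l2norm Ω φ + |c| * |hmax| ^ (lG + 1) * l2norm Ω (iteratedFDeriv ℝ (lG + 1) φ) := by
  have h1 := l2norm_le_add (Lp.memLp (fn (D.IG (φ.restrict (closure Ω)) : H1 Ω)))
    (memLp_of_continuous hb hΩ φ.continuous)
  have h2 := hD.approxG φ hφ
  have h3 := mul_pow_le_abs_mul_pow (c := c) D.h_pos hh (lG + 1)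
    (l2norm_nonneg (Ω := Ω) (iteratedFDeriv ℝ (lG + 1) φ))
  have h4 := mul_nonneg D.h_pos.le (l2norm_nonneg (Ω := Ω)
    (fun x => grad (D.IG (φ.restrict (closure Ω)) : H1 Ω) x - gradient φ x))
  rw [Lp.norm_def]
  exact h1.trans (by linarith)

theorem Discretization.Approximates.norm_grad_IG_le (hb : Bornology.IsBounded Ω) (hΩ : IsOpen Ω)
    {D : Discretization Ω} {c hmax : ℝ} {lG lM lU : ℕ} (hD : D.Approximates c lG lM lU)
    (hh : D.h ≤ hmax) (φ : C(Sp d, ℝ)) (hφ : ContDiff ℝ ∞ φ) :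
    ‖grad (D.IG (φ.restrict (closure Ω)) : H1 Ω)‖
      ≤ l2norm Ω (gradient φ)
        + |c| * |hmax| ^ lG * l2norm Ω (iteratedFDeriv ℝ (lG + 1) φ) := by
  have hg : Continuous (gradient φ) :=
    (InnerProductSpace.toDual ℝ (Sp d)).symm.continuous.comp (hφ.continuous_fderiv (by simp))
  have h1 := l2norm_le_add (Lp.memLp (grad (D.IG (φ.restrict (closure Ω)) : H1 Ω)))
    (memLp_of_continuous hb hΩ hg)
  have h2 := hD.approxG φ hφ
  have h3 := mul_pow_le_abs_mul_pow (c := c) D.h_pos hh lG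
    (l2norm_nonneg (Ω := Ω) (iteratedFDeriv ℝ (lG + 1) φ))
  have h4 := l2norm_nonneg (Ω := Ω)
    (fun x => fn (D.IG (φ.restrict (closure Ω)) : H1 Ω) x - φ x)
  -- Dividing by the weight `D.h` of the gradient term lowers the power of `D.h` by one.
  have h5 : l2norm Ω (fun x => grad (D.IG (φ.restrict (closure Ω)) : H1 Ω) x - gradient φ x)
      ≤ c * D.h ^ lG * l2norm Ω (iteratedFDeriv ℝ (lG + 1) φ) := by
    refine le_of_mul_le_mul_left ?_ D.h_pos
    rw [pow_succ] at h2
    linarith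
  rw [Lp.norm_def]
  exact h1.trans (by linarith)

theorem memLp_toLp_comp (u : H1v Ω) : MemLp (fun x => WithLp.toLp 2 fun i => fn (comp i u) x) 2
    ((volume : Measure (Sp d)).restrict Ω) := by
  have h : MemLp (fun x i => fn (comp i u) x) 2 ((volume : Measure (Sp d)).restrict Ω) :=
    memLp_pi_iff.2 fun i => Lp.memLp (fn (comp i u))
  exact (PiLp.continuousLinearEquiv 2 ℝ fun _ : Fin d => ℝ).symm.toContinuousLinearMap.comp_memLp' h

theorem ipV_self_eq_l2norm_sq (u : H1v Ω) :
    ipV u u = l2norm Ω (fun x => WithLp.toLp 2 fun i => fn (comp i u) x) ^ 2 := by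
  have h := memLp_toLp_comp u
  have h1 := integral_sq_eq h.norm
  rw [eLpNorm_norm] at h1
  rw [l2norm, ← h1, ipV_self]
  simp only [norm_sq_eq_integral, EuclideanSpace.norm_sq_eq]
  rw [integral_finsetSum _ fun i _ => (Lp.memLp (fn (comp i u))).norm.integrable_sq]

theorem Discretization.Approximates.ipV_IU_le (hb : Bornology.IsBounded Ω) (hΩ : IsOpen Ω)
    {D : Discretization Ω} {c hmax : ℝ} {lG lM lU : ℕ} (hD : D.Approximates c lG lM lU)
    (hh : D.h ≤ hmax) (φ : C(Sp d, Sp d)) (hφ : ContDiff ℝ ∞ φ) (hφ0 : ∀ x ∈ frontier Ω, φ x = 0) :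
    ipV (D.IU (φ.restrict (closure Ω)) : H1v Ω) (D.IU (φ.restrict (closure Ω)) : H1v Ω)
      ≤ (l2norm Ω φ
        + |c| * |hmax| ^ (lU + 1) * l2norm Ω (iteratedFDeriv ℝ (lU + 1) φ)) ^ 2 := by
  have h1 := l2norm_le_add (memLp_toLp_comp (D.IU (φ.restrict (closure Ω)) : H1v Ω))
    (memLp_of_continuous hb hΩ φ.continuous)
  have h2 := hD.approxU φ hφ hφ0
  have h3 := mul_pow_le_abs_mul_pow (c := c) D.h_pos hh (lU + 1)
    (l2norm_nonneg (Ω := Ω) (iteratedFDeriv ℝ (lU + 1) φ))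
  rw [ipV_self_eq_l2norm_sq]
  exact pow_le_pow_left₀ (l2norm_nonneg _) (h1.trans (by linarith)) 2

/-- Spatial derivatives of a smooth function of time and space are bounded and Lipschitz
continuous in time. -/
theorem exists_bound_iteratedFDeriv (hb : Bornology.IsBounded Ω) {h : ℝ → C(Sp d, Sp d)}
    (hh : ContDiff ℝ ∞ fun q : ℝ × Sp d => h q.1 q.2) (T : ℝ) (n : ℕ) :
    ∃ L, 0 ≤ L ∧ ∀ t ∈ Set.Icc 0 T, ∀ x ∈ Ω, ‖iteratedFDeriv ℝ n (h t) x‖ ≤ L ∧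
      ∀ t' ∈ Set.Icc 0 T, ‖iteratedFDeriv ℝ n (h t - h t') x‖ ≤ L * |t - t'| := by
  set Hj : ℝ × Sp d → Sp d := fun q => h q.1 q.2 with hHj
  have hslice : ∀ t, ContDiff ℝ ∞ (h t) := fun t =>
    hh.comp (contDiff_const.prodMk contDiff_id)
  -- A spatial derivative is the space-time derivative composed with the inclusion of `{0} × ℝ^d`.
  -- It is therefore jointly `C¹`, and Lipschitz on a compact convex set containing the cylinder.
  have hder : ∀ t x, iteratedFDeriv ℝ n (h t) x
      = (iteratedFDeriv ℝ n Hj (t, x)).compContinuousLinearMap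
        fun _ => ContinuousLinearMap.inr ℝ ℝ (Sp d) := by
    intro t x
    have e1 : (h t : Sp d → Sp d)
        = (fun q => Hj ((t, 0) + q)) ∘ ContinuousLinearMap.inr ℝ ℝ (Sp d) := by
      ext y
      simp [hHj]
    have hc : ContDiff ℝ ∞ fun q => Hj ((t, 0) + q) := hh.comp (contDiff_const.add contDiff_id)
    rw [e1, ContinuousLinearMap.iteratedFDeriv_comp_right _ hc x (by exact_mod_cast le_top),
      iteratedFDeriv_comp_add_left]
    simp
  have hsmooth : ContDiff ℝ 1 fun q : ℝ × Sp d => iteratedFDeriv ℝ n (h q.1) q.2 := by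
    simp only [hder]
    have h1 : ContDiff ℝ 1 (iteratedFDeriv ℝ n Hj) :=
      hh.iteratedFDeriv_right (by exact_mod_cast le_top)
    exact (ContinuousMultilinearMap.compContinuousLinearMapL
      (fun _ : Fin n => ContinuousLinearMap.inr ℝ ℝ (Sp d))).contDiff.comp h1
  obtain ⟨R, hR⟩ := hb.subset_closedBall (0 : Sp d)
  have hcomp : IsCompact (Set.Icc (0 : ℝ) T ×ˢ Metric.closedBall (0 : Sp d) R) :=
    isCompact_Icc.prod (isCompact_closedBall _ _)
  have hconv : Convex ℝ (Set.Icc (0 : ℝ) T ×ˢ Metric.closedBall (0 : Sp d) R) :=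
    (convex_Icc _ _).prod (convex_closedBall _ _)
  obtain ⟨C, hC⟩ := hcomp.exists_bound_of_continuousOn hsmooth.continuous.continuousOn
  obtain ⟨K, hK⟩ := hsmooth.contDiffOn.exists_lipschitzOnWith one_ne_zero hconv hcomp
  refine ⟨max (max C K) 0, le_max_right _ _, fun t ht x hx => ⟨?_, fun t' ht' => ?_⟩⟩
  · exact (hC (t, x) ⟨ht, hR hx⟩).trans ((le_max_left _ _).trans (le_max_left _ _))
  · have h1 := hK.norm_sub_le (x := (t, x)) ⟨ht, hR hx⟩ (y := (t', x)) ⟨ht', hR hx⟩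
    have h2 : iteratedFDeriv ℝ n (h t - h t') x
        = iteratedFDeriv ℝ n (h t) x - iteratedFDeriv ℝ n (h t') x := by
      exact iteratedFDeriv_sub_apply ((hslice t).contDiffAt.of_le (by exact_mod_cast le_top))
        ((hslice t').contDiffAt.of_le (by exact_mod_cast le_top))
    rw [h2]
    refine h1.trans ?_
    have h3 : ‖((t, x) : ℝ × Sp d) - (t', x)‖ = |t - t'| := by
      simp [Prod.norm_def]
    rw [h3]
    gcongr
    exact (le_max_right _ _).trans (le_max_left _ _)

/-- The discrete magnetic fields are bounded and Lipschitz continuous in time, uniformly in the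
discretization. -/
theorem exists_bound_IM_ha (hb : Bornology.IsBounded Ω) (hΩ : IsOpen Ω) (dat : SmoothData Ω)
    (T c hmax : ℝ) (lG lM lU : ℕ) : ∃ B, 0 ≤ B ∧ ∀ D : Discretization Ω, D.h ≤ hmax →
      D.Approximates c lG lM lU → ∀ t ∈ Set.Icc 0 T,
        ‖(D.IM ((dat.ha t).restrict (closure Ω)) : L2v Ω)‖ ≤ B ∧
        ∀ t' ∈ Set.Icc 0 T, ‖((D.IM ((dat.ha t).restrict (closure Ω))
          - D.IM ((dat.ha t').restrict (closure Ω)) : D.M) : L2v Ω)‖ ≤ B * |t - t'| := by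
  obtain ⟨L₀, hL₀, h0⟩ := exists_bound_iteratedFDeriv hb dat.ha_smooth T 0
  obtain ⟨L₁, hL₁, h1⟩ := exists_bound_iteratedFDeriv hb dat.ha_smooth T (lM + 1)
  set V := (volume Ω ^ (2 : ℝ)⁻¹).toReal with hV
  have hV0 : 0 ≤ V := ENNReal.toReal_nonneg
  have hslice : ∀ t, ContDiff ℝ ∞ (dat.ha t) := fun t =>
    dat.ha_smooth.comp (contDiff_const.prodMk contDiff_id)
  refine ⟨V * L₀ + |c| * |hmax| ^ (lM + 1) * (V * L₁), by positivity,
    fun D hD hA t ht => ⟨?_, fun t' ht' => ?_⟩⟩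
  · refine (hA.norm_IM_le hb hΩ hD (dat.ha t) (hslice t)).trans ?_
    gcongr
    · exact l2norm_le_of_bound hb hΩ hL₀ fun x hx => by
        simpa using (h0 t ht x hx).1
    · exact l2norm_le_of_bound hb hΩ hL₁ fun x hx => (h1 t ht x hx).1
  -- By linearity the increment of the interpolated field is the interpolant of the increment, to
  -- which the same approximation estimate applies.
  · have e : D.IM ((dat.ha t).restrict (closure Ω)) - D.IM ((dat.ha t').restrict (closure Ω))
        = D.IM ((dat.ha t - dat.ha t').restrict (closure Ω)) := by
      rw [← map_sub]
      rfl
    have hs : ContDiff ℝ ∞ (dat.ha t - dat.ha t' : C(Sp d, Sp d)) := (hslice t).sub (hslice t')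
    rw [e]
    refine (hA.norm_IM_le hb hΩ hD (dat.ha t - dat.ha t') hs).trans ?_
    have e2 : (V * L₀ + |c| * |hmax| ^ (lM + 1) * (V * L₁)) * |t - t'|
        = V * (L₀ * |t - t'|) + |c| * |hmax| ^ (lM + 1) * (V * (L₁ * |t - t'|)) := by ring
    rw [e2]
    gcongr
    · exact l2norm_le_of_bound hb hΩ (by positivity) fun x hx => by
        simpa using (h0 t ht x hx).2 t' ht'
    · exact l2norm_le_of_bound hb hΩ (by positivity) fun x hx => (h1 t ht x hx).2 t' ht'

end Data

/-! ## Bound of the chemical potential -/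

section Potential

variable {d : ℕ} {Ω : Set (Sp d)}

theorem integral_dwF_nonneg (u : L2 Ω) : 0 ≤ ∫ x in Ω, dwF (u x) :=
  integral_nonneg fun _ => dwF_nonneg _

theorem norm_sq_le_integral_dwF (hb : Bornology.IsBounded Ω) (u : L2 Ω) :
    ‖u‖ ^ 2 ≤ 2 * (∫ x in Ω, dwF (u x)) + 2 * (volume Ω).toReal := by
  have := isFiniteMeasure_restrict hb
  have h : ∫ x in Ω, ‖u x‖ ^ 2 ≤ ∫ x in Ω, (2 * dwF (u x) + 2) := by
    refine integral_mono (Lp.memLp u).norm.integrable_sq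
      (((integrable_dwF_comp hb u).const_mul 2).add (integrable_const 2)) fun x => ?_
    simp only [Real.norm_eq_abs, sq_abs]
    exact sq_le_dwF _
  rw [integral_add ((integrable_dwF_comp hb u).const_mul 2) (integrable_const 2),
    integral_const_mul, integral_const, smul_eq_mul, Measure.real,
    Measure.restrict_apply_univ] at h
  rw [norm_sq_eq_integral]
  linarith

theorem integral_dwF_le_norm_sq (hb : Bornology.IsBounded Ω) (u : L2 Ω) :
    ∫ x in Ω, dwF (u x) ≤ ‖u‖ ^ 2 + (volume Ω).toReal := by
  have := isFiniteMeasure_restrict hb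
  have h : ∫ x in Ω, dwF (u x) ≤ ∫ x in Ω, (‖u x‖ ^ 2 + 1) := by
    refine integral_mono (integrable_dwF_comp hb u)
      ((Lp.memLp u).norm.integrable_sq.add (integrable_const 1)) fun x => ?_
    simp only [Real.norm_eq_abs, sq_abs]
    exact dwF_le_sq_add_one _
  rw [integral_add (Lp.memLp u).norm.integrable_sq (integrable_const 1),
    integral_const, smul_eq_mul, Measure.real, Measure.restrict_apply_univ] at h
  rw [norm_sq_eq_integral]
  linarith

theorem norm_dwfun_comp_sq_le (hb : Bornology.IsBounded Ω) (u : L2 Ω) :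
    ‖(memLp_dwfun_comp hb u).toLp _‖ ^ 2 ≤ 4 * ∫ x in Ω, dwF (u x) := by
  rw [norm_sq_eq_integral, ← integral_const_mul]
  refine integral_mono_ae (Lp.memLp _).norm.integrable_sq
    ((integrable_dwF_comp hb u).const_mul 4) ?_
  filter_upwards [(memLp_dwfun_comp hb u).coeFn_toLp] with x hx
  rw [hx, Real.norm_eq_abs, sq_abs]
  exact dwfun_sq_le _

theorem energy_nonneg {D : Discretization Ω} (p : Params) (s : State D) : 0 ≤ energy p s := by
  have h1 := p.lam_pos
  have h2 := integral_dwF_nonneg (fn (s.Φ : H1 Ω))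
  have h3 : 0 ≤ ipV (s.U : H1v Ω) (s.U : H1v Ω) := by
    rw [ipV_self]
    positivity
  rw [energy]
  positivity

theorem norm_grad_sq_le_energy {D : Discretization Ω} (p : Params) (s : State D) :
    ‖grad (s.Φ : H1 Ω)‖ ^ 2 ≤ energy p s / p.lam := by
  have h1 := p.lam_pos
  have h2 := integral_dwF_nonneg (fn (s.Φ : H1 Ω))
  have h3 : 0 ≤ ipV (s.U : H1v Ω) (s.U : H1v Ω) := by
    rw [ipV_self]
    positivity
  have h4 : 0 ≤ (2 * p.lam / p.ε ^ 2) * ∫ x in Ω, dwF (fn (s.Φ : H1 Ω) x) := by positivity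
  rw [le_div_iff₀ h1, energy, mul_comm]
  exact le_add_of_le_of_nonneg (le_add_of_nonneg_left h3) h4

theorem integral_dwF_le_energy {D : Discretization Ω} (p : Params) (s : State D) :
    ∫ x in Ω, dwF (fn (s.Φ : H1 Ω) x) ≤ energy p s * p.ε ^ 2 / (2 * p.lam) := by
  have h1 := p.lam_pos
  have hε := p.ε_pos
  have h3 : 0 ≤ ipV (s.U : H1v Ω) (s.U : H1v Ω) := by
    rw [ipV_self]
    positivity
  have h4 : 0 ≤ ipV (s.U : H1v Ω) (s.U : H1v Ω) + p.lam * ‖grad (s.Φ : H1 Ω)‖ ^ 2 := by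
    positivity
  have h5 : (2 * p.lam / p.ε ^ 2) * ∫ x in Ω, dwF (fn (s.Φ : H1 Ω) x) ≤ energy p s :=
    le_add_of_nonneg_left h4
  calc ∫ x in Ω, dwF (fn (s.Φ : H1 Ω) x)
      = (2 * p.lam / p.ε ^ 2) * (∫ x in Ω, dwF (fn (s.Φ : H1 Ω) x)) * (p.ε ^ 2 / (2 * p.lam)) := by
        field_simp
    _ ≤ energy p s * (p.ε ^ 2 / (2 * p.lam)) := by gcongr
    _ = _ := by ring

theorem norm_grad_le_dissipation {D : Discretization Ω} (p : Params) {τ : ℝ} (hτ : 0 < τ)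
    (H : D.M) (s' s : State D) :
    (2 * p.lam * p.γ * τ / p.ε) * ‖grad (s.Ψ : H1 Ω)‖ ^ 2 ≤ dissipation p τ H s' s := by
  have h1 := p.lam_pos
  have h2 := p.μ₀_pos
  have h3 := p.trel_pos
  have a1 : 0 ≤ ipV ((s.U - s'.U : D.U) : H1v Ω) ((s.U - s'.U : D.U) : H1v Ω) := by
    rw [ipV_self]
    positivity
  have a2 : 0 ≤ ∫ x in Ω, p.ν (fn (s'.Φ : H1 Ω) x) *
      ∑ i, ∑ j, symGrad (s.U : H1v Ω) i j x ^ 2 :=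
    integral_nonneg fun x => mul_nonneg (p.ν_pos _).le
      (Finset.sum_nonneg fun i _ => Finset.sum_nonneg fun j _ => sq_nonneg _)
  have a3 : 0 ≤ ∫ x in Ω, p.κ (fn (s'.Φ : H1 Ω) x) * ‖(H : L2v Ω) x‖ ^ 2 :=
    integral_nonneg fun x => mul_nonneg (p.κ_bounds _).1 (sq_nonneg _)
  rw [dissipation]
  refine le_add_of_le_of_nonneg (le_add_of_le_of_nonneg (le_add_of_le_of_nonneg
    (le_add_of_nonneg_left ?_) ?_) ?_) ?_ <;> positivity

/-- `h` is the potential equation tested with `Ψ`, and `w = ‖Ψ‖`. The terms of `f` and of the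
stabilization spend `w² / 4` each, so everything else is doubled. The increment is bounded by the
two norms only, which is why `1 / η ^ 2` remains. -/
theorem potential_arith {ε η w gg gΦ gΨ f Fi δ δi Φ Φ' a b v : ℝ} (hε : 0 < ε) (hη : 0 < η)
    (h : w ^ 2 + ε * gg + 1 / ε * Fi + 1 / η * δi = 0) (hgg : |gg| ≤ gΦ * gΨ)
    (hF : |Fi| ≤ f * w) (hδ : |δi| ≤ δ * w) (hδ' : δ ≤ Φ + Φ') (hδ0 : 0 ≤ δ)
    (ha : gΦ ^ 2 ≤ a) (hf : f ^ 2 ≤ 4 * b) (hΦ : Φ ^ 2 ≤ 2 * b + 2 * v)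
    (hΦ' : Φ' ^ 2 ≤ 2 * b + 2 * v) :
    w ^ 2 ≤ gΨ ^ 2 + (ε ^ 2 * a + 8 * b / ε ^ 2 + 16 * (b + v) / η ^ 2) := by
  have h1 : - (ε * gg) ≤ ε ^ 2 * a / 2 + gΨ ^ 2 / 2 := by
    have := mul_le_mul_of_nonneg_left (abs_le.1 hgg).1 hε.le
    have := mul_le_mul_of_nonneg_left ha (sq_nonneg ε)
    nlinarith [sq_nonneg (ε * gΦ - gΨ)]
  have h2 : - (1 / ε * Fi) ≤ 4 * b / ε ^ 2 + w ^ 2 / 4 := by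
    have e1 := mul_le_mul_of_nonneg_left (abs_le.1 hF).1 (one_div_pos.2 hε).le
    have e2 := mul_le_mul_of_nonneg_left hf (sq_nonneg (1 / ε))
    have e3 : 4 * b / ε ^ 2 = (1 / ε) ^ 2 * (4 * b) := by ring
    nlinarith [sq_nonneg (1 / ε * f - w / 2)]
  have h3 : - (1 / η * δi) ≤ 8 * (b + v) / η ^ 2 + w ^ 2 / 4 := by
    have e1 := mul_le_mul_of_nonneg_left (abs_le.1 hδ).1 (one_div_pos.2 hη).le
    have e0 : δ ^ 2 ≤ 8 * (b + v) := by nlinarith [sq_nonneg (Φ - Φ')]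
    have e2 := mul_le_mul_of_nonneg_left e0 (sq_nonneg (1 / η))
    have e3 : 8 * (b + v) / η ^ 2 = (1 / η) ^ 2 * (8 * (b + v)) := by ring
    nlinarith [sq_nonneg (1 / η * δ - w / 2)]
  have e4 : 8 * b / ε ^ 2 = 2 * (4 * b / ε ^ 2) := by ring
  have e5 : 16 * (b + v) / η ^ 2 = 2 * (8 * (b + v) / η ^ 2) := by ring
  linarith

/-- The chemical potential of one step is controlled by its gradient and the energy. -/
theorem IsStep.norm_potential_sq_le (hb : Bornology.IsBounded Ω) {D : Discretization Ω}
    {p : Params} {η τ : ℝ} (hη : 0 < η) {H : D.M} {s' s : State D} (h : IsStep D p η τ H s' s)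
    {a b : ℝ} (ha : ‖grad (s.Φ : H1 Ω)‖ ^ 2 ≤ a)
    (hs : ∫ x in Ω, dwF (fn (s.Φ : H1 Ω) x) ≤ b) (hs' : ∫ x in Ω, dwF (fn (s'.Φ : H1 Ω) x) ≤ b) :
    ‖fn (s.Ψ : H1 Ω)‖ ^ 2 ≤ ‖grad (s.Ψ : H1 Ω)‖ ^ 2 + (p.ε ^ 2 * a + 8 * b / p.ε ^ 2
      + 16 * (b + (volume Ω).toReal) / η ^ 2) := by
  have e := h.chemical s.Ψ
  rw [real_inner_self_eq_norm_sq] at e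
  have hm := memLp_dwfun_comp hb (fn (s'.Φ : H1 Ω))
  have hF : ∫ x in Ω, dwf (fn (s'.Φ : H1 Ω) x) * fn (s.Ψ : H1 Ω) x
      = inner ℝ (hm.toLp _) (fn (s.Ψ : H1 Ω)) := by
    rw [inner_toLp_left, dwf_eq]
    simp only [RCLike.inner_apply, conj_trivial, mul_comm]
  rw [hF] at e
  have h1 := norm_sq_le_integral_dwF hb (fn (s.Φ : H1 Ω))
  have h2 := norm_sq_le_integral_dwF hb (fn (s'.Φ : H1 Ω))
  have h3 : ‖fn ((s.Φ - s'.Φ : D.G) : H1 Ω)‖ ≤ ‖fn (s.Φ : H1 Ω)‖ + ‖fn (s'.Φ : H1 Ω)‖ := by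
    rw [Submodule.coe_sub, map_sub]
    exact norm_sub_le _ _
  exact potential_arith p.ε_pos hη e (abs_real_inner_le_norm _ _)
    (abs_real_inner_le_norm _ _) (abs_real_inner_le_norm _ _) h3 (norm_nonneg _) ha
    ((norm_dwfun_comp_sq_le hb _).trans (by gcongr)) (h1.trans (by gcongr)) (h2.trans (by gcongr))

/-- The initial energy is bounded uniformly in the discretization. -/
theorem exists_bound_initial (hb : Bornology.IsBounded Ω) (hΩ : IsOpen Ω) (p : Params)
    (dat : SmoothData Ω) (c hmax : ℝ) (lG lM lU : ℕ) :
    ∃ R, ∀ D : Discretization Ω, D.h ≤ hmax → D.Approximates c lG lM lU →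
      ∀ (η tF : ℝ) (K : ℕ) (s : ℕ → State D), IsSolution D p η tF dat K s →
        energy p (s 0) + 2 * p.μ₀ * ‖((s 0).M : L2v Ω)‖ ^ 2 ≤ R := by
  have h1 := p.lam_pos
  have h2 := p.μ₀_pos
  let bd {F : Type} [NormedAddCommGroup F] [NormedSpace ℝ F] (f : Sp d → F) (n l : ℕ) : ℝ :=
    |c| * |hmax| ^ n * l2norm Ω (iteratedFDeriv ℝ l f)
  refine ⟨(l2norm Ω dat.u0 + bd dat.u0 (lU + 1) (lU + 1)) ^ 2
    + p.lam * (l2norm Ω (gradient dat.φ0) + bd dat.φ0 lG (lG + 1)) ^ 2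
    + (2 * p.lam / p.ε ^ 2)
      * ((l2norm Ω dat.φ0 + bd dat.φ0 (lG + 1) (lG + 1)) ^ 2 + (volume Ω).toReal)
    + 2 * p.μ₀ * (l2norm Ω dat.m0 + bd dat.m0 (lM + 1) (lM + 1)) ^ 2,
    fun D hD hA η tF K s hs => ?_⟩
  have aU := hA.ipV_IU_le hb hΩ hD dat.u0 dat.u0_smooth dat.u0_bdry
  have aG := hA.norm_grad_IG_le hb hΩ hD dat.φ0 dat.φ0_smooth
  have aF := hA.norm_fn_IG_le hb hΩ hD dat.φ0 dat.φ0_smooth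
  have aM := hA.norm_IM_le hb hΩ hD dat.m0 dat.m0_smooth
  have aP := (integral_dwF_le_norm_sq hb (fn (D.IG (dat.φ0.restrict (closure Ω)) : H1 Ω))).trans
    (add_le_add_left (pow_le_pow_left₀ (norm_nonneg _) aF 2) _)
  rw [energy, hs.initΦ, hs.initM, hs.initU]
  exact add_le_add (add_le_add (add_le_add aU (mul_le_mul_of_nonneg_left
    (pow_le_pow_left₀ (norm_nonneg _) aG 2) h1.le))
    (mul_le_mul_of_nonneg_left aP (by positivity)))
    (mul_le_mul_of_nonneg_left (pow_le_pow_left₀ (norm_nonneg _) aM 2) (by positivity))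

/-- Energy and dissipation are bounded uniformly in the discretization. -/
theorem exists_bound_energy (hb : Bornology.IsBounded Ω) (hΩ : IsOpen Ω) (p : Params)
    {η tF : ℝ} (hη : 0 < η) (hηε : η ≤ p.ε) (htF : 0 < tF)
    (dat : SmoothData Ω) (c hmax : ℝ) (lG lM lU : ℕ) :
    ∃ R, ∀ D : Discretization Ω, D.h ≤ hmax → D.Approximates c lG lM lU →
      ∀ (K : ℕ) (s : ℕ → State D), 0 < K → IsSolution D p η tF dat K s → ∀ n ≤ K,
        energy p (s n) ≤ R ∧ ∑ k ∈ Finset.Icc 1 n,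
          dissipation p (tF / K) (Hk D dat (tF / K) k) (s (k - 1)) (s k) ≤ R := by
  obtain ⟨R₀, hR₀⟩ := exists_bound_initial hb hΩ p dat c hmax lG lM lU
  obtain ⟨B, hB0, hB⟩ := exists_bound_IM_ha hb hΩ dat tF c hmax lG lM lU
  have hμ := p.μ₀_pos
  have htr := p.trel_pos
  refine ⟨R₀ + p.μ₀ * B ^ 2 + 2 * p.μ₀ * B ^ 2
    + 3 * p.μ₀ / p.trel * (1 + p.κ₀ ^ 2) * B ^ 2 * tF + 3 * p.μ₀ * p.trel * (tF * B ^ 2),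
    fun D hD hA K s hK hs n hn => ?_⟩
  have hi := hR₀ D hD hA η tF K s hs
  have hK' : (0 : ℝ) < K := by exact_mod_cast hK
  have hτ : 0 < tF / K := div_pos htF hK'
  have hmem : ∀ k ≤ K, (k : ℝ) * (tF / K) ∈ Set.Icc 0 tF := fun k hk =>
    ⟨by positivity, by
      have : (k : ℝ) ≤ K := by exact_mod_cast hk
      calc (k : ℝ) * (tF / K) ≤ K * (tF / K) := by gcongr
        _ = tF := by field_simp⟩
  have hH : ∀ k ≤ K, ‖(Hk D dat (tF / K) k : L2v Ω)‖ ^ 2 ≤ B ^ 2 := fun k hk =>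
    pow_le_pow_left₀ (norm_nonneg _) (hB D hD hA _ (hmem k hk)).1 2
  -- Lipschitz continuity in time bounds the difference quotient by `B`, whatever the step size.
  have hδ : ∀ k, k + 1 ≤ K →
      ‖((tF / K)⁻¹ • (Hk D dat (tF / K) (k + 1) - Hk D dat (tF / K) k : D.M) : L2v Ω)‖ ^ 2
        ≤ B ^ 2 := fun k hk => by
    refine pow_le_pow_left₀ (norm_nonneg _) ?_ 2
    have := (hB D hD hA _ (hmem (k + 1) hk)).2 _ (hmem k (by omega))
    have e : |((k + 1 : ℕ) : ℝ) * (tF / K) - k * (tF / K)| = tF / K := by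
      rw [← sub_mul]
      push_cast
      rw [add_sub_cancel_left, one_mul, abs_of_pos hτ]
    rw [e] at this
    rw [norm_smul, norm_inv, Real.norm_of_nonneg hτ.le, inv_mul_le_iff₀ hτ, mul_comm (tF / K)]
    exact this
  -- The summed estimate begins at `n = 1`; the initial level is covered by the bound of the data.
  rcases Nat.eq_zero_or_pos n with rfl | hn0
  · have h0 := energy_nonneg p (s 0)
    have h0' : 0 ≤ 2 * p.μ₀ * ‖((s 0).M : L2v Ω)‖ ^ 2 := by positivity
    have h1 : 0 ≤ p.μ₀ * B ^ 2 + 2 * p.μ₀ * B ^ 2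
        + 3 * p.μ₀ / p.trel * (1 + p.κ₀ ^ 2) * B ^ 2 * tF + 3 * p.μ₀ * p.trel * (tF * B ^ 2) := by
      positivity
    refine ⟨by linarith, ?_⟩
    simp only [Finset.Icc_eq_empty_of_lt one_pos, Finset.sum_empty]
    linarith
  have hmain := hs.energy_le hb hη hηε htF hn0 hn
  have hnK : (n : ℝ) * (tF / K) ≤ tF := (hmem n hn).2
  have s1 : ∑ k ∈ Finset.Icc 1 n, 3 * p.μ₀ * (tF / K) / p.trel * (1 + p.κ₀ ^ 2)
      * ‖(Hk D dat (tF / K) k : L2v Ω)‖ ^ 2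
      ≤ 3 * p.μ₀ / p.trel * (1 + p.κ₀ ^ 2) * B ^ 2 * tF := by
    calc _ ≤ ∑ k ∈ Finset.Icc 1 n, 3 * p.μ₀ * (tF / K) / p.trel * (1 + p.κ₀ ^ 2) * B ^ 2 :=
          Finset.sum_le_sum fun k hk => mul_le_mul_of_nonneg_left
            (hH k ((Finset.mem_Icc.1 hk).2.trans hn)) (by positivity)
      _ = 3 * p.μ₀ / p.trel * (1 + p.κ₀ ^ 2) * B ^ 2 * (n * (tF / K)) := by
          rw [Finset.sum_const, Nat.card_Icc, Nat.add_sub_cancel, nsmul_eq_mul]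
          ring
      _ ≤ _ := by gcongr
  have s2 : ∑ k ∈ Finset.Icc 1 (n - 1), (tF / K)
      * ‖((tF / K)⁻¹ • (Hk D dat (tF / K) (k + 1) - Hk D dat (tF / K) k : D.M) : L2v Ω)‖ ^ 2
      ≤ tF * B ^ 2 := by
    calc _ ≤ ∑ k ∈ Finset.Icc 1 (n - 1), (tF / K) * B ^ 2 :=
          Finset.sum_le_sum fun k hk => mul_le_mul_of_nonneg_left
            (hδ k (by have := (Finset.mem_Icc.1 hk).2; omega)) hτ.le
      _ = ((n - 1 : ℕ) * (tF / K)) * B ^ 2 := by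
          rw [Finset.sum_const, Nat.card_Icc, Nat.add_sub_cancel, nsmul_eq_mul]
          ring
      _ ≤ _ := by
          gcongr
          exact (hmem (n - 1) (by omega)).2
  have s3 := mul_le_mul_of_nonneg_left s2 (by positivity : 0 ≤ 3 * p.μ₀ * p.trel)
  have s4 := mul_le_mul_of_nonneg_left (hH 1 hK) hμ.le
  have s5 := mul_le_mul_of_nonneg_left (hH n hn) (by positivity : 0 ≤ 2 * p.μ₀)
  have hrhs := hmain.trans (add_le_add (add_le_add (add_le_add (add_le_add hi s4) s5) s1) s3)
  have p1 := energy_nonneg p (s n)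
  have p2 : 0 ≤ p.μ₀ / 2 * ‖((s n).M : L2v Ω)‖ ^ 2 := by positivity
  have p3 : 0 ≤ ∑ k ∈ Finset.Icc 1 n,
      dissipation p (tF / K) (Hk D dat (tF / K) k) (s (k - 1)) (s k) := by
    refine Finset.sum_nonneg fun k _ => le_trans ?_ (norm_grad_le_dissipation p hτ _ _ _)
    have := p.lam_pos
    have := p.γ_pos
    have := p.ε_pos
    positivity
  exact ⟨(le_add_of_nonneg_right p2).trans ((le_add_of_nonneg_right p3).trans hrhs),
    (le_add_of_nonneg_left (add_nonneg p1 p2)).trans hrhs⟩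

/-- The chemical potential is bounded in `ℓ²(H¹)` uniformly in the discretization. -/
theorem exists_bound_potential (hb : Bornology.IsBounded Ω) (hΩ : IsOpen Ω) (p : Params)
    {η tF : ℝ} (hη : 0 < η) (hηε : η ≤ p.ε) (htF : 0 < tF)
    (dat : SmoothData Ω) (cI hmax : ℝ) (lG lM lU : ℕ) :
    ∃ c : ℝ, ∀ D : Discretization Ω, D.h ≤ hmax → D.Approximates cI lG lM lU →
      ∀ K : ℕ, 0 < K → ∀ s : ℕ → State D, IsSolution D p η tF dat K s →
        l2H1norm (tF / K) K s ≤ c := by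
  obtain ⟨R, hR⟩ := exists_bound_energy hb hΩ p hη hηε htF dat cI hmax lG lM lU
  have hl := p.lam_pos
  have hγ := p.γ_pos
  have hε := p.ε_pos
  let b := R * p.ε ^ 2 / (2 * p.lam)
  let C := p.ε ^ 2 * (R / p.lam) + 8 * b / p.ε ^ 2 + 16 * (b + (volume Ω).toReal) / η ^ 2
  refine ⟨Real.sqrt (2 * (R / (2 * p.lam * p.γ / p.ε)) + tF * C),
    fun D hD hA K hK s hs => Real.sqrt_le_sqrt ?_⟩
  have hK' : (0 : ℝ) < K := by exact_mod_cast hK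
  have hτ : 0 < tF / K := div_pos htF hK'
  have hb' := hR D hD hA K s hK hs
  have hg : ∀ n ≤ K, ‖grad ((s n).Φ : H1 Ω)‖ ^ 2 ≤ R / p.lam := fun n hn =>
    (norm_grad_sq_le_energy p (s n)).trans (by gcongr; exact (hb' n hn).1)
  have hp : ∀ n ≤ K, ∫ x in Ω, dwF (fn ((s n).Φ : H1 Ω) x) ≤ b := fun n hn =>
    (integral_dwF_le_energy p (s n)).trans (by simp only [b]; gcongr; exact (hb' n hn).1)
  -- The bound of `‖Ψ‖²` contains one more `‖∇Ψ‖²`, hence the factor `2`. The energy enters at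
  -- levels `k` and `k - 1`, thus also at level `0`.
  have hΨ : ∀ k ∈ Finset.Icc 1 K,
      tF / K * (‖fn ((s k).Ψ : H1 Ω)‖ ^ 2 + ‖grad ((s k).Ψ : H1 Ω)‖ ^ 2)
        ≤ 2 * (tF / K * ‖grad ((s k).Ψ : H1 Ω)‖ ^ 2) + tF / K * C := by
    intro k hk
    have h1 := (hs.step k hk).norm_potential_sq_le hb hη (hg k (Finset.mem_Icc.1 hk).2)
      (hp k (Finset.mem_Icc.1 hk).2) (hp (k - 1) (by have := (Finset.mem_Icc.1 hk).2; omega))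
    have h2 := mul_le_mul_of_nonneg_left h1 hτ.le
    simp only [C]
    linarith
  have hgr : ∑ k ∈ Finset.Icc 1 K, tF / K * ‖grad ((s k).Ψ : H1 Ω)‖ ^ 2
      ≤ R / (2 * p.lam * p.γ / p.ε) := by
    rw [le_div_iff₀ (by positivity), Finset.sum_mul]
    refine le_trans (Finset.sum_le_sum fun k _ => ?_) (hb' K le_rfl).2
    refine (le_of_eq ?_).trans (norm_grad_le_dissipation p hτ _ _ _)
    ring
  refine (Finset.sum_le_sum hΨ).trans ?_
  rw [Finset.sum_add_distrib, ← Finset.mul_sum, Finset.sum_const, Nat.card_Icc,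
    Nat.add_sub_cancel, nsmul_eq_mul]
  have e : (K : ℝ) * (tF / K * C) = tF * C := by field_simp
  rw [e]
  gcongr

end Potential

/-! ## Solvability of the whole scheme -/

section Existence

variable {d : ℕ} {Ω : Set (Sp d)}

theorem exists_isSolution {D : Discretization Ω} {p : Params} {η tF : ℝ} (dat : SmoothData Ω)
    (K : ℕ) (h : ∀ (H : D.M) (s' : State D), ∃ s : State D, IsStep D p η (tF / K) H s' s) :
    ∃ s : ℕ → State D, IsSolution D p η tF dat K s := by
  choose S hS using h
  -- The zeros stand for the potential and pressure of the initial level, which the first step does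
  -- not read.
  let s : ℕ → State D := fun n => Nat.rec
    ⟨D.IG (dat.φ0.restrict (closure Ω)), 0, D.IM (dat.m0.restrict (closure Ω)),
      D.IU (dat.u0.restrict (closure Ω)), 0⟩
    (fun k s' => S (Hk D dat (tF / K) (k + 1)) s') n
  refine ⟨s, rfl, rfl, rfl, fun k hk => ?_⟩
  obtain ⟨j, rfl⟩ : ∃ j, k = j + 1 := ⟨k - 1, by have := (Finset.mem_Icc.1 hk).1; omega⟩
  exact hS _ _

end Existence

end FerroScheme

/-! ### The proposition: existence, energy stability, mass and the potential -/

theorem proposition5 {d : ℕ} (hd : d = 2 ∨ d = 3) (Ω : Set (Sp d))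
    (hΩo : IsOpen Ω) (hΩc : Convex ℝ Ω) (hΩb : Bornology.IsBounded Ω) (hΩn : Ω.Nonempty)
    (p : Params) (η : ℝ) (hη : 0 < η) (hηε : η ≤ p.ε)
    (tF : ℝ) (htF : 0 < tF) (dat : SmoothData Ω) :
    (∀ (D : Discretization Ω) (K : ℕ), 0 < K →
      -- every step of the scheme is solvable, whatever the previous time level is
      (∀ k ∈ Finset.Icc 1 K, ∀ s' : State D,
        ∃ s : State D, IsStep D p η (tF / K) (Hk D dat (tF / K) k) s' s) ∧
      -- hence the whole scheme is solvable
      (∃ s : ℕ → State D, IsSolution D p η tF dat K s) ∧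
      ∀ s : ℕ → State D, IsSolution D p η tF dat K s →
        -- energy stability
        (energy p (s K) + p.μ₀ / 2 * ‖((s K).M : L2v Ω)‖ ^ 2
            + ∑ k ∈ Finset.Icc 1 K,
                dissipation p (tF / K) (Hk D dat (tF / K) k) (s (k - 1)) (s k)
          ≤ energy p (s 0) + 2 * p.μ₀ * ‖((s 0).M : L2v Ω)‖ ^ 2
            + p.μ₀ * ‖(Hk D dat (tF / K) 1 : L2v Ω)‖ ^ 2
            + 2 * p.μ₀ * ‖(Hk D dat (tF / K) K : L2v Ω)‖ ^ 2
            + ∑ k ∈ Finset.Icc 1 K, 3 * p.μ₀ * (tF / K) / p.trel * (1 + p.κ₀ ^ 2)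
                * ‖(Hk D dat (tF / K) k : L2v Ω)‖ ^ 2
            + 3 * p.μ₀ * p.trel * ∑ k ∈ Finset.Icc 1 (K - 1), (tF / K)
                * ‖((tF / K)⁻¹ • (Hk D dat (tF / K) (k + 1) - Hk D dat (tF / K) k : D.M) :
                    L2v Ω)‖ ^ 2) ∧
        -- conservation of mass
        (∀ k ∈ Finset.Icc 1 K,
          ∫ x in Ω, fn ((s k).Φ : H1 Ω) x = ∫ x in Ω, fn ((s 0).Φ : H1 Ω) x)) ∧
    -- bound of the chemical potential, uniform in the discretization parameters
    (∀ (cI hmax : ℝ) (lG lM lU : ℕ), ∃ c : ℝ, ∀ D : Discretization Ω, D.h ≤ hmax →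
      D.Approximates cI lG lM lU → ∀ K : ℕ, 0 < K →
      ∀ s : ℕ → State D, IsSolution D p η tF dat K s → l2H1norm (tF / K) K s ≤ c) := by
  have htau : ∀ K : ℕ, 0 < K → 0 < tF / K := fun K hK => div_pos htF (Nat.cast_pos.2 hK)
  have hstep : ∀ (D : Discretization Ω) (K : ℕ), 0 < K → ∀ (H : D.M) (s' : State D),
      ∃ s : State D, IsStep D p η (tF / K) H s' s := fun D K hK H s' =>
    exists_isStep hd hΩo hΩc hΩb hΩn D p hη (htau K hK) H s'
  refine ⟨fun D K hK => ⟨fun k _ s' => hstep D K hK _ s',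
    exists_isSolution dat K (hstep D K hK), fun s hs => ⟨?_, fun k hk => ?_⟩⟩, ?_⟩
  · exact hs.energy_le hΩb hη hηε htF hK le_rfl
  · exact hs.mass hΩo hΩb htF hK (Finset.mem_Icc.1 hk).2
  · exact exists_bound_potential hΩb hΩo p hη hηε htF dat
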